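/- \textbf{Quantale.} Let $\mathcal V$ be a commutative unital quantale with multiplication $\otimes$ and unit $k$, integral ($k=\top$), whose underlying complete lattice is continuous. For $x,y\in\mathcal V$ write $y\ll x$ if for every $X\subseteq\mathcal V$ with $x\le\bigvee X$ there is a finite $A\subseteq X$ with $y\le\bigvee A$; continuity says $x=\bigvee\{y\mid y\ll x\}$ for all $x$. Let $B\subseteq\mathcal V$ be a basis (for each $x$ the set $\{y\in B\mid y\ll x\}$ is directed with least upper bound $x$) that is closed under finite joins and $\otimes$ and contains $k$. \textbf{Calculus.} Types over a class $G$ of ground types: $A::=X\in G\mid I\mid A\otimes A\mid A\multimap A$. Let $\Sigma$ be a class of operation symbols $f:A_1,\dots,A_n\to A$ with $n\ge1$. Contexts are lists of typed variables without repeated variables. $\mathrm{Sf}(\Gamma_1;\dots;\Gamma_n)$ is the set of contexts that are permutations of $\Gamma_1,\dots,\Gamma_n$ preserving the relative order of the variables of each $\Gamma_i$. Terms (up to renaming of bound variables) and judgements $\Gamma\rhd v:A$ are given by the following rules, with $E\in\mathrm{Sf}(\Gamma_1;\dots;\Gamma_n)$ in the first one and $E\in\mathrm{Sf}(\Gamma;\Delta)$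 in the others that mention $E$: \begin{itemize} \item $E\rhd f(v_1,\dots,v_n):A$ if $\Gamma_i\rhd v_i:A_i$ for all $i$ and $f:A_1,\dots,A_n\to A$ is in $\Sigma$; \ $x:A\rhd x:A$; \ $-\rhd *:I$; \item $E\rhd v\ \mathtt{to}\ *.\,w:A$ if $\Gamma\rhd v:I$ and $\Delta\rhd w:A$; \ $E\rhd v\otimes w:A\otimes B$ if $\Gamma\rhd v:A$ and $\Delta\rhd w:B$; \item $E\rhd\mathtt{pm}\ v\ \mathtt{to}\ x\otimes y.\,w:C$ if $\Gamma\rhd v:A\otimes B$ and $\Delta,x:A,y:B\rhd w:C$; \item $\Gamma\rhd\lambda x:A.\,v:A\multimap B$ if $\Gamma,x:A\rhd v:B$; \ $E\rhd v\,w:B$ if $\Gamma\rhd v:A\multimap B$ and $\Delta\rhd w:A$. \end{itemize} \textbf{$\mathcal V$-equations.} A $\mathcal V$-equation-in-context $\Gamma\rhd v=_qw:A$ consists of $q\in B$ and terms with $\Gamma\rhd v:A$ and $\Gamma\rhd w:A$. Given a class $Ax$ of these (the axioms), let $Th(Ax)$ be the smallest class of $\mathcal V$-equations-in-context that contains $Ax$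 and is closed under (a) and (b). (a) The equations below, in every context in which they are well typed, where $v=w$ abbreviates $v=_\top w$ together with $w=_\top v$: \begin{gather*} \mathtt{pm}\ v\otimes w\ \mathtt{to}\ x\otimes y.\,u=u[v/x,w/y],\qquad \mathtt{pm}\ v\ \mathtt{to}\ x\otimes y.\,u[x\otimes y/z]=u[v/z],\\ *\ \mathtt{to}\ *.\,v=v,\qquad v\ \mathtt{to}\ *.\,w[*/z]=w[v/z],\qquad (\lambda x:A.\,v)\,w=v[w/x],\qquad \lambda x:A.\,(v\,x)=v,\\ u[v\ \mathtt{to}\ *.\,w/z]=v\ \mathtt{to}\ *.\,u[w/z],\qquad u[\mathtt{pm}\ v\ \mathtt{to}\ x\otimes y.\,w/z]=\mathtt{pm}\ v\ \mathtt{to}\ x\otimes y.\,u[w/z]. \end{gather*} (b) The $\mathcal V$-congruence rules (contexts and types being those of the term formation rules where omitted, and all labels in $B$): \begin{itemize} \item $v=_\top v$; \ from $v=_qw$ and $w=_ru$ infer $v=_{q\otimes r}u$; \ from $v=_qw$ and $r\le q$ infer $v=_rw$; \item from $v=_rw$ for all $r\in B$ with $r\ll q$ infer $v=_qw$; \ from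 $v=_{q_i}w$ for all $1\le i\le n$ ($n\ge0$) infer $v=_{\bigvee_iq_i}w$; \item from $v_i=_{q_i}w_i$ for $1\le i\le n$ infer $f(v_1,\dots,v_n)=_{q_1\otimes\dots\otimes q_n}f(w_1,\dots,w_n)$; \item from $v=_qw$ and $v'=_rw'$ infer $v\otimes v'=_{q\otimes r}w\otimes w'$, \ $\mathtt{pm}\ v\ \mathtt{to}\ x\otimes y.\,v'=_{q\otimes r}\mathtt{pm}\ w\ \mathtt{to}\ x\otimes y.\,w'$, \ $v\ \mathtt{to}\ *.\,v'=_{q\otimes r}w\ \mathtt{to}\ *.\,w'$, \ and $v\,v'=_{q\otimes r}w\,w'$; \ from $v=_qw$ infer $\lambda x:A.\,v=_q\lambda x:A.\,w$; \item from $\Gamma\rhd v=_qw:A$ infer $\Delta\rhd v=_qw:A$ for every permutation $\Delta$ of $\Gamma$; \ from $\Gamma,x:A\rhd v=_qw:A'$ and $\Delta\rhd v'=_rw':A$ infer $\Gamma,\Delta\rhd v[v'/x]=_{q\otimes r}w[w'/x]:A'$ (if $\Gamma,\Delta$ is a context). \end{itemize} \textbf{Models.} A $\mathcal V$-category is a class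 $X$ with $a:X\times X\to\mathcal V$ such that $k\le a(x,x)$ and $a(x,y)\otimes a(y,z)\le a(x,z)$; a $\mathcal V$-functor $f:(X,a)\to(Y,b)$ is a map with $a(x,y)\le b(f(x),f(y))$; and $(X,a)\otimes(Y,b)$ is $X\times Y$ with $((x,y),(x',y'))\mapsto a(x,x')\otimes b(y,y')$. A category is $\mathcal V\text{-}\mathsf{Cat}$-enriched if its hom-sets are $\mathcal V$-categories and each composition map $\mathsf C(X,Y)\otimes\mathsf C(Y,Z)\to\mathsf C(X,Z)$ is a $\mathcal V$-functor; a functor is a $\mathcal V\text{-}\mathsf{Cat}$-functor if its actions on homs are $\mathcal V$-functors; an adjunction is a $\mathcal V\text{-}\mathsf{Cat}$-adjunction if both functors are $\mathcal V\text{-}\mathsf{Cat}$-functors and the natural bijections of homs are $\mathcal V$-isomorphisms. A $\mathcal V\text{-}\mathsf{Cat}$-enriched autonomous category $\mathsf C$ is a symmetric monoidal closed, $\mathcal V\text{-}\mathsf{Cat}$-enriched category such that $\otimes:\mathsf C\times\mathsf C\to\mathsf C$ is a $\mathcal V\text{-}\mathsf{Cat}$-functor (homs of $\mathsf C\times\mathsf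 C$ carrying the tensor product structure) and each $(-\otimes X)\dashv(X\multimap-)$ is a $\mathcal V\text{-}\mathsf{Cat}$-adjunction. Choose an object $[\![X]\!]$ of $\mathsf C$ for each $X\in G$, extend this to types by the autonomous structure, put $[\![x_1:A_1,\dots,x_n:A_n]\!]=(\dots([\![A_1]\!]\otimes[\![A_2]\!])\otimes\dots)\otimes[\![A_n]\!]$ (the unit object $I$ if $n=0$), and choose a morphism $[\![f]\!]:(\dots([\![A_1]\!]\otimes[\![A_2]\!])\otimes\dots)\otimes[\![A_n]\!]\to[\![A]\!]$ for each $f:A_1,\dots,A_n\to A$ in $\Sigma$. Let $\mathrm{sh}_E:[\![E]\!]\to[\![\Gamma_1,\dots,\Gamma_n]\!]$ be the canonical permutation morphism, $\mathrm{sp}:[\![\Gamma_1,\dots,\Gamma_n]\!]\to[\![\Gamma_1]\!]\otimes\dots\otimes[\![\Gamma_n]\!]$ the canonical isomorphism and $\mathrm{jn}$ its inverse, $\mathrm{sw}$ the symmetry, $\alpha:X\otimes(Y\otimes Z)\to(X\otimes Y)\otimes Z$ the associator, $\lambda:I\otimes X\to X$ the left unitor, $\mathrm{app}:(X\multimap Y)\otimes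 X\to Y$ the application, and $\overline g:X\to(Y\multimap Z)$ the transpose of $g:X\otimes Y\to Z$. Judgements $\Gamma\rhd v:A$ are interpreted as morphisms $[\![\Gamma\rhd v:A]\!]:[\![\Gamma]\!]\to[\![A]\!]$ along their derivations, writing $m_i,m,n$ for the interpretations of the premises: \begin{gather*} [\![x]\!]=\mathrm{id},\qquad[\![*]\!]=\mathrm{id},\qquad[\![f(v_1,\dots,v_n)]\!]=[\![f]\!]\cdot(m_1\otimes\dots\otimes m_n)\cdot\mathrm{sp}\cdot\mathrm{sh}_E,\\ [\![v\ \mathtt{to}\ *.\,w]\!]=n\cdot\lambda\cdot(m\otimes\mathrm{id})\cdot\mathrm{sp}\cdot\mathrm{sh}_E,\qquad[\![v\otimes w]\!]=(m\otimes n)\cdot\mathrm{sp}\cdot\mathrm{sh}_E,\\ [\![\mathtt{pm}\ v\ \mathtt{to}\ x\otimes y.\,w]\!]=n\cdot\mathrm{jn}\cdot\alpha\cdot\mathrm{sw}\cdot(m\otimes\mathrm{id})\cdot\mathrm{sp}\cdot\mathrm{sh}_E,\\ [\![\lambda x:A.\,v]\!]=\overline{m\cdot\mathrm{jn}},\qquad[\![v\,w]\!]=\mathrm{app}\cdot(m\otimes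 n)\cdot\mathrm{sp}\cdot\mathrm{sh}_E. \end{gather*} A $\mathcal V$-equation $\Gamma\rhd v=_qw:A$ is satisfied by the interpretation if $a([\![\Gamma\rhd v:A]\!],[\![\Gamma\rhd w:A]\!])\ge q$, where $a$ is the $\mathcal V$-category structure of $\mathsf C([\![\Gamma]\!],[\![A]\!])$. \textbf{Theorem (soundness).} The equations (a) and the rules (b) are sound for every interpretation in a $\mathcal V\text{-}\mathsf{Cat}$-enriched autonomous category $\mathsf C$: if all $\mathcal V$-equations-in-context in $Ax$ are satisfied, then so is every $\mathcal V$-equation in $Th(Ax)$, that is, $\Gamma\rhd v:A$ and $\Gamma\rhd w:A$ hold and \[a([\![\Gamma\rhd v:A]\!],[\![\Gamma\rhd w:A]\!])\ge q\qquad\text{whenever }\Gamma\rhd v=_qw:A\text{ is in }Th(Ax).\] In particular (case $Ax=\emptyset$) this holds for every $\mathcal V$-equation that results from (a) and (b) alone. -/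

import Mathlib

open CategoryTheory MonoidalCategory

universe u v w u₁ v₁ u₂ v₂

/-! # Linear lambda-calculus with quantale-labelled equations -/

namespace LinLam

/-! ## Quantales: the way-below relation and bases -/

section Lattice

variable {L : Type w} [CompleteLattice L]

/-- `y` is way-below `x`: whenever `x ≤ ⋁ X`, there is a finite `A ⊆ X` with `y ≤ ⋁ A`. -/
def WayBelow (y x : L) : Prop :=
  ∀ X : Set L, x ≤ sSup X → ∃ A : Set L, A ⊆ X ∧ A.Finite ∧ y ≤ sSup A

variable (L) in
/-- The complete lattice `L` is continuous. -/
def IsContinuousLattice : Prop :=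
  ∀ x : L, x = sSup {y | WayBelow y x}

/-- `B` is a basis of `L`: for each `x`, the elements of `B` way-below `x` form a (non-empty)
directed set whose least upper bound is `x`. -/
def IsLatticeBasis (B : Set L) : Prop :=
  ∀ x : L, (B ∩ {y | WayBelow y x}).Nonempty ∧
    DirectedOn (· ≤ ·) (B ∩ {y | WayBelow y x}) ∧
    IsLUB (B ∩ {y | WayBelow y x}) x

end Lattice

/-! ## Categories over a quantale -/

section VCat

variable (V : Type w) [CommMonoid V] [CompleteLattice V]

/-- A `V`-category structure on `X`. -/
class VCategory (X : Type u) where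
  /-- the `V`-valued hom (generalised distance) -/
  a : X → X → V
  unit_le : ∀ x, 1 ≤ a x x
  mul_le : ∀ x y z, a x y * a y z ≤ a x z

/-- `f` is a `V`-functor. -/
def IsVFunctor {X : Type u} {Y : Type v} [VCategory V X] [VCategory V Y] (f : X → Y) : Prop :=
  ∀ x y, VCategory.a (V := V) x y ≤ VCategory.a (V := V) (f x) (f y)

/-- A bijection is a `V`-isomorphism when it and its inverse are `V`-functors. -/
def IsVIso {X : Type u} {Y : Type v} [VCategory V X] [VCategory V Y] (e : X ≃ Y) : Prop :=
  IsVFunctor V e ∧ IsVFunctor V e.symm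

/-- The tensor product of two `V`-categories. -/
instance VCategory.prod [IsQuantale V] (X : Type u) (Y : Type v)
    [VCategory V X] [VCategory V Y] : VCategory V (X × Y) where
  a p q := VCategory.a p.1 q.1 * VCategory.a p.2 q.2
  unit_le p := one_le_mul (VCategory.unit_le p.1) (VCategory.unit_le p.2)
  mul_le p q r := by
    rw [mul_mul_mul_comm]
    exact mul_le_mul' (VCategory.mul_le p.1 q.1 r.1) (VCategory.mul_le p.2 q.2 r.2)

/-- A `V-Cat`-enriched category: every hom-set is a `V`-category, and composition is a
`V`-functor from the tensor product. -/
class VCatEnriched [IsQuantale V] (C : Type u) [Category.{v} C] where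
  homVCat : ∀ X Y : C, VCategory V (X ⟶ Y)
  comp_isVFunctor : ∀ X Y Z : C,
    IsVFunctor V (fun p : (X ⟶ Y) × (Y ⟶ Z) => p.1 ≫ p.2)

attribute [reducible, instance] VCatEnriched.homVCat

variable [IsQuantale V]

/-- The product of two `V-Cat`-categories, with hom-objects the tensor products of
hom-objects. -/
instance VCatEnriched.prod (C : Type u₁) [Category.{v₁} C] (D : Type u₂) [Category.{v₂} D]
    [VCatEnriched V C] [VCatEnriched V D] : VCatEnriched V (C × D) where
  homVCat X Y := VCategory.prod V (X.1 ⟶ Y.1) (X.2 ⟶ Y.2)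
  comp_isVFunctor X Y Z p q := by
    have h1 := VCatEnriched.comp_isVFunctor (V := V) X.1 Y.1 Z.1 (p.1.1, p.2.1) (q.1.1, q.2.1)
    have h2 := VCatEnriched.comp_isVFunctor (V := V) X.2 Y.2 Z.2 (p.1.2, p.2.2) (q.1.2, q.2.2)
    refine le_trans (le_of_eq ?_) (mul_le_mul' h1 h2)
    exact mul_mul_mul_comm _ _ _ _

/-- A functor between `V-Cat`-categories is a `V-Cat`-functor if its action on each hom is a
`V`-functor. -/
def IsVCatFunctor {C : Type u₁} [Category.{v₁} C] {D : Type u₂} [Category.{v₂} D]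
    [VCatEnriched V C] [VCatEnriched V D] (F : C ⥤ D) : Prop :=
  ∀ X Y : C, IsVFunctor V (fun f : X ⟶ Y => F.map f)

/-- An adjunction is `V-Cat`-enriched if both functors are `V-Cat`-functors and the natural
bijections on homs are `V`-isomorphisms. -/
structure IsVCatAdjunction {C : Type u₁} [Category.{v₁} C] {D : Type u₂} [Category.{v₂} D]
    [VCatEnriched V C] [VCatEnriched V D] {F : C ⥤ D} {G : D ⥤ C} (adj : F ⊣ G) : Prop where
  left : IsVCatFunctor V F
  right : IsVCatFunctor V G
  homEquiv : ∀ (X : C) (Y : D), IsVIso V (adj.homEquiv X Y)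

end VCat

/-! ## Autonomous (symmetric monoidal closed) categories -/

section Autonomous

variable {C : Type u} [Category.{v} C] [MonoidalCategory C] [SymmetricCategory C]
  [MonoidalClosed C]

/-- The adjunction `(- ⊗ X) ⊣ (X ⊸ -)`. -/
def tensorHomAdj (X : C) : tensorRight X ⊣ ihom X :=
  (ihom.adjunction X).ofNatIsoLeft (BraidedCategory.tensorLeftIsoTensorRight X)

/-- The right transpose `X ⟶ (Y ⊸ Z)` of `f : X ⊗ Y ⟶ Z`. -/
def transpose {X Y Z : C} (f : X ⊗ Y ⟶ Z) : X ⟶ (ihom Y).obj Z :=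
  (tensorHomAdj Y).homEquiv X Z f

/-- The application `(X ⊸ Y) ⊗ X ⟶ Y`. -/
def appHom (X Y : C) : (ihom X).obj Y ⊗ X ⟶ Y :=
  (tensorHomAdj X).counit.app Y

variable (V : Type w) [CommMonoid V] [CompleteLattice V] [IsQuantale V]

variable (C) in
/-- A `V-Cat`-enriched autonomous category: a category that is autonomous and `V-Cat`-enriched,
such that the tensor bifunctor is a `V-Cat`-functor and each adjunction `(- ⊗ X) ⊣ (X ⊸ -)` is
`V-Cat`-enriched. -/
class VCatAutonomous [VCatEnriched V C] : Prop where
  tensor_isVCatFunctor : IsVCatFunctor V (MonoidalCategory.tensor C)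
  adj_isVCatAdjunction : ∀ X : C, IsVCatAdjunction V (tensorHomAdj X)

end Autonomous

/-! ## Types, signatures, terms -/

/-- Types over the ground types `G`. -/
inductive Ty (G : Type u) : Type u
  | base : G → Ty G
  | unit : Ty G
  | tensor : Ty G → Ty G → Ty G
  | lolli : Ty G → Ty G → Ty G

/-- Operation symbols `f : A₁, …, Aₙ → A` with `n ≥ 1`. -/
structure Signature (G : Type u) where
  Op : Type v
  arity : Op → ℕ
  arity_pos : ∀ f, 1 ≤ arity f
  dom : ∀ f, Fin (arity f) → Ty G
  cod : Op → Ty G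

variable {G : Type u}

/-- Terms up to renaming of bound variables. Free variables are named by natural numbers.
Binders are nameless: the body of `lam A v` refers to the bound variable as `0`, and to the
variable `n` of the surrounding scope as `n + 1`. In `letPair v w`, i.e.
`pm v to x ⊗ y. w`, the body `w` refers to `x` as `1`, to `y` as `0`, and to the variable `n` of
the surrounding scope as `n + 2`. The term `letUnit v w` is `v to *. w`. -/
inductive Tm (S : Signature.{u, v} G) : Type (max u v)
  | var : ℕ → Tm S
  | op : (f : S.Op) → (Fin (S.arity f) → Tm S) → Tm S
  | star : Tm S
  | letUnit : Tm S → Tm S → Tm S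
  | tensor : Tm S → Tm S → Tm S
  | letPair : Tm S → Tm S → Tm S
  | lam : Ty G → Tm S → Tm S
  | app : Tm S → Tm S → Tm S

namespace Tm

variable {S : Signature.{u, v} G}

/-- Extend a renaming under one binder. -/
def upRen (ρ : ℕ → ℕ) : ℕ → ℕ
  | 0 => 0
  | n + 1 => ρ n + 1

/-- Renaming of free variables. -/
def rename : (ℕ → ℕ) → Tm S → Tm S
  | ρ, var n => var (ρ n)
  | ρ, op f vs => op f (fun i => rename ρ (vs i))
  | _, star => star
  | ρ, letUnit v w => letUnit (rename ρ v) (rename ρ w)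
  | ρ, tensor v w => tensor (rename ρ v) (rename ρ w)
  | ρ, letPair v w => letPair (rename ρ v) (rename (upRen (upRen ρ)) w)
  | ρ, lam A v => lam A (rename (upRen ρ) v)
  | ρ, app v w => app (rename ρ v) (rename ρ w)

/-- Extend a substitution under one binder. -/
def upSub (σ : ℕ → Tm S) : ℕ → Tm S
  | 0 => var 0
  | n + 1 => rename Nat.succ (σ n)

/-- Simultaneous capture-avoiding substitution. -/
def subst : (ℕ → Tm S) → Tm S → Tm S
  | σ, var n => σ n
  | σ, op f vs => op f (fun i => subst σ (vs i))
  | _, star => star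
  | σ, letUnit v w => letUnit (subst σ v) (subst σ w)
  | σ, tensor v w => tensor (subst σ v) (subst σ w)
  | σ, letPair v w => letPair (subst σ v) (subst (upSub (upSub σ)) w)
  | σ, lam A v => lam A (subst (upSub σ) v)
  | σ, app v w => app (subst σ v) (subst σ w)

/-- `v[w/x]` for a free variable `x`. -/
def subst1 (v w : Tm S) (x : ℕ) : Tm S :=
  subst (Function.update var x w) v

/-- `v[w/x]` as a term in the scope of two further binders, in which `w` already lives: the
variables of `v` other than `x` are moved under the binders. -/
def subst1Under2 (v w : Tm S) (x : ℕ) : Tm S :=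
  subst (Function.update (fun n => var (n + 2)) x w) v

/-- `v[w/x]` for `v` the body of a `lam` binding `x`. -/
def inst (v w : Tm S) : Tm S :=
  subst (fun n => match n with
    | 0 => w
    | n + 1 => var n) v

/-- `u[v/x, w/y]` for `u` the body of a `letPair` binding `x` and `y`. -/
def inst2 (u v w : Tm S) : Tm S :=
  subst (fun n => match n with
    | 0 => w
    | 1 => v
    | n + 2 => var n) u

end Tm

/-! ## Contexts, shuffles and judgements -/

/-- Lists of typed variables. They are stored last variable first: the list
`x₁ : A₁, …, xₙ : Aₙ` is `[(xₙ, Aₙ), …, (x₁, A₁)]`. So `Γ, x : A` is `(x, A) :: Γ`. -/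
abbrev Ctx (G : Type u) := List (ℕ × Ty G)

namespace Ctx

/-- No variable occurs twice. -/
def Valid (Γ : Ctx G) : Prop := (Γ.map Prod.fst).Nodup

/-- The concatenation `Γ, Δ`. -/
abbrev cat (Γ Δ : Ctx G) : Ctx G := Δ ++ Γ

/-- The concatenation `Γ₁, …, Γₙ`. -/
def catN : (n : ℕ) → (Fin n → Ctx G) → Ctx G
  | 0, _ => []
  | 1, Γs => Γs 0
  | n + 2, Γs => cat (catN (n + 1) (fun i => Γs i.castSucc)) (Γs (Fin.last (n + 1)))

/-- The same typed variables, seen from inside `k` further binders. -/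
def lift (k : ℕ) (Γ : Ctx G) : Ctx G := Γ.map (fun p => (p.1 + k, p.2))

end Ctx

/-- `Insertion a E' E`: the list `E` arises from `E'` by inserting `a` at some position. -/
inductive Insertion {α : Type u} (a : α) : List α → List α → Type u
  | here (E : List α) : Insertion a E (a :: E)
  | there (b : α) {E' E : List α} : Insertion a E' E → Insertion a (b :: E') (b :: E)

/-- `Permutation E Γ`: the list `E` is a permutation of `Γ`. An element is a recipe for finding the
entries of `Γ` in `E` one after the other, so there is exactly one if the entries are distinct. -/
inductive Permutation {α : Type u} : List α → List α → Type u
  | nil : Permutation [] []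
  | cons {a : α} {E E' Γ : List α} :
      Insertion a E' E → Permutation E' Γ → Permutation E (a :: Γ)

/-- `E ∈ Sf(Γ; Δ)`. -/
structure Shuffle (Γ Δ E : Ctx G) where
  valid : E.Valid
  perm : Permutation E (Γ.cat Δ)
  left : Γ.Sublist E
  right : Δ.Sublist E

/-- `E ∈ Sf(Γ₁; …; Γₙ)`. -/
structure ShuffleN {n : ℕ} (Γs : Fin n → Ctx G) (E : Ctx G) where
  valid : E.Valid
  perm : Permutation E (Ctx.catN n Γs)
  sub : ∀ i, (Γs i).Sublist E

/-- Derivations of judgements `Γ ▷ v : A`. -/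
inductive Typed {S : Signature.{u, v} G} : Ctx G → Tm S → Ty G → Type (max u v)
  | ax {E : Ctx G} (f : S.Op) {Γs : Fin (S.arity f) → Ctx G} {vs : Fin (S.arity f) → Tm S} :
      (∀ i, Typed (Γs i) (vs i) (S.dom f i)) → ShuffleN Γs E → Typed E (.op f vs) (S.cod f)
  | hyp (x : ℕ) (A : Ty G) : Typed [(x, A)] (.var x) A
  | unitI : Typed [] .star .unit
  | unitE {Γ Δ E : Ctx G} {v w : Tm S} {A : Ty G} :
      Typed Γ v .unit → Typed Δ w A → Shuffle Γ Δ E → Typed E (.letUnit v w) A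
  | tensorI {Γ Δ E : Ctx G} {v w : Tm S} {A B : Ty G} :
      Typed Γ v A → Typed Δ w B → Shuffle Γ Δ E → Typed E (.tensor v w) (.tensor A B)
  | tensorE {Γ Δ E : Ctx G} {v w : Tm S} {A B D : Ty G} :
      Typed Γ v (.tensor A B) → Typed ((0, B) :: (1, A) :: Δ.lift 2) w D → Shuffle Γ Δ E →
      Typed E (.letPair v w) D
  | lolliI {Γ : Ctx G} {v : Tm S} {A B : Ty G} :
      Typed ((0, A) :: Γ.lift 1) v B → Typed Γ (.lam A v) (.lolli A B)
  | lolliE {Γ Δ E : Ctx G} {v w : Tm S} {A B : Ty G} :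
      Typed Γ v (.lolli A B) → Typed Δ w A → Shuffle Γ Δ E → Typed E (.app v w) B

/-! ## Interpretation in an autonomous category -/

section NTensor

variable {C : Type u} [Category.{v} C] [MonoidalCategory C]

/-- The `n`-tensor `(… (X₁ ⊗ X₂) ⊗ …) ⊗ Xₙ`. -/
def nTensor : (n : ℕ) → (Fin n → C) → C
  | 0, _ => 𝟙_ C
  | 1, X => X 0
  | n + 2, X => nTensor (n + 1) (fun i => X i.castSucc) ⊗ X (Fin.last (n + 1))

/-- The `n`-tensor of morphisms. -/
def nTensorHom : (n : ℕ) → {X Y : Fin n → C} → (∀ i, X i ⟶ Y i) → (nTensor n X ⟶ nTensor n Y)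
  | 0, _, _, _ => 𝟙 (𝟙_ C)
  | 1, _, _, m => m 0
  | n + 2, _, _, m => nTensorHom (n + 1) (fun i => m i.castSucc) ⊗ₘ m (Fin.last (n + 1))

end NTensor

section Semantics

variable {C : Type u₁} [Category.{v₁} C] [MonoidalCategory C] [MonoidalClosed C]

/-- The interpretation of types that extends the interpretation `g` of ground types. -/
def tyObj (g : G → C) : Ty G → C
  | .base X => g X
  | .unit => 𝟙_ C
  | .tensor A B => tyObj g A ⊗ tyObj g B
  | .lolli A B => (ihom (tyObj g A)).obj (tyObj g B)

variable (C) in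
/-- An interpretation of the ground types and the operation symbols. -/
structure Interpretation (S : Signature.{u, v} G) where
  ground : G → C
  op : ∀ f : S.Op,
    nTensor (S.arity f) (fun i => tyObj ground (S.dom f i)) ⟶ tyObj ground (S.cod f)

namespace Interpretation

variable {S : Signature.{u, v} G} (I : Interpretation C S)

/-- `⟦A⟧` -/
abbrev ty (A : Ty G) : C := tyObj I.ground A

/-- `⟦x₁ : A₁, …, xₙ : Aₙ⟧ = (… (⟦A₁⟧ ⊗ ⟦A₂⟧) ⊗ …) ⊗ ⟦Aₙ⟧`, and `⟦-⟧ = 𝟙_`. -/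
def ctx : Ctx G → C
  | [] => 𝟙_ C
  | [p] => I.ty p.2
  | p :: q :: Γ => ctx (q :: Γ) ⊗ I.ty p.2

/-- `⟦Γ, x : A⟧ ≅ ⟦Γ⟧ ⊗ ⟦A⟧`: split off the last variable. -/
def snocIso : (Γ : Ctx G) → (p : ℕ × Ty G) → (I.ctx (p :: Γ) ≅ I.ctx Γ ⊗ I.ty p.2)
  | [], p => (λ_ (I.ty p.2)).symm
  | q :: Γ, p => Iso.refl (I.ctx (q :: Γ) ⊗ I.ty p.2)

/-- `⟦Γ, Δ⟧ ≅ ⟦Γ⟧ ⊗ ⟦Δ⟧`: the forward morphism is the splitting morphism, its inverse the joining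
morphism. -/
def splitIso (Γ : Ctx G) : (Δ : Ctx G) → (I.ctx (Γ.cat Δ) ≅ I.ctx Γ ⊗ I.ctx Δ)
  | [] => (ρ_ (I.ctx Γ)).symm
  | p :: Δ =>
      I.snocIso (Γ.cat Δ) p ≪≫ whiskerRightIso (splitIso Γ Δ) (I.ty p.2) ≪≫
        α_ (I.ctx Γ) (I.ctx Δ) (I.ty p.2) ≪≫
        whiskerLeftIso (I.ctx Γ) (I.snocIso Δ p).symm

/-- The splitting morphism `⟦Γ₁, …, Γₙ⟧ ⟶ ⟦Γ₁⟧ ⊗ … ⊗ ⟦Γₙ⟧`. -/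
def splitN : (n : ℕ) → (Γs : Fin n → Ctx G) →
    (I.ctx (Ctx.catN n Γs) ⟶ nTensor n (fun i => I.ctx (Γs i)))
  | 0, _ => 𝟙 (𝟙_ C)
  | 1, Γs => 𝟙 (I.ctx (Γs 0))
  | n + 2, Γs =>
      (I.splitIso (Ctx.catN (n + 1) (fun i => Γs i.castSucc)) (Γs (Fin.last (n + 1)))).hom ≫
        (splitN (n + 1) (fun i => Γs i.castSucc) ▷ I.ctx (Γs (Fin.last (n + 1))))

/-- The interpretation of a context does not depend on the names of its variables. -/
theorem ctx_lift (k : ℕ) : ∀ Γ : Ctx G, I.ctx (Γ.lift k) = I.ctx Γ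
  | [] => rfl
  | [_] => rfl
  | p :: q :: Γ => congrArg (fun X => X ⊗ I.ty p.2) (ctx_lift k (q :: Γ))

/-- The joining morphism `⟦Γ⟧ ⊗ ⟦A⟧ ⟶ ⟦Γ, x : A⟧` for a bound variable `x`. -/
def joinBound (Γ : Ctx G) (A : Ty G) :
    I.ctx Γ ⊗ I.ty A ⟶ I.ctx ((0, A) :: Γ.lift 1) :=
  (eqToHom (I.ctx_lift 1 Γ).symm ▷ I.ty A) ≫ (I.snocIso (Γ.lift 1) (0, A)).inv

/-- The joining morphism `(⟦Γ⟧ ⊗ ⟦A⟧) ⊗ ⟦B⟧ ⟶ ⟦Γ, x : A, y : B⟧` for bound variables `x`, `y`. -/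
def joinBound2 (Γ : Ctx G) (A B : Ty G) :
    (I.ctx Γ ⊗ I.ty A) ⊗ I.ty B ⟶ I.ctx ((0, B) :: (1, A) :: Γ.lift 2) :=
  ((eqToHom (I.ctx_lift 2 Γ).symm ▷ I.ty A) ▷ I.ty B) ≫
    ((I.snocIso (Γ.lift 2) (1, A)).inv ▷ I.ty B) ≫
    (I.snocIso ((1, A) :: Γ.lift 2) (0, B)).inv

variable [SymmetricCategory C]

/-- `⟦E⟧ ⟶ ⟦E'⟧ ⊗ ⟦A⟧`: extract one variable of `E` by moving it past the later ones. -/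
def extractHom {p : ℕ × Ty G} :
    {E' E : Ctx G} → Insertion p E' E → (I.ctx E ⟶ I.ctx E' ⊗ I.ty p.2)
  | _, _, .here E => (I.snocIso E p).hom
  | _, _, .there q (E' := E') (E := E) i =>
      (I.snocIso E q).hom ≫ (extractHom i ▷ I.ty q.2) ≫
        (α_ (I.ctx E') (I.ty p.2) (I.ty q.2)).hom ≫
        (I.ctx E' ◁ (β_ (I.ty p.2) (I.ty q.2)).hom) ≫
        (α_ (I.ctx E') (I.ty q.2) (I.ty p.2)).inv ≫
        ((I.snocIso E' q).inv ▷ I.ty p.2)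

/-- The morphism `⟦E⟧ ⟶ ⟦Γ⟧` that permutes the variables of `E` into the order of `Γ`. -/
def permHom : {E Γ : Ctx G} → Permutation E Γ → (I.ctx E ⟶ I.ctx Γ)
  | _, _, .nil => 𝟙 (𝟙_ C)
  | _, _, .cons (a := p) (Γ := Γ) i π =>
      I.extractHom i ≫ (permHom π ▷ I.ty p.2) ≫ (I.snocIso Γ p).inv

/-- Shuffle, then split: `⟦E⟧ ⟶ ⟦Γ, Δ⟧ ⟶ ⟦Γ⟧ ⊗ ⟦Δ⟧`. -/
def shuffleSplit {Γ Δ E : Ctx G} (s : Shuffle Γ Δ E) : I.ctx E ⟶ I.ctx Γ ⊗ I.ctx Δ :=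
  I.permHom s.perm ≫ (I.splitIso Γ Δ).hom

/-- Shuffle, then split: `⟦E⟧ ⟶ ⟦Γ₁, …, Γₙ⟧ ⟶ ⟦Γ₁⟧ ⊗ … ⊗ ⟦Γₙ⟧`. -/
def shuffleSplitN {n : ℕ} {Γs : Fin n → Ctx G} {E : Ctx G} (s : ShuffleN Γs E) :
    I.ctx E ⟶ nTensor n (fun i => I.ctx (Γs i)) :=
  I.permHom s.perm ≫ I.splitN n Γs

/-- The interpretation `⟦Γ ▷ v : A⟧ : ⟦Γ⟧ ⟶ ⟦A⟧` of judgements. -/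
def den : {Γ : Ctx G} → {v : Tm S} → {A : Ty G} → Typed Γ v A → (I.ctx Γ ⟶ I.ty A)
  | _, _, _, .ax f d s =>
      I.shuffleSplitN s ≫ nTensorHom (S.arity f) (fun i => den (d i)) ≫ I.op f
  | _, _, _, .hyp _ A => 𝟙 (I.ty A)
  | _, _, _, .unitI => 𝟙 (𝟙_ C)
  | _, _, _, .unitE (Δ := Δ) m n s =>
      I.shuffleSplit s ≫ (den m ▷ I.ctx Δ) ≫ (λ_ (I.ctx Δ)).hom ≫ den n
  | _, _, _, .tensorI m n s => I.shuffleSplit s ≫ (den m ⊗ₘ den n)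
  | _, _, _, .tensorE (Δ := Δ) (A := A) (B := B) m n s =>
      I.shuffleSplit s ≫ (den m ▷ I.ctx Δ) ≫
        (β_ (I.ty A ⊗ I.ty B) (I.ctx Δ)).hom ≫
        (α_ (I.ctx Δ) (I.ty A) (I.ty B)).inv ≫
        I.joinBound2 Δ A B ≫ den n
  | _, _, _, .lolliI (Γ := Γ) (A := A) m => transpose (I.joinBound Γ A ≫ den m)
  | _, _, _, .lolliE (A := A) (B := B) m n s =>
      I.shuffleSplit s ≫ (den m ⊗ₘ den n) ≫ appHom (I.ty A) (I.ty B)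

end Interpretation

end Semantics

/-! ## The deductive system -/

section Deduction

variable {S : Signature.{u, v} G}

/-- The equations-in-context `F ▷ v = w : A` that correspond to the axiomatics of autonomous
categories. The context `F` of an equation is any context that consists of the variables of its
constituents. -/
inductive BaseEq : Ctx G → Tm S → Tm S → Ty G → Prop
  /-- `pm v ⊗ w to x ⊗ y. u = u[v/x, w/y]` -/
  | tensor_beta {Γ Δ E F : Ctx G} {u v w : Tm S} {A B D : Ty G} :
      Typed Γ v A → Typed Δ w B → Typed ((0, B) :: (1, A) :: E.lift 2) u D →
      F.Valid → F.Perm ((E.cat Γ).cat Δ) →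
      BaseEq F (.letPair (.tensor v w) u) (u.inst2 v w) D
  /-- `pm v to x ⊗ y. u[x ⊗ y / z] = u[v/z]` -/
  | tensor_eta {Γ Δ F : Ctx G} {u v : Tm S} {z : ℕ} {A B D : Ty G} :
      Typed Γ v (.tensor A B) → Typed ((z, .tensor A B) :: Δ) u D →
      F.Valid → F.Perm (Γ.cat Δ) →
      BaseEq F (.letPair v (u.subst1Under2 (.tensor (.var 1) (.var 0)) z)) (u.subst1 v z) D
  /-- `* to *. v = v` -/
  | unit_beta {Γ : Ctx G} {v : Tm S} {A : Ty G} :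
      Typed Γ v A → BaseEq Γ (.letUnit .star v) v A
  /-- `v to *. w[*/z] = w[v/z]` -/
  | unit_eta {Γ Δ F : Ctx G} {v w : Tm S} {z : ℕ} {A : Ty G} :
      Typed Γ v .unit → Typed ((z, .unit) :: Δ) w A →
      F.Valid → F.Perm (Γ.cat Δ) →
      BaseEq F (.letUnit v (w.subst1 .star z)) (w.subst1 v z) A
  /-- `(λ x : A. v) w = v[w/x]` -/
  | lolli_beta {Γ Δ F : Ctx G} {v w : Tm S} {A B : Ty G} :
      Typed ((0, A) :: Γ.lift 1) v B → Typed Δ w A →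
      F.Valid → F.Perm (Γ.cat Δ) →
      BaseEq F (.app (.lam A v) w) (v.inst w) B
  /-- `λ x : A. (v x) = v` -/
  | lolli_eta {Γ : Ctx G} {v : Tm S} {A B : Ty G} :
      Typed Γ v (.lolli A B) →
      BaseEq Γ (.lam A (.app (v.rename Nat.succ) (.var 0))) v (.lolli A B)
  /-- `u[v to *. w / z] = v to *. u[w/z]` -/
  | unit_comm {Γ Δ E F : Ctx G} {u v w : Tm S} {z : ℕ} {A B : Ty G} :
      Typed ((z, A) :: Γ) u B → Typed Δ v .unit → Typed E w A →
      F.Valid → F.Perm ((Γ.cat Δ).cat E) →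
      BaseEq F (u.subst1 (.letUnit v w) z) (.letUnit v (u.subst1 w z)) B
  /-- `u[pm v to x ⊗ y. w / z] = pm v to x ⊗ y. u[w/z]` -/
  | tensor_comm {Γ Δ E F : Ctx G} {u v w : Tm S} {z : ℕ} {A B D D' : Ty G} :
      Typed ((z, D) :: Γ) u D' → Typed Δ v (.tensor A B) →
      Typed ((0, B) :: (1, A) :: E.lift 2) w D →
      F.Valid → F.Perm ((Γ.cat Δ).cat E) →
      BaseEq F (u.subst1 (.letPair v w) z) (.letPair v (u.subst1Under2 w z)) D'

variable {V : Type w} [CommMonoid V] [CompleteLattice V]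

variable (S V) in
/-- The data of a `V`-equation `Γ ▷ v =_q w : A`. -/
structure VEquation where
  ctx : Ctx G
  lhs : Tm S
  rhs : Tm S
  ty : Ty G
  label : V

/-- A `V`-equation-in-context has a label in `B`, and both of its sides are typable. -/
def VEquation.InContext (B : Set V) (e : VEquation S V) : Prop :=
  e.label ∈ B ∧ Nonempty (Typed e.ctx e.lhs e.ty) ∧ Nonempty (Typed e.ctx e.rhs e.ty)

/-- `Th B Ax Γ v w A q`: the `V`-equation `Γ ▷ v =_q w : A` with `q ∈ B` is derivable from the
axioms `Ax` by the equations of `BaseEq` (each standing for two `V`-equations labelled by `⊤`) and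
the `V`-congruence rules. -/
inductive Th (B : Set V) (Ax : Set (VEquation S V)) :
    Ctx G → Tm S → Tm S → Ty G → V → Prop
  | ax {Γ : Ctx G} {v w : Tm S} {A : Ty G} {q : V} :
      ⟨Γ, v, w, A, q⟩ ∈ Ax → Th B Ax Γ v w A q
  | eq {Γ : Ctx G} {v w : Tm S} {A : Ty G} : BaseEq Γ v w A → Th B Ax Γ v w A ⊤
  | eq_symm {Γ : Ctx G} {v w : Tm S} {A : Ty G} : BaseEq Γ v w A → Th B Ax Γ w v A ⊤
  | refl {Γ : Ctx G} {v : Tm S} {A : Ty G} : Typed Γ v A → Th B Ax Γ v v A ⊤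
  | trans {Γ : Ctx G} {v w u : Tm S} {A : Ty G} {q r : V} :
      Th B Ax Γ v w A q → Th B Ax Γ w u A r → Th B Ax Γ v u A (q * r)
  | weak {Γ : Ctx G} {v w : Tm S} {A : Ty G} {q r : V} :
      Th B Ax Γ v w A q → r ∈ B → r ≤ q → Th B Ax Γ v w A r
  | arch {Γ : Ctx G} {v w : Tm S} {A : Ty G} {q : V} :
      q ∈ B → (∀ r ∈ B, WayBelow r q → Th B Ax Γ v w A r) → Th B Ax Γ v w A q
  | join {Γ : Ctx G} {v w : Tm S} {A : Ty G} {n : ℕ} {q : Fin n → V} :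
      Typed Γ v A → Typed Γ w A → (∀ i, Th B Ax Γ v w A (q i)) → Th B Ax Γ v w A (⨆ i, q i)
  | op {E : Ctx G} (f : S.Op) {Γs : Fin (S.arity f) → Ctx G} {vs ws : Fin (S.arity f) → Tm S}
      {q : Fin (S.arity f) → V} :
      (∀ i, Th B Ax (Γs i) (vs i) (ws i) (S.dom f i) (q i)) → ShuffleN Γs E →
      Th B Ax E (.op f vs) (.op f ws) (S.cod f) (∏ i, q i)
  | tensor {Γ Δ E : Ctx G} {v w v' w' : Tm S} {A A' : Ty G} {q r : V} :
      Th B Ax Γ v w A q → Th B Ax Δ v' w' A' r → Shuffle Γ Δ E →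
      Th B Ax E (.tensor v v') (.tensor w w') (.tensor A A') (q * r)
  | letPair {Γ Δ E : Ctx G} {v w v' w' : Tm S} {A A' D : Ty G} {q r : V} :
      Th B Ax Γ v w (.tensor A A') q →
      Th B Ax ((0, A') :: (1, A) :: Δ.lift 2) v' w' D r → Shuffle Γ Δ E →
      Th B Ax E (.letPair v v') (.letPair w w') D (q * r)
  | letUnit {Γ Δ E : Ctx G} {v w v' w' : Tm S} {A : Ty G} {q r : V} :
      Th B Ax Γ v w .unit q → Th B Ax Δ v' w' A r → Shuffle Γ Δ E →
      Th B Ax E (.letUnit v v') (.letUnit w w') A (q * r)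
  | lam {Γ : Ctx G} {v w : Tm S} {A A' : Ty G} {q : V} :
      Th B Ax ((0, A) :: Γ.lift 1) v w A' q →
      Th B Ax Γ (.lam A v) (.lam A w) (.lolli A A') q
  | app {Γ Δ E : Ctx G} {v w v' w' : Tm S} {A A' : Ty G} {q r : V} :
      Th B Ax Γ v w (.lolli A A') q → Th B Ax Δ v' w' A r → Shuffle Γ Δ E →
      Th B Ax E (.app v v') (.app w w') A' (q * r)
  | exchange {Γ Δ : Ctx G} {v w : Tm S} {A : Ty G} {q : V} :
      Th B Ax Γ v w A q → Δ.Perm Γ → Th B Ax Δ v w A q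
  | subst {Γ Δ : Ctx G} {v w v' w' : Tm S} {x : ℕ} {A A' : Ty G} {q r : V} :
      Th B Ax ((x, A) :: Γ) v w A' q → Th B Ax Δ v' w' A r → (Γ.cat Δ).Valid →
      Th B Ax (Γ.cat Δ) (v.subst1 v' x) (w.subst1 w' x) A' (q * r)

variable {C : Type u₁} [Category.{v₁} C] [MonoidalCategory C] [SymmetricCategory C]
  [MonoidalClosed C] [IsQuantale V] [VCatEnriched V C]

/-- The `V`-equation `Γ ▷ v =_q w : A` is satisfied: `a(⟦Γ ▷ v : A⟧, ⟦Γ ▷ w : A⟧) ≥ q`. -/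
def Interpretation.Satisfies (I : Interpretation C S) (e : VEquation S V) : Prop :=
  ∀ (d : Typed e.ctx e.lhs e.ty) (d' : Typed e.ctx e.rhs e.ty),
    VCategory.a (I.den d) (I.den d') ≥ e.label

end Deduction

end LinLam

open LinLam

/-! The theorem rests on two facts about the interpretation, one algebraic and one metric.

The metric fact settles most rules in (b). Every term constructor is interpreted by composing,
tensoring and transposing the interpretations of its parts with fixed structural morphisms.
Composition and tensor are `V`-functors on tensor products of homs, and transposition is a
`V`-functor because the adjunction is enriched. Since `1 ≤ a f f`, fixed morphisms cost nothing, so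
the labels of the premises multiply. Weakening, finite joins and the approximation rule are order
theory: an upper bound of the labels bounds their join, and `q` is the least upper bound of the
basis elements way below it.

The algebraic fact is that the interpretation depends on the judgement alone and turns substitution
into composition. Derivations are unique (`Typed.unique`): by linearity a context contains exactly
the free variables of its term, so the splitting of a context is forced, and a permutation of
distinct variables is determined by its source and target. Permuting the context precomposes with
the permutation morphism (`Interpretation.exchange`), renaming changes nothing essential
(`exists_den_rename`), and simultaneous substitution precomposes with the interpretation of the
substitution (`exists_den_subst`). The equations (a) then become identities of autonomous
categories: the adjunction bijection for functions, naturality, the hexagon and symmetry for pairs,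
and the unitors for the unit (`eqDen_of_baseEq`). The substitution rule in (b) also follows from the
substitution lemma.

The remaining work is coherence. Permutation morphisms are closed under composition, inversion and
concatenation, and they realise braidings and associators of split contexts. Hence every composite
of structural maps met here (`IsWire`) comes from a permutation, and two such permutations out of a
duplicate-free context agree. -/

namespace LinLam

/-! ### Exchanging two adjacent tensor factors -/

section Swap

variable {C : Type u₁} [Category.{v₁} C] [MonoidalCategory C] [SymmetricCategory C]

/-- Exchange of the last two factors. -/
def swapR (X A B : C) : (X ⊗ A) ⊗ B ⟶ (X ⊗ B) ⊗ A :=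
  (α_ X A B).hom ≫ (X ◁ (β_ A B).hom) ≫ (α_ X B A).inv

@[simp]
theorem swapR_swapR (X A B : C) : swapR X A B ≫ swapR X B A = 𝟙 _ := by
  simp [swapR, ← whiskerLeft_comp_assoc]

@[simp]
theorem swapR_swapR_assoc (X A B : C) {Z : C} (h : (X ⊗ A) ⊗ B ⟶ Z) :
    swapR X A B ≫ swapR X B A ≫ h = h := by
  rw [← Category.assoc, swapR_swapR, Category.id_comp]

theorem swapR_naturality {X X' A A' B B' : C} (f : X ⟶ X') (g : A ⟶ A') (h : B ⟶ B') :
    ((f ⊗ₘ g) ⊗ₘ h) ≫ swapR X' A' B' = swapR X A B ≫ ((f ⊗ₘ h) ⊗ₘ g) := by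
  simp only [swapR, Category.assoc, associator_naturality_assoc, ← associator_inv_naturality]
  simp only [← id_tensorHom, tensorHom_comp_tensorHom_assoc, BraidedCategory.braiding_naturality,
    Category.comp_id, Category.id_comp]

theorem swapR_naturality_left {X X' : C} (f : X ⟶ X') (A B : C) :
    (f ▷ A) ▷ B ≫ swapR X' A B = swapR X A B ≫ (f ▷ B) ▷ A := by
  simpa using swapR_naturality f (𝟙 A) (𝟙 B)

theorem swapR_naturality_left_assoc {X X' : C} (f : X ⟶ X') (A B : C) {Z : C}
    (h : (X' ⊗ B) ⊗ A ⟶ Z) :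
    (f ▷ A) ▷ B ≫ swapR X' A B ≫ h = swapR X A B ≫ (f ▷ B) ▷ A ≫ h := by
  rw [← Category.assoc, swapR_naturality_left, Category.assoc]

/-- Up to associators both sides are `X` whiskered with the two sides of the Yang–Baxter identity of
the braiding. -/
theorem swapR_yang_baxter (X A B D : C) :
    swapR X A B ▷ D ≫ swapR (X ⊗ B) A D ≫ swapR X B D ▷ A =
      swapR (X ⊗ A) B D ≫ swapR X A D ▷ B ≫ swapR (X ⊗ D) A B := by
  have h := BraidedCategory.yang_baxter' A B D
  calc _ = 𝟙 _ ⊗≫ X ◁ ((β_ A B).hom ▷ D ⊗≫ B ◁ (β_ A D).hom ⊗≫ (β_ B D).hom ▷ A) ⊗≫ 𝟙 _ := by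
        simp only [swapR]; monoidal
    _ = _ := by rw [h]; simp only [swapR]; monoidal

end Swap

/-! ## Permutations of lists as data -/

section Perm

variable {α : Type u}

theorem Insertion.perm {a : α} {E' E : List α} : Insertion a E' E → E.Perm (a :: E')
  | .here _ => List.Perm.refl _
  | .there b i => (i.perm.cons b).trans (.swap _ _ _)

theorem Permutation.toPerm {E Γ : List α} : Permutation E Γ → E.Perm Γ
  | .nil => .nil
  | .cons i π => i.perm.trans (π.toPerm.cons _)

/-- The last entry, kept in its place. -/
def Permutation.refl : (E : List α) → Permutation E E
  | [] => .nil
  | _ :: E => .cons (.here E) (Permutation.refl E)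

/-- The insertion that `l₁` preceding the insertion point describes. -/
def Insertion.middle {a : α} : (l₁ l₂ : List α) → Insertion a (l₁ ++ l₂) (l₁ ++ a :: l₂)
  | [], l₂ => .here l₂
  | b :: l₁, l₂ => .there b (Insertion.middle l₁ l₂)

/-- Locate the head of `Γ` in `E`, remove it, and recurse. Repeated entries would leave a choice, so
only existence is claimed. -/
theorem Permutation.exists_of_perm : ∀ {Γ E : List α}, E.Perm Γ → Nonempty (Permutation E Γ)
  | [], E, h => by
      obtain rfl := h.eq_nil
      exact ⟨.nil⟩
  | a :: Γ, E, h => by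
      obtain ⟨l₁, l₂, rfl⟩ := List.append_of_mem (h.symm.subset (List.mem_cons_self ..))
      have h' : (l₁ ++ l₂).Perm Γ := (List.perm_middle.symm.trans h).cons_inv
      obtain ⟨π⟩ := Permutation.exists_of_perm h'
      exact ⟨.cons (.middle l₁ l₂) π⟩

/-- When entries are distinct, `a` no longer occurs after its removal, so it was found at the only
possible position. The remainder is an index of the family, hence the heterogeneous equality. -/
theorem Insertion.unique {a : α} {E' E'' E : List α} (hE : E.Nodup) (i : Insertion a E' E)
    (j : Insertion a E'' E) : E' = E'' ∧ HEq i j := by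
  induction i generalizing E'' with
  | here E =>
    cases j with
    | here => exact ⟨rfl, .rfl⟩
    | there _ j => exact absurd (j.perm.symm.subset (List.mem_cons_self ..)) (List.nodup_cons.1 hE).1
  | there b i ih =>
    cases j with
    | here => exact absurd (i.perm.symm.subset (List.mem_cons_self ..)) (List.nodup_cons.1 hE).1
    | there _ j =>
      obtain ⟨rfl, h⟩ := ih (List.nodup_cons.1 hE).2 j
      obtain rfl := eq_of_heq h
      exact ⟨rfl, .rfl⟩

/-- This is how coherence maps obtained in different ways are compared: out of a duplicate-free
context there is nothing to choose. -/
theorem Permutation.unique {E Γ : List α} (hE : E.Nodup) (π π' : Permutation E Γ) : π = π' := by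
  induction π with
  | nil => cases π'; rfl
  | cons i π ih =>
    cases π' with
    | cons j π' =>
      obtain ⟨rfl, h⟩ := i.unique hE j
      obtain rfl := eq_of_heq h
      rw [ih (List.nodup_cons.1 (i.perm.nodup_iff.1 hE)).2 π']

/-- An insertion into the later part of a concatenation. -/
def Insertion.appendLeft {a : α} {E' E : List α} (l : List α) :
    Insertion a E' E → Insertion a (E' ++ l) (E ++ l)
  | .here _ => .here _
  | .there b i => .there b (i.appendLeft l)

/-- An insertion into the earlier part of a concatenation. -/
def Insertion.appendRight {a : α} {E' E : List α} (i : Insertion a E' E) :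
    (l : List α) → Insertion a (l ++ E') (l ++ E)
  | [] => i
  | b :: l => .there b (i.appendRight l)

end Perm

variable {G : Type u} {S : Signature.{u, v} G}

theorem Ctx.Valid.nodup {Γ : Ctx G} (h : Γ.Valid) : Γ.Nodup := List.Nodup.of_map _ h

theorem Ctx.Valid.of_perm {Γ Δ : Ctx G} (h : Γ.Valid) (p : Γ.Perm Δ) : Δ.Valid :=
  (p.map Prod.fst).nodup_iff.1 h

variable {C : Type u₁} [Category.{v₁} C] [MonoidalCategory C] [MonoidalClosed C]
  [SymmetricCategory C]

/-! ### Permutation morphisms compose and have inverses -/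

namespace Interpretation

variable (I : Interpretation C S)

theorem extractHom_here (E : Ctx G) (p : ℕ × Ty G) :
    I.extractHom (.here E : Insertion p E (p :: E)) = (I.snocIso E p).hom := rfl

theorem extractHom_there {p : ℕ × Ty G} {E' E : Ctx G} (q : ℕ × Ty G) (i : Insertion p E' E) :
    I.extractHom (.there q i) = (I.snocIso E q).hom ≫ (I.extractHom i ▷ I.ty q.2) ≫
      swapR _ _ _ ≫ ((I.snocIso E' q).inv ▷ I.ty p.2) := by
  simp [extractHom, swapR]

theorem permHom_cons {p : ℕ × Ty G} {E' E Γ : Ctx G} (i : Insertion p E' E)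
    (π : Permutation E' Γ) :
    I.permHom (.cons i π) = I.extractHom i ≫ (I.permHom π ▷ I.ty p.2) ≫ (I.snocIso Γ p).inv :=
  rfl

@[simp]
theorem permHom_refl : ∀ E : Ctx G, I.permHom (.refl E) = 𝟙 _
  | [] => rfl
  | p :: E => by simp [Permutation.refl, permHom_cons, extractHom_here, permHom_refl E]

/-- Two successive extractions can be done in the other order. -/
theorem extractHom_comm {a b : ℕ × Ty G} {E E₁ E₂ : Ctx G} (i : Insertion a E₁ E)
    (j : Insertion b E₂ E₁) :
    ∃ (F : Ctx G) (i' : Insertion b F E) (j' : Insertion a E₂ F),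
      I.extractHom i ≫ I.extractHom j ▷ I.ty a.2 ≫ swapR _ _ _ =
        I.extractHom i' ≫ I.extractHom j' ▷ I.ty b.2 := by
  induction i generalizing E₂ with
  | here E =>
    exact ⟨_, .there a j, .here E₂, by
      simp [extractHom_here, extractHom_there, ← comp_whiskerRight]⟩
  | there c i ih =>
    cases j with
    | here =>
      exact ⟨_, .here _, i, by
        simp [extractHom_here, extractHom_there, ← comp_whiskerRight_assoc]⟩
    | there _ j =>
      obtain ⟨F, i', j', h⟩ := ih j
      refine ⟨_, .there c i', .there c j', ?_⟩
      simp only [extractHom_there, Category.assoc, comp_whiskerRight,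
        ← comp_whiskerRight_assoc _ (I.snocIso _ c).hom, Iso.inv_hom_id, id_whiskerRight,
        Category.id_comp, swapR_naturality_left]
      have h' := congrArg (fun f => f ▷ I.ty c.2) h
      simp only [comp_whiskerRight] at h'
      -- Both extracted variables pass `c`, and they are also exchanged with each other; Yang–Baxter
      -- makes the order of these three swaps irrelevant.
      rw [← swapR_naturality_left_assoc, ← reassoc_of% swapR_yang_baxter, reassoc_of% h', swapR_naturality_left_assoc]

/-- An extraction from the target of a permutation can be done first. -/
theorem permHom_extractHom {a : ℕ × Ty G} {E Γ Γ' : Ctx G} (π : Permutation E Γ)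
    (i : Insertion a Γ' Γ) :
    ∃ (E' : Ctx G) (j : Insertion a E' E) (π' : Permutation E' Γ'),
      I.permHom π ≫ I.extractHom i = I.extractHom j ≫ I.permHom π' ▷ I.ty a.2 := by
  induction i generalizing E with
  | here Γ =>
    cases π with
    | cons j π => exact ⟨_, j, π, by simp [permHom_cons, extractHom_here]⟩
  | there b i ih =>
    cases π with
    | cons j π =>
      obtain ⟨E', j₁, π₁, h₁⟩ := ih π
      obtain ⟨F, i', j', h₂⟩ := I.extractHom_comm j j₁
      refine ⟨F, i', .cons j' π₁, ?_⟩
      simp only [permHom_cons, extractHom_there, Category.assoc, Iso.inv_hom_id_assoc,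
        comp_whiskerRight]
      rw [← comp_whiskerRight_assoc, h₁, comp_whiskerRight_assoc, ← reassoc_of% h₂,
        swapR_naturality_left_assoc]

/-- Induction on the second permutation: its first extraction is carried back across the first
permutation by `permHom_extractHom`, which leaves a shorter problem. -/
theorem permHom_trans {E F Γ : Ctx G} (π : Permutation E F) (π' : Permutation F Γ) :
    ∃ π'' : Permutation E Γ, I.permHom π'' = I.permHom π ≫ I.permHom π' := by
  induction π' generalizing E with
  | nil => cases π; exact ⟨.nil, (Category.id_comp _).symm⟩
  | cons i π' ih =>
    obtain ⟨E', j, π₁, h⟩ := I.permHom_extractHom π i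
    obtain ⟨π₂, h₂⟩ := ih π₁
    exact ⟨.cons j π₂, by simp [permHom_cons, h₂, reassoc_of% h]⟩

/-- The step for inverses: a last variable can be sent back to the place from which it was
extracted. -/
theorem permHom_cons_extractHom {a : ℕ × Ty G} {Γ E' E : Ctx G} (π : Permutation Γ E')
    (i : Insertion a E' E) :
    ∃ π' : Permutation (a :: Γ) E,
      I.permHom π' ≫ I.extractHom i = (I.snocIso Γ a).hom ≫ I.permHom π ▷ I.ty a.2 := by
  induction i generalizing Γ with
  | here E => exact ⟨.cons (.here _) π, by simp [permHom_cons, extractHom_here]⟩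
  | there b i ih =>
    cases π with
    | cons j π =>
      obtain ⟨π', h⟩ := ih π
      refine ⟨.cons (.there a j) π', ?_⟩
      simp only [permHom_cons, extractHom_there, Category.assoc, Iso.inv_hom_id_assoc,
        comp_whiskerRight]
      rw [← comp_whiskerRight_assoc (I.permHom π'), h]
      simp [swapR_naturality_left_assoc]

theorem permHom_symm {E Γ : Ctx G} (π : Permutation E Γ) :
    ∃ π' : Permutation Γ E, I.permHom π' ≫ I.permHom π = 𝟙 _ := by
  induction π with
  | nil => exact ⟨.nil, Category.id_comp _⟩
  | cons i π ih =>
    obtain ⟨π', h⟩ := ih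
    obtain ⟨π'', h'⟩ := I.permHom_cons_extractHom π' i
    refine ⟨π'', ?_⟩
    rw [permHom_cons, reassoc_of% h', ← comp_whiskerRight_assoc, h]
    simp

/-- The left inverse `π₁` has a left inverse `π₂` of its own, and the usual cancellation identifies
`π₂` with `π`. Distinctness of the entries is not needed. -/
theorem permHom_symm' {E Γ : Ctx G} (π : Permutation E Γ) :
    ∃ π' : Permutation Γ E, I.permHom π ≫ I.permHom π' = 𝟙 _ := by
  obtain ⟨π₁, h₁⟩ := I.permHom_symm π
  obtain ⟨π₂, h₂⟩ := I.permHom_symm π₁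
  have : I.permHom π₂ = I.permHom π := by
    rw [← Category.comp_id (I.permHom π₂), ← h₁, reassoc_of% h₂]
  exact ⟨π₁, this ▸ h₂⟩

end Interpretation

end LinLam

/-! ### Permutation morphisms and the splitting of contexts -/

namespace LinLam

section Swap

variable {C : Type u₁} [Category.{v₁} C] [MonoidalCategory C] [SymmetricCategory C]

/-- The hexagon: passing a tensor product is passing its factors one by one. -/
theorem swapR_tensor (X A B D : C) :
    (α_ (X ⊗ A) B D).inv ≫ swapR X A B ▷ D ≫ swapR (X ⊗ B) A D ≫ (α_ X B D).hom ▷ A =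
      swapR X A (B ⊗ D) := by
  simp only [swapR, BraidedCategory.braiding_tensor_right_hom]
  monoidal

theorem swapR_unit (X A : C) : swapR X A (𝟙_ C) = (ρ_ (X ⊗ A)).hom ≫ (ρ_ X).inv ▷ A := by
  simp only [swapR, braiding_tensorUnit_right]
  monoidal

end Swap

variable {G : Type u} {S : Signature.{u, v} G}
variable {C : Type u₁} [Category.{v₁} C] [MonoidalCategory C] [MonoidalClosed C]

namespace Interpretation

variable (I : Interpretation C S)

theorem splitIso_nil_hom (Γ : Ctx G) : (I.splitIso Γ []).hom = (ρ_ (I.ctx Γ)).inv := rfl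

theorem splitIso_cons_hom (Γ Δ : Ctx G) (p : ℕ × Ty G) :
    (I.splitIso Γ (p :: Δ)).hom = (I.snocIso (Γ.cat Δ) p).hom ≫ (I.splitIso Γ Δ).hom ▷ I.ty p.2 ≫
      (α_ _ _ _).hom ≫ I.ctx Γ ◁ (I.snocIso Δ p).inv := by
  simp [splitIso]

theorem splitIso_singleton (Γ : Ctx G) (p : ℕ × Ty G) :
    (I.splitIso Γ [p]).hom = (I.snocIso Γ p).hom := by
  rw [splitIso_cons_hom, splitIso_nil_hom]
  -- `I.ctx [p]` and `I.ty p.2` agree only by unfolding, so the identity is proved in a form that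
  -- simplification can handle and is then matched by `exact`. The abstract `key` statements about
  -- morphisms below serve the same purpose.
  have : ∀ {X : C} (f : X ⟶ I.ctx Γ ⊗ I.ty p.2), f ≫ (ρ_ (I.ctx Γ)).inv ▷ I.ty p.2 ≫
      (α_ _ _ _).hom ≫ I.ctx Γ ◁ (λ_ (I.ty p.2)).hom = f := by
    simp
  exact this _

variable [SymmetricCategory C]

/-- A variable of the later part moves only past later variables of that part; `Γ` is a spectator
and only reassociation remains. -/
theorem extractHom_appendLeft {p : ℕ × Ty G} {E' E : Ctx G} (Γ : Ctx G) (i : Insertion p E' E) :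
    I.extractHom (i.appendLeft Γ) ≫ (I.splitIso Γ E').hom ▷ I.ty p.2 =
      (I.splitIso Γ E).hom ≫ I.ctx Γ ◁ I.extractHom i ≫ (α_ _ _ _).inv := by
  induction i with
  | here E =>
    simp [Insertion.appendLeft, extractHom_here, splitIso_cons_hom]
  | there q i ih =>
    rename_i E' E
    have h : ∀ X A B D : C, (swapR (X ⊗ A) B D) ≫ (α_ X A D).hom ▷ B =
        (α_ X A B).hom ▷ D ≫ (α_ X (A ⊗ B) D).hom ≫ X ◁ swapR A B D ≫ (α_ X (A ⊗ D) B).inv := by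
      intro X A B D
      simp only [swapR]
      monoidal
    simp only [Insertion.appendLeft, extractHom_there, splitIso_cons_hom, Category.assoc,
      comp_whiskerRight, MonoidalCategory.whiskerLeft_comp]
    rw [← comp_whiskerRight_assoc (I.snocIso (List.append E' Γ) q).inv]
    erw [Iso.inv_hom_id]
    simp only [id_whiskerRight, Category.id_comp]
    erw [← swapR_naturality_left_assoc]
    rw [← comp_whiskerRight_assoc, ih, reassoc_of% h]
    simp

/-- A variable of the earlier part has to pass all of `Δ`; `swapR_tensor` assembles the single swaps
into one swap with `I.ctx Δ`. -/
theorem extractHom_appendRight {p : ℕ × Ty G} {E' E : Ctx G} (i : Insertion p E' E) :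
    ∀ Δ : Ctx G, I.extractHom (i.appendRight Δ) ≫ (I.splitIso E' Δ).hom ▷ I.ty p.2 =
      (I.splitIso E Δ).hom ≫ I.extractHom i ▷ I.ctx Δ ≫ swapR _ _ _
  | [] => by
    change _ = (ρ_ (I.ctx E)).inv ≫ I.extractHom i ▷ 𝟙_ C ≫ swapR _ _ (𝟙_ C)
    rw [swapR_unit]
    simp [Insertion.appendRight, splitIso_nil_hom]
    rfl
  | q :: Δ => by
    have ih := extractHom_appendRight i Δ
    simp only [Insertion.appendRight, extractHom_there, splitIso_cons_hom, Category.assoc,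
      comp_whiskerRight]
    rw [← comp_whiskerRight_assoc (I.snocIso (List.append Δ E') q).inv]
    erw [Iso.inv_hom_id]
    simp only [id_whiskerRight, Category.id_comp]
    erw [← swapR_naturality_left_assoc]
    rw [← comp_whiskerRight_assoc, ih]
    have h := swapR_naturality (𝟙 (I.ctx E')) (𝟙 (I.ty p.2)) (I.snocIso Δ q).inv
    simp only [id_tensorHom, tensorHom_id, id_whiskerRight] at h
    rw [whisker_exchange_assoc, h, ← swapR_tensor]
    simp

theorem permHom_cat {E Γ : Ctx G} (π : Permutation E Γ) {E' Δ : Ctx G} (π' : Permutation E' Δ) :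
    ∃ π'' : Permutation (E.cat E') (Γ.cat Δ), I.permHom π'' ≫ (I.splitIso Γ Δ).hom =
      (I.splitIso E E').hom ≫ (I.permHom π ⊗ₘ I.permHom π') := by
  induction π' with
  | nil =>
    refine ⟨π, ?_⟩
    change _ = (ρ_ (I.ctx E)).inv ≫ (I.permHom π ⊗ₘ 𝟙 (𝟙_ C))
    simp [splitIso_nil_hom]
    rfl
  | cons i π' ih =>
    obtain ⟨π₁, h⟩ := ih
    refine ⟨.cons (i.appendLeft E) π₁, ?_⟩
    simp only [permHom_cons, splitIso_cons_hom, Category.assoc]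
    erw [Iso.inv_hom_id_assoc]
    rw [← comp_whiskerRight_assoc, h, comp_whiskerRight_assoc,
      reassoc_of% I.extractHom_appendLeft]
    rw [MonoidalCategory.tensorHom_def, MonoidalCategory.tensorHom_def]
    simp only [Category.assoc, comp_whiskerRight, MonoidalCategory.whiskerLeft_comp]
    simp [← whisker_exchange_assoc]

/-- `Ctx.cat [] Γ` equals `Γ`, but not by computation, so the unit law is realised by a permutation
instead of a transport. `permHom_cat_assoc` treats associativity in the same way. -/
theorem permHom_nil_cat : ∀ Γ : Ctx G, ∃ π : Permutation (Ctx.cat [] Γ) Γ,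
    I.permHom π = (I.splitIso [] Γ).hom ≫ (λ_ (I.ctx Γ)).hom
  | [] => ⟨.nil, by
    change 𝟙 (𝟙_ C) = (ρ_ (𝟙_ C)).inv ≫ (λ_ (𝟙_ C)).hom
    simp [unitors_equal]⟩
  | p :: Γ => by
    obtain ⟨π, h⟩ := permHom_nil_cat Γ
    refine ⟨.cons (.here _) π, ?_⟩
    rw [permHom_cons, extractHom_here, splitIso_cons_hom, h]
    have h₁ : ∀ {X A D : C} (f : X ⟶ 𝟙_ C ⊗ A) (g : A ⊗ I.ty p.2 ⟶ D),
        (f ≫ (λ_ A).hom) ▷ I.ty p.2 ≫ g =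
          f ▷ I.ty p.2 ≫ (α_ _ _ _).hom ≫ 𝟙_ C ◁ g ≫ (λ_ D).hom := by
      intros; simp
    have h₂ : ∀ {X₁ X₂ X₃ X₄ X₅ X₆ : C} (f₁ : X₁ ⟶ X₂) (f₂ : X₂ ⟶ X₃) (f₃ : X₃ ⟶ X₄) (f₄ : X₄ ⟶ X₅)
        (f₅ : X₅ ⟶ X₆), (f₁ ≫ f₂ ≫ f₃ ≫ f₄) ≫ f₅ = f₁ ≫ f₂ ≫ f₃ ≫ f₄ ≫ f₅ := by
      intros; simp
    exact (congrArg _ (h₁ _ _)).trans (h₂ _ _ _ _ _).symm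

/-- The last variable of `Γ` crosses `Δ`, the others follow by induction, and the hexagon (`hex`)
joins the two crossings into one braiding. -/
theorem permHom_cat_comm (Δ : Ctx G) : ∀ Γ : Ctx G,
    ∃ π : Permutation (Γ.cat Δ) (Δ.cat Γ), I.permHom π ≫ (I.splitIso Δ Γ).hom =
      (I.splitIso Γ Δ).hom ≫ (β_ (I.ctx Γ) (I.ctx Δ)).hom
  | [] => by
    obtain ⟨π, h⟩ := I.permHom_nil_cat Δ
    refine ⟨π, ?_⟩
    change _ = (I.splitIso [] Δ).hom ≫ (β_ (𝟙_ C) (I.ctx Δ)).hom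
    rw [h, splitIso_nil_hom, braiding_tensorUnit_left]
    exact Category.assoc _ _ _
  | p :: Γ => by
    obtain ⟨π, h⟩ := permHom_cat_comm Δ Γ
    refine ⟨.cons ((Insertion.here Γ).appendRight Δ) π, ?_⟩
    have hex : ∀ X A B : C, swapR X A B ≫ (β_ X B).hom ▷ A ≫ (α_ B X A).hom =
        (β_ (X ⊗ A) B).hom := by
      intro X A B
      simp [swapR, BraidedCategory.braiding_tensor_left_hom]
    rw [permHom_cons, splitIso_cons_hom, Category.assoc, Category.assoc]
    erw [Iso.inv_hom_id_assoc]
    rw [← comp_whiskerRight_assoc, h, comp_whiskerRight_assoc,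
      reassoc_of% I.extractHom_appendRight, reassoc_of% hex, extractHom_here,
      ← BraidedCategory.braiding_naturality_left, ← comp_whiskerRight_assoc]
    simp

theorem permHom_cat_assoc (Γ Δ : Ctx G) : ∀ E : Ctx G,
    ∃ π : Permutation ((Γ.cat Δ).cat E) (Γ.cat (Δ.cat E)),
      I.permHom π ≫ (I.splitIso Γ (Δ.cat E)).hom ≫ I.ctx Γ ◁ (I.splitIso Δ E).hom =
        (I.splitIso (Γ.cat Δ) E).hom ≫ (I.splitIso Γ Δ).hom ▷ I.ctx E ≫ (α_ _ _ _).hom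
  | [] => ⟨.refl _, by
    have h : ∀ X Y : C, X ◁ (ρ_ Y).inv = (ρ_ (X ⊗ Y)).inv ≫ (α_ X Y (𝟙_ C)).hom := by simp
    change _ = (ρ_ _).inv ≫ (I.splitIso Γ Δ).hom ▷ 𝟙_ C ≫ (α_ _ _ (𝟙_ C)).hom
    rw [permHom_refl, ← rightUnitor_inv_naturality_assoc, splitIso_nil_hom]
    exact (Category.id_comp _).trans (congrArg (_ ≫ ·) (h _ _))⟩
  | p :: E => by
    obtain ⟨π, h⟩ := permHom_cat_assoc Γ Δ E
    refine ⟨.cons (.here _) π, ?_⟩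
    calc _ = ((I.snocIso _ p).hom ≫ I.permHom π ▷ I.ty p.2 ≫ (I.snocIso _ p).inv) ≫
          ((I.snocIso (Γ.cat (Δ.cat E)) p).hom ≫ (I.splitIso Γ (Δ.cat E)).hom ▷ I.ty p.2 ≫
            (α_ _ _ _).hom ≫ I.ctx Γ ◁ (I.snocIso (Δ.cat E) p).inv) ≫
          I.ctx Γ ◁ ((I.snocIso (Δ.cat E) p).hom ≫ (I.splitIso Δ E).hom ▷ I.ty p.2 ≫
            (α_ _ _ _).hom ≫ I.ctx Δ ◁ (I.snocIso E p).inv) := by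
            rw [← splitIso_cons_hom, ← splitIso_cons_hom]; rfl
      _ = (I.snocIso _ p).hom ≫ (I.permHom π ≫ (I.splitIso Γ (Δ.cat E)).hom ≫
            I.ctx Γ ◁ (I.splitIso Δ E).hom) ▷ I.ty p.2 ≫ (α_ _ _ _).hom ≫ I.ctx Γ ◁
            ((α_ _ _ _).hom ≫ I.ctx Δ ◁ (I.snocIso E p).inv) := by
            simp
      _ = (I.splitIso (Γ.cat Δ) (p :: E)).hom ≫ (I.splitIso Γ Δ).hom ▷ I.ctx (p :: E) ≫
            (α_ _ _ _).hom := by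
            rw [h, splitIso_cons_hom, Category.assoc, Category.assoc, Category.assoc,
              whisker_exchange_assoc]
            simp

end Interpretation

end LinLam

/-! ### Coherence: structural maps between bracketed contexts are permutations -/

namespace LinLam

/-- Bracketings of contexts. -/
inductive Shape (G : Type u) : Type u
  | ctx : Ctx G → Shape G
  | node : Shape G → Shape G → Shape G

variable {G : Type u} {S : Signature.{u, v} G}

/-- The context of all variables of a bracketing. -/
def Shape.flat : Shape G → Ctx G
  | ctx Γ => Γ
  | node T U => T.flat.cat U.flat

variable {C : Type u₁} [Category.{v₁} C] [MonoidalCategory C] [MonoidalClosed C]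

namespace Interpretation

variable (I : Interpretation C S)

/-- The interpretation of a bracketing. -/
def shapeObj : Shape G → C
  | .ctx Γ => I.ctx Γ
  | .node T U => shapeObj T ⊗ shapeObj U

/-- A bracketing is interpreted as its context, up to isomorphism. -/
def flatIso : (T : Shape G) → (I.shapeObj T ≅ I.ctx T.flat)
  | .ctx Γ => Iso.refl (I.ctx Γ)
  | .node T U => (flatIso T ⊗ᵢ flatIso U) ≪≫ (I.splitIso T.flat U.flat).symm

variable [SymmetricCategory C]

/-- The morphisms that permute and rebracket the variables of `T`. -/
def IsWire (T U : Shape G) (f : I.shapeObj T ⟶ I.shapeObj U) : Prop :=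
  ∃ π : Permutation T.flat U.flat, (I.flatIso T).hom ≫ I.permHom π = f ≫ (I.flatIso U).hom

variable {I}

omit [MonoidalCategory C] [MonoidalClosed C] [SymmetricCategory C] in
theorem comp_inv_comp_hom {X Y Z : C} (f : X ⟶ Y) (i : Z ≅ Y) : (f ≫ i.inv) ≫ i.hom = f := by
  simp

theorem IsWire.id (T : Shape G) : I.IsWire T T (𝟙 _) := ⟨.refl _, by simp⟩

theorem IsWire.comp {T U W : Shape G} {f : I.shapeObj T ⟶ I.shapeObj U}
    {g : I.shapeObj U ⟶ I.shapeObj W} (hf : I.IsWire T U f) (hg : I.IsWire U W g) :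
    I.IsWire T W (f ≫ g) := by
  obtain ⟨π, hf⟩ := hf
  obtain ⟨π', hg⟩ := hg
  obtain ⟨π'', h⟩ := I.permHom_trans π π'
  exact ⟨π'', by rw [h, reassoc_of% hf, hg, Category.assoc]⟩

/-- Permutation morphisms are invertible among themselves, so a wire that is an isomorphism has a
wire as inverse. This gives joining from splitting, and the inverse associator. -/
theorem IsWire.symm (T U : Shape G) {e : I.shapeObj T ≅ I.shapeObj U} (he : I.IsWire T U e.hom) :
    I.IsWire U T e.inv := by
  obtain ⟨π, h⟩ := he
  obtain ⟨π', h'⟩ := I.permHom_symm' π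
  refine ⟨π', ?_⟩
  rw [← cancel_epi e.hom, ← reassoc_of% h, h']
  simp

theorem IsWire.tensor {T U T' U' : Shape G} {f : I.shapeObj T ⟶ I.shapeObj U}
    {g : I.shapeObj T' ⟶ I.shapeObj U'} (hf : I.IsWire T U f) (hg : I.IsWire T' U' g) :
    I.IsWire (.node T T') (.node U U') (f ⊗ₘ g) := by
  obtain ⟨π, hf⟩ := hf
  obtain ⟨π', hg⟩ := hg
  obtain ⟨π'', h⟩ := I.permHom_cat π π'
  refine ⟨π'', ?_⟩
  change ((_ ⊗ₘ _) ≫ (I.splitIso T.flat T'.flat).inv) ≫ I.permHom π'' =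
    (f ⊗ₘ g) ≫ (_ ⊗ₘ _) ≫ (I.splitIso U.flat U'.flat).inv
  rw [← cancel_mono (I.splitIso U.flat U'.flat).hom]
  simp only [Category.assoc, h, Iso.inv_hom_id_assoc, Iso.inv_hom_id, Category.comp_id,
    tensorHom_comp_tensorHom]
  rw [hf, hg]

theorem IsWire.whiskerRight {T U : Shape G} {f : I.shapeObj T ⟶ I.shapeObj U}
    (hf : I.IsWire T U f) (W : Shape G) : I.IsWire (.node T W) (.node U W) (f ▷ I.shapeObj W) := by
  simpa using hf.tensor (.id W)

theorem IsWire.whiskerLeft (W : Shape G) {T U : Shape G} {f : I.shapeObj T ⟶ I.shapeObj U}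
    (hf : I.IsWire T U f) : I.IsWire (.node W T) (.node W U) (I.shapeObj W ◁ f) := by
  simpa using (IsWire.id W).tensor hf

theorem IsWire.braiding (T U : Shape G) :
    I.IsWire (.node T U) (.node U T) (β_ (I.shapeObj T) (I.shapeObj U)).hom := by
  obtain ⟨π, h⟩ := I.permHom_cat_comm U.flat T.flat
  refine ⟨π, ?_⟩
  change ((_ ⊗ₘ _) ≫ (I.splitIso T.flat U.flat).inv) ≫ I.permHom π =
    (β_ (I.shapeObj T) (I.shapeObj U)).hom ≫ (_ ⊗ₘ _) ≫ (I.splitIso U.flat T.flat).inv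
  rw [← cancel_mono (I.splitIso U.flat T.flat).hom]
  simp only [Category.assoc, h, Iso.inv_hom_id_assoc, Iso.inv_hom_id, Category.comp_id,
    BraidedCategory.braiding_naturality]

theorem IsWire.associator (T U W : Shape G) :
    I.IsWire (.node (.node T U) W) (.node T (.node U W))
      (α_ (I.shapeObj T) (I.shapeObj U) (I.shapeObj W)).hom := by
  obtain ⟨π, h⟩ := I.permHom_cat_assoc T.flat U.flat W.flat
  refine ⟨π, ?_⟩
  change ((((I.flatIso T).hom ⊗ₘ (I.flatIso U).hom) ≫ (I.splitIso T.flat U.flat).inv ⊗ₘ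
      (I.flatIso W).hom) ≫ (I.splitIso (T.flat.cat U.flat) W.flat).inv) ≫ I.permHom π =
    (α_ (I.shapeObj T) (I.shapeObj U) (I.shapeObj W)).hom ≫ ((I.flatIso T).hom ⊗ₘ (((I.flatIso U).hom ⊗ₘ (I.flatIso W).hom) ≫
      (I.splitIso U.flat W.flat).inv)) ≫ (I.splitIso T.flat (U.flat.cat W.flat)).inv
  rw [← cancel_mono (I.splitIso T.flat (U.flat.cat W.flat)).hom,
    ← cancel_mono (I.ctx T.flat ◁ (I.splitIso U.flat W.flat).hom)]
  simp only [Category.assoc, h, Iso.inv_hom_id_assoc, Iso.inv_hom_id, Category.comp_id]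
  simp only [← id_tensorHom, ← tensorHom_id, tensorHom_comp_tensorHom,
    tensorHom_comp_tensorHom_assoc, Category.assoc, Iso.inv_hom_id, Category.comp_id,
    associator_naturality]

theorem IsWire.permHom {E Γ : Ctx G} (π : Permutation E Γ) :
    I.IsWire (.ctx E) (.ctx Γ) (I.permHom π) :=
  ⟨π, (Category.id_comp _).trans (Category.comp_id _).symm⟩

theorem IsWire.split (Γ Δ : Ctx G) :
    I.IsWire (.ctx (Γ.cat Δ)) (.node (.ctx Γ) (.ctx Δ)) (I.splitIso Γ Δ).hom := by
  refine ⟨.refl _, ?_⟩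
  change 𝟙 _ ≫ I.permHom (.refl (Γ.cat Δ)) = (I.splitIso Γ Δ).hom ≫ (𝟙 _ ⊗ₘ 𝟙 _) ≫ (I.splitIso Γ Δ).inv
  rw [permHom_refl]
  simp

theorem IsWire.split_inv (Γ Δ : Ctx G) :
    I.IsWire (.node (.ctx Γ) (.ctx Δ)) (.ctx (Γ.cat Δ)) (I.splitIso Γ Δ).inv :=
  .symm (.ctx (Γ.cat Δ)) (.node (.ctx Γ) (.ctx Δ)) (.split Γ Δ)

theorem IsWire.associator_inv (T U W : Shape G) :
    I.IsWire (.node T (.node U W)) (.node (.node T U) W)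
      (α_ (I.shapeObj T) (I.shapeObj U) (I.shapeObj W)).inv :=
  .symm (.node (.node T U) W) (.node T (.node U W)) (.associator T U W)

theorem IsWire.exists_permHom {E Γ : Ctx G} {f : I.ctx E ⟶ I.ctx Γ}
    (h : I.IsWire (.ctx E) (.ctx Γ) f) : ∃ π : Permutation E Γ, I.permHom π = f := by
  obtain ⟨π, h⟩ := h
  exact ⟨π, (Category.id_comp _).symm.trans (h.trans (Category.comp_id _))⟩

/-- Turns a composite of splittings, braidings and associators into one permutation followed by one
splitting, the form in which the generalised typing rules below accept it. -/
theorem IsWire.exists_permHom_split {E Γ Δ : Ctx G} {f : I.ctx E ⟶ I.ctx Γ ⊗ I.ctx Δ}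
    (h : I.IsWire (.ctx E) (.node (.ctx Γ) (.ctx Δ)) f) :
    ∃ π : Permutation E (Γ.cat Δ), I.permHom π ≫ (I.splitIso Γ Δ).hom = f := by
  obtain ⟨π, h⟩ := IsWire.exists_permHom (h.comp (.split_inv Γ Δ))
  exact ⟨π, by rw [h]; exact comp_inv_comp_hom f (I.splitIso Γ Δ)⟩

theorem IsWire.exists_permHom_split_right {E Γ Δ Θ : Ctx G}
    {f : I.ctx E ⟶ (I.ctx Γ ⊗ I.ctx Δ) ⊗ I.ctx Θ}
    (h : I.IsWire (.ctx E) (.node (.node (.ctx Γ) (.ctx Δ)) (.ctx Θ)) f) :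
    ∃ π : Permutation E ((Γ.cat Δ).cat Θ),
      I.permHom π ≫ (I.splitIso (Γ.cat Δ) Θ).hom ≫ (I.splitIso Γ Δ).hom ▷ I.ctx Θ = f := by
  obtain ⟨π, h⟩ := IsWire.exists_permHom_split (h.comp ((split_inv Γ Δ).whiskerRight (.ctx Θ)))
  refine ⟨π, ?_⟩
  have h' := h =≫ (I.splitIso Γ Δ).hom ▷ I.ctx Θ
  rw [Category.assoc] at h'
  rw [h']
  exact comp_inv_comp_hom f (whiskerRightIso (I.splitIso Γ Δ) (I.ctx Θ))

theorem IsWire.exists_permHom_split_left {E Γ Δ Θ : Ctx G}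
    {f : I.ctx E ⟶ I.ctx Γ ⊗ (I.ctx Δ ⊗ I.ctx Θ)}
    (h : I.IsWire (.ctx E) (.node (.ctx Γ) (.node (.ctx Δ) (.ctx Θ))) f) :
    ∃ π : Permutation E (Γ.cat (Δ.cat Θ)),
      I.permHom π ≫ (I.splitIso Γ (Δ.cat Θ)).hom ≫ I.ctx Γ ◁ (I.splitIso Δ Θ).hom = f := by
  obtain ⟨π, h⟩ := IsWire.exists_permHom_split (h.comp ((split_inv Δ Θ).whiskerLeft (.ctx Γ)))
  refine ⟨π, ?_⟩
  have h' := h =≫ I.ctx Γ ◁ (I.splitIso Δ Θ).hom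
  rw [Category.assoc] at h'
  rw [h']
  exact comp_inv_comp_hom f (whiskerLeftIso (I.ctx Γ) (I.splitIso Δ Θ))

theorem IsWire.swapR (T U W : Shape G) : I.IsWire (.node (.node T U) W) (.node (.node T W) U)
    (swapR (I.shapeObj T) (I.shapeObj U) (I.shapeObj W)) :=
  (IsWire.associator T U W).comp (.comp (.whiskerLeft T (.braiding U W))
    (.associator_inv T W U))

end Interpretation

end LinLam

/-! ### Contexts that differ only in the names of their variables -/

namespace LinLam

variable {G : Type u} {S : Signature.{u, v} G}

/-- Renaming of the variables of a context. -/
def Ctx.ren (ρ : ℕ → ℕ) (Γ : Ctx G) : Ctx G := Γ.map (fun p => (ρ p.1, p.2))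

theorem Ctx.map_snd_ren (ρ : ℕ → ℕ) (Γ : Ctx G) :
    (Γ.ren ρ).map Prod.snd = Γ.map Prod.snd := by
  simp [Ctx.ren, Function.comp_def]

theorem Ctx.map_snd_lift (k : ℕ) (Γ : Ctx G) :
    (Γ.lift k).map Prod.snd = Γ.map Prod.snd := Γ.map_snd_ren (· + k)

theorem Ctx.map_snd_cat {Γ Γ' Δ Δ' : Ctx G} (h : Γ.map Prod.snd = Γ'.map Prod.snd)
    (h' : Δ.map Prod.snd = Δ'.map Prod.snd) :
    (Γ.cat Δ).map Prod.snd = (Γ'.cat Δ').map Prod.snd := by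
  simp [Ctx.cat, h, h']

theorem Ctx.map_snd_catN : ∀ (n : ℕ) {Γs Δs : Fin n → Ctx G},
    (∀ i, (Γs i).map Prod.snd = (Δs i).map Prod.snd) →
    (Ctx.catN n Γs).map Prod.snd = (Ctx.catN n Δs).map Prod.snd
  | 0, _, _, _ => rfl
  | 1, _, _, h => h 0
  | n + 2, _, _, h => map_snd_cat (map_snd_catN (n + 1) fun i => h i.castSucc) (h _)

theorem Ctx.ren_cat (ρ : ℕ → ℕ) (Γ Δ : Ctx G) : (Γ.cat Δ).ren ρ = (Γ.ren ρ).cat (Δ.ren ρ) :=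
  List.map_append

theorem Ctx.ren_catN (ρ : ℕ → ℕ) : ∀ (n : ℕ) (Γs : Fin n → Ctx G),
    (Ctx.catN n Γs).ren ρ = Ctx.catN n (fun i => (Γs i).ren ρ)
  | 0, _ => rfl
  | 1, _ => rfl
  | n + 2, Γs => by
    rw [Ctx.catN, ren_cat, ren_catN ρ (n + 1)]
    rfl

variable {C : Type u₁} [Category.{v₁} C] [MonoidalCategory C] [MonoidalClosed C]

omit [MonoidalClosed C] in
-- The inductive step shared by the `n`-ary compatibilities of `splitN`: `h` treats the last block
-- and `h'` the blocks before it.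
theorem comp_comp_whiskerRight_of_eq {X₁ X₂ X₃ X₄ Y₁ Y₂ Z₁ Z₂ : C} {a : X₁ ⟶ X₂}
    {b : X₂ ⟶ Y₁ ⊗ Y₂} {c : X₁ ⟶ X₃ ⊗ X₄} {d : X₃ ⟶ Y₁} {e : X₄ ⟶ Y₂} {f : Y₁ ⟶ Z₁} {g : X₃ ⟶ Z₂}
    {k : Z₂ ⟶ Z₁} (h : a ≫ b = c ≫ (d ⊗ₘ e)) (h' : d ≫ f = g ≫ k) :
    a ≫ b ≫ f ▷ Y₂ = (c ≫ g ▷ X₄) ≫ (k ⊗ₘ e) := by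
  rw [reassoc_of% h, Category.assoc, tensorHom_def', tensorHom_def', Category.assoc,
    ← comp_whiskerRight, h', comp_whiskerRight, whisker_exchange_assoc]

namespace Interpretation

variable (I : Interpretation C S)

theorem ctx_congr : ∀ {Γ Γ' : Ctx G}, Γ.map Prod.snd = Γ'.map Prod.snd → I.ctx Γ = I.ctx Γ'
  | [], [], _ => rfl
  | [(_, A)], [(_, A')], h => by
    obtain rfl : A = A' := by simpa using h
    rfl
  | (_, A) :: q :: Γ, (_, A') :: q' :: Γ', h => by
    obtain ⟨rfl, h'⟩ : A = A' ∧ (q :: Γ).map Prod.snd = (q' :: Γ').map Prod.snd := by simpa using h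
    exact congrArg (fun X => X ⊗ I.ty A) (ctx_congr h')

/-- The identification of the interpretations of two contexts with the same types. -/
def retype {Γ Γ' : Ctx G} (h : Γ.map Prod.snd = Γ'.map Prod.snd) : I.ctx Γ ⟶ I.ctx Γ' :=
  eqToHom (I.ctx_congr h)

@[simp]
theorem retype_self {Γ : Ctx G} (h : Γ.map Prod.snd = Γ.map Prod.snd) : I.retype h = 𝟙 _ := rfl

@[simp]
theorem retype_retype {Γ Γ' Γ'' : Ctx G} (h : Γ.map Prod.snd = Γ'.map Prod.snd)
    (h' : Γ'.map Prod.snd = Γ''.map Prod.snd) :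
    I.retype h ≫ I.retype h' = I.retype (h.trans h') := eqToHom_trans _ _

@[simp]
theorem retype_retype_assoc {Γ Γ' Γ'' : Ctx G} (h : Γ.map Prod.snd = Γ'.map Prod.snd)
    (h' : Γ'.map Prod.snd = Γ''.map Prod.snd) {Z : C} (f : I.ctx Γ'' ⟶ Z) :
    I.retype h ≫ I.retype h' ≫ f = I.retype (h.trans h') ≫ f := eqToHom_trans_assoc _ _ _

/-- A one-variable context carries no unit factor, so the empty tail is a separate case, in which
the two unitors cancel. -/
theorem retype_cons : ∀ {Γ Γ' : Ctx G} (x y : ℕ) (A : Ty G)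
    (h : Γ.map Prod.snd = Γ'.map Prod.snd)
    (h' : List.map Prod.snd ((x, A) :: Γ) = List.map Prod.snd ((y, A) :: Γ')),
    I.retype h' = (I.snocIso Γ (x, A)).hom ≫ I.retype h ▷ I.ty A ≫ (I.snocIso Γ' (y, A)).inv
  | [], [], _, _, A, _, _ => by
    change 𝟙 (I.ty A) = (λ_ (I.ty A)).inv ≫ 𝟙 (𝟙_ C) ▷ I.ty A ≫ (λ_ (I.ty A)).hom
    simp
  | q :: Γ, q' :: Γ', _, _, A, h, _ => by
    have e : ∀ {X Y : C} (h : X = Y) (h' : X ⊗ I.ty A = Y ⊗ I.ty A),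
        eqToHom h' = 𝟙 _ ≫ eqToHom h ▷ I.ty A ≫ 𝟙 _ := by
      rintro X _ rfl _
      simp
    exact e (I.ctx_congr h) _

theorem retype_split {Γ Γ' : Ctx G} (h : Γ.map Prod.snd = Γ'.map Prod.snd) :
    ∀ {Δ Δ' : Ctx G} (h' : Δ.map Prod.snd = Δ'.map Prod.snd),
    I.retype (Ctx.map_snd_cat h h') ≫ (I.splitIso Γ' Δ').hom =
      (I.splitIso Γ Δ).hom ≫ (I.retype h ⊗ₘ I.retype h')
  | [], [], _ => by
    change I.retype h ≫ (ρ_ (I.ctx Γ')).inv = (ρ_ (I.ctx Γ)).inv ≫ (I.retype h ⊗ₘ 𝟙 (𝟙_ C))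
    simp
  | (x, A) :: Δ, (y, A') :: Δ', h' => by
    obtain ⟨rfl, h₁⟩ : A = A' ∧ Δ.map Prod.snd = Δ'.map Prod.snd := by simpa using h'
    have ih := retype_split h h₁
    rw [I.retype_cons x y A h₁ h', splitIso_cons_hom, splitIso_cons_hom]
    have e := I.retype_cons x y A (Ctx.map_snd_cat h h₁) (Ctx.map_snd_cat h h')
    rw [e]
    simp only [Category.assoc, Iso.inv_hom_id_assoc]
    rw [← comp_whiskerRight_assoc, ih]
    simp only [MonoidalCategory.tensorHom_def, comp_whiskerRight, Category.assoc]
    simp [← whisker_exchange_assoc]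

theorem retype_splitN : ∀ (n : ℕ) {Γs Δs : Fin n → Ctx G}
    (h : ∀ i, (Γs i).map Prod.snd = (Δs i).map Prod.snd),
    I.retype (Ctx.map_snd_catN n h) ≫ I.splitN n Δs =
      I.splitN n Γs ≫ nTensorHom n (fun i => I.retype (h i))
  | 0, _, _, _ => rfl
  | 1, _, _, _ => (Category.comp_id _).trans (Category.id_comp _).symm
  | n + 2, Γs, Δs, h => by
    have h₁ := I.retype_split (Ctx.map_snd_catN (n + 1) fun i => h i.castSucc) (h (Fin.last _))
    have h₂ := retype_splitN (n + 1) fun i => h i.castSucc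
    exact comp_comp_whiskerRight_of_eq h₁ h₂

variable [SymmetricCategory C]

/-- Insertions record positions and not names, so `ρ` may be arbitrary here; injectivity plays no
role. -/
theorem extractHom_ren (ρ : ℕ → ℕ) {p : ℕ × Ty G} {E' E : Ctx G} (i : Insertion p E' E) :
    ∃ i' : Insertion (ρ p.1, p.2) (E'.ren ρ) (E.ren ρ),
      I.extractHom i' ≫ I.retype (E'.map_snd_ren ρ) ▷ I.ty p.2 =
        I.retype (E.map_snd_ren ρ) ≫ I.extractHom i := by
  induction i with
  | here E =>
    refine ⟨.here _, ?_⟩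
    have h := I.retype_cons (ρ p.1) p.1 p.2 (Ctx.map_snd_ren ρ E) (Ctx.map_snd_ren ρ (p :: E))
    change (I.snocIso (Ctx.ren ρ E) (ρ p.1, p.2)).hom ≫ _ =
      I.retype (Γ := (ρ p.1, p.2) :: Ctx.ren ρ E) (Γ' := (p.1, p.2) :: E) _ ≫
        (I.snocIso E (p.1, p.2)).hom
    rw [h]
    simp
  | there q i ih =>
    rename_i E' E
    obtain ⟨i', ih⟩ := ih
    refine ⟨.there (ρ q.1, q.2) i', ?_⟩
    have h₁ := I.retype_cons (ρ q.1) q.1 q.2 (Ctx.map_snd_ren ρ E) (Ctx.map_snd_ren ρ (q :: E))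
    have h₂ := I.retype_cons (ρ q.1) q.1 q.2 (Ctx.map_snd_ren ρ E') (Ctx.map_snd_ren ρ (q :: E'))
    change I.extractHom (.there (ρ q.1, q.2) i') ≫
        I.retype (Γ := (ρ q.1, q.2) :: Ctx.ren ρ E') (Γ' := (q.1, q.2) :: E') _ ▷ I.ty p.2 =
      I.retype (Γ := (ρ q.1, q.2) :: Ctx.ren ρ E) (Γ' := (q.1, q.2) :: E) _ ≫
        I.extractHom (.there (q.1, q.2) i)
    rw [h₁, h₂, extractHom_there, extractHom_there]
    simp only [Category.assoc, comp_whiskerRight, Iso.inv_hom_id_assoc]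
    rw [← comp_whiskerRight_assoc (I.retype _), ← ih]
    simp [swapR_naturality_left_assoc]

theorem permHom_ren (ρ : ℕ → ℕ) {E Γ : Ctx G} (π : Permutation E Γ) :
    ∃ π' : Permutation (E.ren ρ) (Γ.ren ρ), I.permHom π' ≫ I.retype (Γ.map_snd_ren ρ) =
      I.retype (E.map_snd_ren ρ) ≫ I.permHom π := by
  induction π with
  | nil => exact ⟨.nil, rfl⟩
  | cons i π ih =>
    rename_i p E E' Γ
    obtain ⟨π', ih⟩ := ih
    obtain ⟨i', hi⟩ := I.extractHom_ren ρ i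
    refine ⟨.cons i' π', ?_⟩
    have h := I.retype_cons (ρ p.1) p.1 p.2 (Ctx.map_snd_ren ρ Γ) (Ctx.map_snd_ren ρ (p :: Γ))
    change I.permHom (.cons i' π') ≫
        I.retype (Γ := (ρ p.1, p.2) :: Ctx.ren ρ Γ) (Γ' := (p.1, p.2) :: Γ) _ = _
    rw [h, permHom_cons, permHom_cons, ← reassoc_of% hi]
    simp only [Category.assoc, Iso.inv_hom_id_assoc]
    rw [← comp_whiskerRight_assoc, ih, comp_whiskerRight_assoc]

theorem permHom_lift (k : ℕ) {E Γ : Ctx G} (π : Permutation E Γ) :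
    ∃ π' : Permutation (E.lift k) (Γ.lift k), I.permHom π' ≫ I.retype (Γ.map_snd_lift k) =
      I.retype (E.map_snd_lift k) ≫ I.permHom π :=
  I.permHom_ren (· + k) π

/-- Lets an equality of contexts count as one more permutation, so that transports are absorbed by
`permHom_trans`. -/
theorem exists_permHom_eq_retype {Γ Γ' : Ctx G} (h : Γ = Γ') :
    ∃ π : Permutation Γ Γ', I.permHom π = I.retype (congrArg _ h) := by
  subst h
  exact ⟨.refl _, I.permHom_refl _⟩

/-! ## Rearranging shuffles -/

theorem permHom_catN : ∀ (n : ℕ) {Γs Δs : Fin n → Ctx G} (π : ∀ i, Permutation (Γs i) (Δs i)),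
    ∃ π' : Permutation (Ctx.catN n Γs) (Ctx.catN n Δs),
      I.permHom π' ≫ I.splitN n Δs = I.splitN n Γs ≫ nTensorHom n (fun i => I.permHom (π i))
  | 0, _, _, _ => ⟨.nil, rfl⟩
  | 1, _, _, π => ⟨π 0, (Category.comp_id _).trans (Category.id_comp _).symm⟩
  | n + 2, Γs, Δs, π => by
    obtain ⟨π₁, h₁⟩ := permHom_catN (n + 1) fun i => π i.castSucc
    obtain ⟨π₂, h₂⟩ := I.permHom_cat π₁ (π (Fin.last _))
    refine ⟨π₂, ?_⟩
    exact comp_comp_whiskerRight_of_eq h₂ h₁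

omit [SymmetricCategory C] in
theorem _root_.LinLam.Ctx.sublist_catN : ∀ (n : ℕ) (Γs : Fin n → Ctx G) (i : Fin n),
    (Γs i).Sublist (Ctx.catN n Γs)
  | 1, Γs, i => by
    obtain rfl := Subsingleton.elim i 0
    exact .refl _
  | n + 2, Γs, i => by
    induction i using Fin.lastCases with
    | last => exact List.sublist_append_left _ _
    | cast i =>
      exact (Ctx.sublist_catN (n + 1) (fun i => Γs i.castSucc) i).trans
        (List.sublist_append_right _ _)

/-- The typing rules accept only order-preserving shuffles. An arbitrary permutation onto `Γ, Δ`
factors as a shuffle followed by a permutation inside each part: the parts are listed in the order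
they have in `E`, and the two routes agree because the variables of `E` are distinct. -/
theorem exists_shuffle {Γ Δ E : Ctx G} (hE : E.Valid) (π : Permutation E (Γ.cat Δ)) :
    ∃ (Γ' Δ' : Ctx G) (s : Shuffle Γ' Δ' E) (π₁ : Permutation Γ' Γ) (π₂ : Permutation Δ' Δ),
      I.shuffleSplit s ≫ (I.permHom π₁ ⊗ₘ I.permHom π₂) = I.permHom π ≫ (I.splitIso Γ Δ).hom := by
  have hp := π.toPerm
  obtain ⟨Γ', hΓ, hΓE⟩ := (hp.symm.subperm_left (l := Γ)).1 (List.sublist_append_right _ _).subperm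
  obtain ⟨Δ', hΔ, hΔE⟩ := (hp.symm.subperm_left (l := Δ)).1 (List.sublist_append_left _ _).subperm
  obtain ⟨π₁⟩ := Permutation.exists_of_perm hΓ
  obtain ⟨π₂⟩ := Permutation.exists_of_perm hΔ
  obtain ⟨π₃⟩ := Permutation.exists_of_perm (hp.trans (hΔ.append hΓ).symm)
  refine ⟨Γ', Δ', ⟨hE, π₃, hΓE, hΔE⟩, π₁, π₂, ?_⟩
  obtain ⟨π₄, h₄⟩ := I.permHom_cat π₁ π₂
  obtain ⟨π₅, h₅⟩ := I.permHom_trans π₃ π₄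
  rw [shuffleSplit, Category.assoc, ← h₄, ← reassoc_of% h₅, π.unique hE.nodup π₅]

theorem exists_shuffleN {n : ℕ} {Γs : Fin n → Ctx G} {E : Ctx G} (hE : E.Valid)
    (π : Permutation E (Ctx.catN n Γs)) :
    ∃ (Γs' : Fin n → Ctx G) (s : ShuffleN Γs' E) (πs : ∀ i, Permutation (Γs' i) (Γs i)),
      I.shuffleSplitN s ≫ nTensorHom n (fun i => I.permHom (πs i)) =
        I.permHom π ≫ I.splitN n Γs := by
  have hp := π.toPerm
  choose Γs' hΓ hΓE using fun i =>
    (hp.symm.subperm_left (l := Γs i)).1 (Ctx.sublist_catN n Γs i).subperm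
  have πs := fun i => (Permutation.exists_of_perm (hΓ i)).some
  obtain ⟨π₁, h₁⟩ := I.permHom_catN n πs
  obtain ⟨π₂⟩ := Permutation.exists_of_perm (hp.trans π₁.toPerm.symm)
  refine ⟨Γs', ⟨hE, π₂, hΓE⟩, πs, ?_⟩
  obtain ⟨π₃, h₃⟩ := I.permHom_trans π₂ π₁
  rw [shuffleSplitN, Category.assoc, ← h₁, ← reassoc_of% h₃, π.unique hE.nodup π₃]

end Interpretation

end LinLam

/-! ### The exchange lemma -/

namespace LinLam

variable {G : Type u} {S : Signature.{u, v} G}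

theorem Ctx.valid_lift_iff (k : ℕ) (Γ : Ctx G) : (Γ.lift k).Valid ↔ Γ.Valid := by
  have h : (Γ.lift k).map Prod.fst = (Γ.map Prod.fst).map (· + k) := by
    simp [Ctx.lift, Function.comp_def]
  rw [Valid, h]
  exact List.nodup_map_iff (add_left_injective k)

theorem Ctx.valid_cons_lift {Γ : Ctx G} (A : Ty G) (h : Γ.Valid) :
    Ctx.Valid ((0, A) :: Γ.lift 1) := by
  refine List.nodup_cons.2 ⟨?_, (valid_lift_iff 1 Γ).2 h⟩
  simp [Ctx.lift]

theorem Ctx.valid_cons_cons_lift {Γ : Ctx G} (A B : Ty G) (h : Γ.Valid) :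
    Ctx.Valid ((0, B) :: (1, A) :: Γ.lift 2) := by
  refine List.nodup_cons.2 ⟨?_, List.nodup_cons.2 ⟨?_, (valid_lift_iff 2 Γ).2 h⟩⟩ <;>
  simp [Ctx.lift]

theorem Ctx.Valid.of_sublist {Γ Δ : Ctx G} (h : Δ.Valid) (p : Γ.Sublist Δ) : Γ.Valid :=
  List.Nodup.sublist (p.map _) h

theorem Typed.valid {Γ : Ctx G} {v : Tm S} {A : Ty G} (d : Typed Γ v A) : Γ.Valid := by
  induction d with
  | ax f d s ih => exact s.valid
  | hyp x A => simp [Ctx.Valid]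
  | unitI => simp [Ctx.Valid]
  | unitE d₁ d₂ s => exact s.valid
  | tensorI d₁ d₂ s => exact s.valid
  | tensorE d₁ d₂ s => exact s.valid
  | lolliI d ih => exact (Ctx.valid_lift_iff 1 _).1 (List.nodup_cons.1 ih).2
  | lolliE d₁ d₂ s => exact s.valid

variable {C : Type u₁} [Category.{v₁} C] [MonoidalCategory C]

theorem nTensorHom_comp : ∀ (n : ℕ) {X Y Z : Fin n → C} (f : ∀ i, X i ⟶ Y i) (g : ∀ i, Y i ⟶ Z i),
    nTensorHom n (fun i => f i ≫ g i) = nTensorHom n f ≫ nTensorHom n g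
  | 0, _, _, _, _, _ => (Category.id_comp _).symm
  | 1, _, _, _, _, _ => rfl
  | n + 2, X, Y, Z, f, g => by
    rw [nTensorHom, nTensorHom_comp (n + 1)]
    exact (tensorHom_comp_tensorHom _ _ _ _).symm

/-- With `p` and `q` a rearrangement, a renaming or a substitution acting on the two parts, this and
its variants are the rule-by-rule calculation of the exchange, renaming and substitution lemmas
alike. -/
theorem split_tensorHom {X Y Z Y' Z' A B : C} {s : X ⟶ Y ⊗ Z} {p : Y ⟶ Y'} {q : Z ⟶ Z'}
    {t : X ⟶ Y' ⊗ Z'} (h : s ≫ (p ⊗ₘ q) = t) (f : Y' ⟶ A) (g : Z' ⟶ B) :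
    s ≫ ((p ≫ f) ⊗ₘ (q ≫ g)) = t ≫ (f ⊗ₘ g) := by
  simp [← h]

theorem split_tensorHom_assoc {X Y Z Y' Z' A B D : C} {s : X ⟶ Y ⊗ Z} {p : Y ⟶ Y'} {q : Z ⟶ Z'}
    {t : X ⟶ Y' ⊗ Z'} (h : s ≫ (p ⊗ₘ q) = t) (f : Y' ⟶ A) (g : Z' ⟶ B) (k : A ⊗ B ⟶ D) :
    s ≫ ((p ≫ f) ⊗ₘ (q ≫ g)) ≫ k = t ≫ (f ⊗ₘ g) ≫ k := by
  simp [← h]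

theorem split_leftUnitor {X Y Z Y' Z' B : C} {s : X ⟶ Y ⊗ Z} {p : Y ⟶ Y'} {q : Z ⟶ Z'}
    {t : X ⟶ Y' ⊗ Z'} (h : s ≫ (p ⊗ₘ q) = t) (f : Y' ⟶ 𝟙_ C) (g : Z' ⟶ B) :
    s ≫ (p ≫ f) ▷ Z ≫ (λ_ Z).hom ≫ q ≫ g = t ≫ f ▷ Z' ≫ (λ_ Z').hom ≫ g := by
  simp [← h, MonoidalCategory.tensorHom_def, whisker_exchange_assoc]

/-- In the applications `j` and `j'` join the two bound variables and `r` is `q` carried under the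
binders; `hj` is all that is needed of them. -/
theorem split_braiding [BraidedCategory C] {X Y Z Y' Z' A B W W' D : C} {s : X ⟶ Y ⊗ Z}
    {p : Y ⟶ Y'} {q : Z ⟶ Z'} {t : X ⟶ Y' ⊗ Z'} (h : s ≫ (p ⊗ₘ q) = t)
    {j : (Z ⊗ A) ⊗ B ⟶ W} {j' : (Z' ⊗ A) ⊗ B ⟶ W'} {r : W ⟶ W'}
    (hj : j ≫ r = q ▷ A ▷ B ≫ j') (f : Y' ⟶ A ⊗ B) (g : W' ⟶ D) :
    s ≫ (p ≫ f) ▷ Z ≫ (β_ (A ⊗ B) Z).hom ≫ (α_ Z A B).inv ≫ j ≫ r ≫ g =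
      t ≫ f ▷ Z' ≫ (β_ (A ⊗ B) Z').hom ≫ (α_ Z' A B).inv ≫ j' ≫ g := by
  rw [reassoc_of% hj, ← h]
  simp only [comp_whiskerRight, Category.assoc, MonoidalCategory.tensorHom_def,
    whisker_exchange_assoc, BraidedCategory.braiding_naturality_right_assoc,
    associator_inv_naturality_left_assoc]

variable [MonoidalClosed C]

theorem transpose_comp_left [SymmetricCategory C] {X X' Y Z : C} (g : X' ⟶ X) (f : X ⊗ Y ⟶ Z) :
    transpose (g ▷ Y ≫ f) = g ≫ transpose f :=
  (tensorHomAdj Y).homEquiv_naturality_left g f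

namespace Interpretation

variable (I : Interpretation C S)

theorem joinBound_eq (Γ : Ctx G) (A : Ty G) :
    I.joinBound Γ A = I.retype (Γ.map_snd_lift 1).symm ▷ I.ty A ≫ (I.snocIso _ (0, A)).inv := rfl

theorem joinBound2_eq (Γ : Ctx G) (A B : Ty G) :
    I.joinBound2 Γ A B = I.retype (Γ.map_snd_lift 2).symm ▷ I.ty A ▷ I.ty B ≫
      (I.snocIso _ (1, A)).inv ▷ I.ty B ≫ (I.snocIso _ (0, B)).inv := rfl

theorem joinBound_naturality {E Γ : Ctx G} (A : Ty G) (f : I.ctx E ⟶ I.ctx Γ)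
    (f' : I.ctx (E.lift 1) ⟶ I.ctx (Γ.lift 1))
    (h : f' ≫ I.retype (Γ.map_snd_lift 1) = I.retype (E.map_snd_lift 1) ≫ f) :
    I.joinBound E A ≫ (I.snocIso _ (0, A)).hom ≫ f' ▷ I.ty A ≫ (I.snocIso _ (0, A)).inv =
      f ▷ I.ty A ≫ I.joinBound Γ A := by
  have h' : I.retype (E.map_snd_lift 1).symm ≫ f' = f ≫ I.retype (Γ.map_snd_lift 1).symm := by
    have := congrArg (fun g => I.retype (E.map_snd_lift 1).symm ≫ g ≫
      I.retype (Γ.map_snd_lift 1).symm) h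
    simpa using this
  simp only [joinBound_eq, Category.assoc, Iso.inv_hom_id_assoc]
  rw [← comp_whiskerRight_assoc, h', comp_whiskerRight_assoc]

theorem joinBound2_naturality {E Γ : Ctx G} (A B : Ty G) (f : I.ctx E ⟶ I.ctx Γ)
    (f' : I.ctx (E.lift 2) ⟶ I.ctx (Γ.lift 2))
    (h : f' ≫ I.retype (Γ.map_snd_lift 2) = I.retype (E.map_snd_lift 2) ≫ f) :
    I.joinBound2 E A B ≫ (I.snocIso _ (0, B)).hom ≫
        ((I.snocIso _ (1, A)).hom ≫ f' ▷ I.ty A ≫ (I.snocIso _ (1, A)).inv) ▷ I.ty B ≫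
        (I.snocIso _ (0, B)).inv =
      f ▷ I.ty A ▷ I.ty B ≫ I.joinBound2 Γ A B := by
  have h' : I.retype (E.map_snd_lift 2).symm ≫ f' = f ≫ I.retype (Γ.map_snd_lift 2).symm := by
    have := congrArg (fun g => I.retype (E.map_snd_lift 2).symm ≫ g ≫
      I.retype (Γ.map_snd_lift 2).symm) h
    simpa using this
  simp only [joinBound2_eq, Category.assoc, Iso.inv_hom_id_assoc, ← comp_whiskerRight_assoc]
  rw [h']

variable [SymmetricCategory C]

/-- Exchange holds for the derivation `d`. -/
def Exchange {Γ : Ctx G} {v : Tm S} {A : Ty G} (d : Typed Γ v A) : Prop :=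
  ∀ ⦃E : Ctx G⦄, E.Valid → ∀ π : Permutation E Γ,
    ∃ d' : Typed E v A, I.den d' = I.permHom π ≫ I.den d

variable {I}

/-- The typing rule with any permutation in place of a shuffle: `exists_shuffleN` moves the disorder
into the premises, for which exchange is assumed. The analogues for the other rules are the building
blocks for renaming, substitution and the equations. -/
theorem Exchange.ax {E : Ctx G} (f : S.Op) {Γs : Fin (S.arity f) → Ctx G}
    {vs : Fin (S.arity f) → Tm S} {d : ∀ i, Typed (Γs i) (vs i) (S.dom f i)}
    (h : ∀ i, I.Exchange (d i)) (hE : E.Valid) (π : Permutation E (Ctx.catN _ Γs)) :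
    ∃ d' : Typed E (.op f vs) (S.cod f), I.den d' =
      I.permHom π ≫ I.splitN _ Γs ≫ nTensorHom (S.arity f) (fun i => I.den (d i)) ≫ I.op f := by
  obtain ⟨Γs', s, πs, h'⟩ := I.exists_shuffleN hE π
  choose d' hd using fun i => h i (hE.of_sublist (s.sub i)) (πs i)
  refine ⟨.ax f d' s, ?_⟩
  simp only [den, hd, nTensorHom_comp, Category.assoc]
  rw [reassoc_of% h']

theorem Exchange.unitE {Γ Δ E : Ctx G} {v w : Tm S} {A : Ty G} {d₁ : Typed Γ v .unit}
    {d₂ : Typed Δ w A} (h₁ : I.Exchange d₁) (h₂ : I.Exchange d₂) (hE : E.Valid)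
    (π : Permutation E (Γ.cat Δ)) :
    ∃ d : Typed E (.letUnit v w) A, I.den d = I.permHom π ≫ (I.splitIso Γ Δ).hom ≫
      (I.den d₁ ▷ I.ctx Δ) ≫ (λ_ (I.ctx Δ)).hom ≫ I.den d₂ := by
  obtain ⟨Γ', Δ', s, π₁, π₂, h⟩ := I.exists_shuffle hE π
  obtain ⟨d₁', h₁⟩ := h₁ (hE.of_sublist s.left) π₁
  obtain ⟨d₂', h₂⟩ := h₂ (hE.of_sublist s.right) π₂
  refine ⟨.unitE d₁' d₂' s, ?_⟩
  change I.shuffleSplit s ≫ (I.den d₁' ▷ I.ctx Δ') ≫ (λ_ (I.ctx Δ')).hom ≫ I.den d₂' = _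
  rw [h₁, h₂]
  exact (split_leftUnitor h _ _).trans (Category.assoc _ _ _)

theorem Exchange.tensorI {Γ Δ E : Ctx G} {v w : Tm S} {A B : Ty G} {d₁ : Typed Γ v A}
    {d₂ : Typed Δ w B} (h₁ : I.Exchange d₁) (h₂ : I.Exchange d₂) (hE : E.Valid)
    (π : Permutation E (Γ.cat Δ)) :
    ∃ d : Typed E (.tensor v w) (.tensor A B), I.den d =
      (I.permHom π ≫ (I.splitIso Γ Δ).hom ≫ (I.den d₁ ⊗ₘ I.den d₂) :
        I.ctx E ⟶ I.ty A ⊗ I.ty B) := by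
  obtain ⟨Γ', Δ', s, π₁, π₂, h⟩ := I.exists_shuffle hE π
  obtain ⟨d₁', h₁⟩ := h₁ (hE.of_sublist s.left) π₁
  obtain ⟨d₂', h₂⟩ := h₂ (hE.of_sublist s.right) π₂
  refine ⟨.tensorI d₁' d₂' s, ?_⟩
  change I.shuffleSplit s ≫ (I.den d₁' ⊗ₘ I.den d₂') = _
  rw [h₁, h₂]
  exact (split_tensorHom h _ _).trans (Category.assoc _ _ _)

theorem Exchange.tensorE {Γ Δ E : Ctx G} {v w : Tm S} {A B D : Ty G}
    {d₁ : Typed Γ v (.tensor A B)} {d₂ : Typed ((0, B) :: (1, A) :: Δ.lift 2) w D}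
    (h₁ : I.Exchange d₁) (h₂ : I.Exchange d₂) (hE : E.Valid) (π : Permutation E (Γ.cat Δ)) :
    ∃ d : Typed E (.letPair v w) D, I.den d = I.permHom π ≫ (I.splitIso Γ Δ).hom ≫
      ((show I.ctx Γ ⟶ I.ty A ⊗ I.ty B from I.den d₁) ▷ I.ctx Δ) ≫
        (β_ (I.ty A ⊗ I.ty B) (I.ctx Δ)).hom ≫ (α_ (I.ctx Δ) (I.ty A) (I.ty B)).inv ≫
        I.joinBound2 Δ A B ≫ I.den d₂ := by
  obtain ⟨Γ', Δ', s, π₁, π₂, h⟩ := I.exists_shuffle hE π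
  obtain ⟨π₂', hπ₂⟩ := I.permHom_lift 2 π₂
  obtain ⟨d₁', h₁⟩ := h₁ (hE.of_sublist s.left) π₁
  -- The bound variables stay last, and the lift of `π₂` acts on the variables before them.
  obtain ⟨d₂', h₂⟩ := h₂ (Ctx.valid_cons_cons_lift _ _ (hE.of_sublist s.right))
    (.cons (.here _) (.cons (.here _) π₂'))
  refine ⟨.tensorE d₁' d₂' s, ?_⟩
  have hj := I.joinBound2_naturality A B _ _ hπ₂
  change I.shuffleSplit s ≫ ((show I.ctx Γ' ⟶ I.ty A ⊗ I.ty B from I.den d₁') ▷ I.ctx Δ') ≫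
        (β_ (I.ty A ⊗ I.ty B) (I.ctx Δ')).hom ≫ (α_ (I.ctx Δ') (I.ty A) (I.ty B)).inv ≫
        I.joinBound2 Δ' A B ≫ I.den d₂' = _
  rw [h₁, h₂]
  exact (split_braiding h hj _ _).trans (Category.assoc _ _ _)

theorem Exchange.lolliI {Γ E : Ctx G} {v : Tm S} {A B : Ty G}
    {d : Typed ((0, A) :: Γ.lift 1) v B} (h : I.Exchange d) (hE : E.Valid) (π : Permutation E Γ) :
    ∃ d' : Typed E (.lam A v) (.lolli A B), I.den d' =
      (I.permHom π ≫ transpose (I.joinBound Γ A ≫ I.den d) :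
        I.ctx E ⟶ (ihom (I.ty A)).obj (I.ty B)) := by
  obtain ⟨π', hπ⟩ := I.permHom_lift 1 π
  obtain ⟨d', h⟩ := h (Ctx.valid_cons_lift _ hE) (.cons (.here _) π')
  refine ⟨.lolliI d', ?_⟩
  have hj := I.joinBound_naturality A _ _ hπ
  change transpose (I.joinBound E A ≫ I.den d') = _
  rw [h, ← transpose_comp_left, ← reassoc_of% hj]
  simp [permHom_cons, extractHom_here]

theorem Exchange.lolliE {Γ Δ E : Ctx G} {v w : Tm S} {A B : Ty G} {d₁ : Typed Γ v (.lolli A B)}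
    {d₂ : Typed Δ w A} (h₁ : I.Exchange d₁) (h₂ : I.Exchange d₂) (hE : E.Valid)
    (π : Permutation E (Γ.cat Δ)) :
    ∃ d : Typed E (.app v w) B, I.den d = I.permHom π ≫ (I.splitIso Γ Δ).hom ≫
      ((show I.ctx Γ ⟶ (ihom (I.ty A)).obj (I.ty B) from I.den d₁) ⊗ₘ I.den d₂) ≫
        appHom (I.ty A) (I.ty B) := by
  obtain ⟨Γ', Δ', s, π₁, π₂, h⟩ := I.exists_shuffle hE π
  obtain ⟨d₁', h₁⟩ := h₁ (hE.of_sublist s.left) π₁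
  obtain ⟨d₂', h₂⟩ := h₂ (hE.of_sublist s.right) π₂
  refine ⟨.lolliE d₁' d₂' s, ?_⟩
  change I.shuffleSplit s ≫
    ((show I.ctx Γ' ⟶ (ihom (I.ty A)).obj (I.ty B) from I.den d₁') ⊗ₘ I.den d₂') ≫
      appHom (I.ty A) (I.ty B) = _
  rw [h₁, h₂]
  exact (split_tensorHom_assoc h _ _ _).trans (Category.assoc _ _ _)

variable (I)

/-- Where a rule contains a shuffle, the given permutation is composed with the stored one and the
generalised rule is applied to the composite; at a `lam` it is carried under the binder. -/
theorem exchange {Γ : Ctx G} {v : Tm S} {A : Ty G} (d : Typed Γ v A) : I.Exchange d := by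
  induction d with
  | ax f d s ih =>
    intro E hE π
    obtain ⟨π', h⟩ := I.permHom_trans π s.perm
    obtain ⟨d', h'⟩ := Exchange.ax f ih hE π'
    refine ⟨d', h'.trans ?_⟩
    rw [h, Category.assoc, den, shuffleSplitN, Category.assoc]
  | hyp x A =>
    intro E hE π
    obtain rfl := List.perm_singleton.1 π.toPerm
    refine ⟨.hyp x A, ?_⟩
    rw [π.unique hE.nodup (.refl _), permHom_refl]
    exact (Category.id_comp _).symm
  | unitI =>
    intro E hE π
    obtain rfl := List.perm_nil.1 π.toPerm
    refine ⟨.unitI, ?_⟩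
    rw [π.unique hE.nodup (.refl _), permHom_refl]
    exact (Category.id_comp _).symm
  | unitE d₁ d₂ s ih₁ ih₂ =>
    intro E hE π
    obtain ⟨π', h⟩ := I.permHom_trans π s.perm
    obtain ⟨d', h'⟩ := ih₁.unitE ih₂ hE π'
    refine ⟨d', h'.trans ?_⟩
    rw [h, Category.assoc, den, shuffleSplit, Category.assoc]
  | tensorI d₁ d₂ s ih₁ ih₂ =>
    intro E hE π
    obtain ⟨π', h⟩ := I.permHom_trans π s.perm
    obtain ⟨d', h'⟩ := ih₁.tensorI ih₂ hE π'
    refine ⟨d', h'.trans ?_⟩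
    rw [h, Category.assoc]
    exact congrArg (I.permHom π ≫ ·) (Category.assoc _ _ _).symm
  | tensorE d₁ d₂ s ih₁ ih₂ =>
    intro E hE π
    obtain ⟨π', h⟩ := I.permHom_trans π s.perm
    obtain ⟨d', h'⟩ := ih₁.tensorE ih₂ hE π'
    refine ⟨d', h'.trans ?_⟩
    rw [h, Category.assoc, den, shuffleSplit, Category.assoc]
    rfl
  | lolliI d ih => exact fun _ hE π => ih.lolliI hE π
  | lolliE d₁ d₂ s ih₁ ih₂ =>
    intro E hE π
    obtain ⟨π', h⟩ := I.permHom_trans π s.perm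
    obtain ⟨d', h'⟩ := ih₁.lolliE ih₂ hE π'
    refine ⟨d', h'.trans ?_⟩
    rw [h, Category.assoc, den, shuffleSplit, Category.assoc]
    rfl

end Interpretation

end LinLam

/-! ### Renaming of variables -/

namespace LinLam

variable {G : Type u} {S : Signature.{u, v} G}

theorem Ctx.ren_upRen_cons (ρ : ℕ → ℕ) (A : Ty G) (Γ : Ctx G) :
    Ctx.ren (Tm.upRen ρ) ((0, A) :: Γ.lift 1) = (0, A) :: (Γ.ren ρ).lift 1 := by
  simp [Ctx.ren, Ctx.lift, Tm.upRen]

theorem Ctx.ren_upRen_cons_cons (ρ : ℕ → ℕ) (A B : Ty G) (Γ : Ctx G) :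
    Ctx.ren (Tm.upRen (Tm.upRen ρ)) ((0, B) :: (1, A) :: Γ.lift 2) =
      (0, B) :: (1, A) :: (Γ.ren ρ).lift 2 := by
  simp [Ctx.ren, Ctx.lift, Tm.upRen]

variable {C : Type u₁} [Category.{v₁} C] [MonoidalCategory C] [MonoidalClosed C]

namespace Interpretation

variable (I : Interpretation C S)

theorem joinBound_retype {E Γ : Ctx G} (A : Ty G) (h : E.map Prod.snd = Γ.map Prod.snd)
    (h' : List.map Prod.snd ((0, A) :: E.lift 1) = List.map Prod.snd ((0, A) :: Γ.lift 1)) :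
    I.joinBound E A ≫ I.retype h' = I.retype h ▷ I.ty A ≫ I.joinBound Γ A := by
  have h₁ : (E.lift 1).map Prod.snd = (Γ.lift 1).map Prod.snd := by
    rw [Ctx.map_snd_lift, Ctx.map_snd_lift, h]
  rw [I.retype_cons 0 0 A h₁, I.joinBound_naturality A (I.retype h)]
  simp

theorem joinBound2_retype {E Γ : Ctx G} (A B : Ty G) (h : E.map Prod.snd = Γ.map Prod.snd)
    (h' : List.map Prod.snd ((0, B) :: (1, A) :: E.lift 2) =
      List.map Prod.snd ((0, B) :: (1, A) :: Γ.lift 2)) :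
    I.joinBound2 E A B ≫ I.retype h' = I.retype h ▷ I.ty A ▷ I.ty B ≫ I.joinBound2 Γ A B := by
  have h₁ : (E.lift 2).map Prod.snd = (Γ.lift 2).map Prod.snd := by
    rw [Ctx.map_snd_lift, Ctx.map_snd_lift, h]
  have h₂ : List.map Prod.snd ((1, A) :: E.lift 2) = List.map Prod.snd ((1, A) :: Γ.lift 2) := by
    simp [h₁]
  rw [I.retype_cons 0 0 B h₂, I.retype_cons 1 1 A h₁, I.joinBound2_naturality A B (I.retype h)]
  simp

variable [SymmetricCategory C]

theorem exists_ren_cat (ρ : ℕ → ℕ) {Γ Δ E : Ctx G} (π : Permutation E (Γ.cat Δ)) :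
    ∃ π' : Permutation (E.ren ρ) ((Γ.ren ρ).cat (Δ.ren ρ)),
      (I.permHom π' ≫ (I.splitIso _ _).hom) ≫
          (I.retype (Γ.map_snd_ren ρ) ⊗ₘ I.retype (Δ.map_snd_ren ρ)) =
        I.retype (E.map_snd_ren ρ) ≫ I.permHom π ≫ (I.splitIso Γ Δ).hom := by
  obtain ⟨π₁, h₁⟩ := I.permHom_ren ρ π
  obtain ⟨π₂, h₂⟩ := I.exists_permHom_eq_retype (Ctx.ren_cat ρ Γ Δ)
  obtain ⟨π₃, h₃⟩ := I.permHom_trans π₁ π₂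
  refine ⟨π₃, ?_⟩
  rw [← reassoc_of% h₁, Category.assoc, ← I.retype_split (Γ.map_snd_ren ρ) (Δ.map_snd_ren ρ), h₃,
    h₂, Category.assoc, retype_retype_assoc]

theorem exists_lift_cat (k : ℕ) {Γ Δ E : Ctx G} (π : Permutation E (Γ.cat Δ)) :
    ∃ π' : Permutation (E.lift k) ((Γ.lift k).cat (Δ.lift k)),
      (I.permHom π' ≫ (I.splitIso _ _).hom) ≫
          (I.retype (Γ.map_snd_lift k) ⊗ₘ I.retype (Δ.map_snd_lift k)) =
        I.retype (E.map_snd_lift k) ≫ I.permHom π ≫ (I.splitIso Γ Δ).hom :=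
  I.exists_ren_cat (· + k) π

theorem exists_ren_catN (ρ : ℕ → ℕ) {n : ℕ} {Γs : Fin n → Ctx G} {E : Ctx G}
    (π : Permutation E (Ctx.catN n Γs)) :
    ∃ π' : Permutation (E.ren ρ) (Ctx.catN n fun i => (Γs i).ren ρ),
      I.permHom π' ≫ I.splitN n (fun i => (Γs i).ren ρ) ≫
          nTensorHom n (fun i => I.retype ((Γs i).map_snd_ren ρ)) =
        I.retype (E.map_snd_ren ρ) ≫ I.permHom π ≫ I.splitN n Γs := by
  obtain ⟨π₁, h₁⟩ := I.permHom_ren ρ π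
  obtain ⟨π₂, h₂⟩ := I.exists_permHom_eq_retype (Ctx.ren_catN ρ n Γs)
  obtain ⟨π₃, h₃⟩ := I.permHom_trans π₁ π₂
  refine ⟨π₃, ?_⟩
  rw [← reassoc_of% h₁, ← I.retype_splitN n (fun i => (Γs i).map_snd_ren ρ), h₃, h₂,
    Category.assoc, retype_retype_assoc]

/-- Renaming a term injectively does not change its interpretation. -/
theorem exists_den_rename {Γ : Ctx G} {v : Tm S} {A : Ty G} (d : Typed Γ v A) :
    ∀ (ρ : ℕ → ℕ) {E : Ctx G} (h : E = Γ.ren ρ), E.Valid → ∃ d' : Typed E (v.rename ρ) A,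
      I.den d' = I.retype ((congrArg _ h).trans (Γ.map_snd_ren ρ)) ≫ I.den d := by
  induction d with
  | ax f d s ih =>
    rintro ρ _ rfl hE
    obtain ⟨π, hπ⟩ := I.exists_ren_catN ρ s.perm
    choose d' hd using fun i => ih i ρ rfl (hE.of_sublist ((s.sub i).map _))
    obtain ⟨d'', h⟩ := Exchange.ax f (fun i => I.exchange (d' i)) hE π
    refine ⟨d'', h.trans ?_⟩
    simp only [hd, nTensorHom_comp, den, shuffleSplitN, Category.assoc]
    rw [reassoc_of% hπ]
  | hyp x A =>
    rintro ρ _ rfl hE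
    exact ⟨.hyp (ρ x) A, (Category.id_comp _).symm⟩
  | unitI =>
    rintro ρ _ rfl hE
    exact ⟨.unitI, (Category.id_comp _).symm⟩
  | unitE d₁ d₂ s ih₁ ih₂ =>
    rintro ρ _ rfl hE
    obtain ⟨π, hπ⟩ := I.exists_ren_cat ρ s.perm
    obtain ⟨d₁', h₁⟩ := ih₁ ρ rfl (hE.of_sublist (s.left.map _))
    obtain ⟨d₂', h₂⟩ := ih₂ ρ rfl (hE.of_sublist (s.right.map _))
    obtain ⟨d', h⟩ := (I.exchange d₁').unitE (I.exchange d₂') hE π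
    refine ⟨d', h.trans ?_⟩
    rw [h₁, h₂]
    exact (Category.assoc _ _ _).symm.trans ((split_leftUnitor hπ _ _).trans (Category.assoc _ _ _))
  | tensorI d₁ d₂ s ih₁ ih₂ =>
    rintro ρ _ rfl hE
    obtain ⟨π, hπ⟩ := I.exists_ren_cat ρ s.perm
    obtain ⟨d₁', h₁⟩ := ih₁ ρ rfl (hE.of_sublist (s.left.map _))
    obtain ⟨d₂', h₂⟩ := ih₂ ρ rfl (hE.of_sublist (s.right.map _))
    obtain ⟨d', h⟩ := (I.exchange d₁').tensorI (I.exchange d₂') hE π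
    refine ⟨d', h.trans ?_⟩
    rw [h₁, h₂]
    exact (Category.assoc _ _ _).symm.trans ((split_tensorHom hπ _ _).trans (Category.assoc _ _ _))
  | tensorE d₁ d₂ s ih₁ ih₂ =>
    rename_i A B D
    rintro ρ _ rfl hE
    obtain ⟨π, hπ⟩ := I.exists_ren_cat ρ s.perm
    have hΔ := hE.of_sublist (s.right.map _)
    obtain ⟨d₁', h₁⟩ := ih₁ ρ rfl (hE.of_sublist (s.left.map _))
    -- The renamed body context has the required shape only up to a proved equality, which is why
    -- the statement takes `E = Γ.ren ρ` as an argument.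
    obtain ⟨d₂', h₂⟩ := ih₂ _ (Ctx.ren_upRen_cons_cons ρ A B _).symm
      (Ctx.valid_cons_cons_lift A B hΔ)
    obtain ⟨d', h⟩ := (I.exchange d₁').tensorE (I.exchange d₂') hE π
    refine ⟨d', h.trans ?_⟩
    rw [h₁, h₂]
    exact (Category.assoc _ _ _).symm.trans
      ((split_braiding hπ (I.joinBound2_retype A B (Ctx.map_snd_ren ρ _) _) _ _).trans
        (Category.assoc _ _ _))
  | lolliI d ih =>
    rename_i A B
    rintro ρ _ rfl hE
    obtain ⟨d₁, h₁⟩ := ih _ (Ctx.ren_upRen_cons ρ A _).symm (Ctx.valid_cons_lift A hE)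
    obtain ⟨d', h⟩ := (I.exchange d₁).lolliI hE (.refl _)
    refine ⟨d', h.trans ?_⟩
    rw [h₁, permHom_refl, reassoc_of% I.joinBound_retype A (Ctx.map_snd_ren ρ _),
      transpose_comp_left]
    exact Category.id_comp _
  | lolliE d₁ d₂ s ih₁ ih₂ =>
    rintro ρ _ rfl hE
    obtain ⟨π, hπ⟩ := I.exists_ren_cat ρ s.perm
    obtain ⟨d₁', h₁⟩ := ih₁ ρ rfl (hE.of_sublist (s.left.map _))
    obtain ⟨d₂', h₂⟩ := ih₂ ρ rfl (hE.of_sublist (s.right.map _))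
    obtain ⟨d', h⟩ := (I.exchange d₁').lolliE (I.exchange d₂') hE π
    refine ⟨d', h.trans ?_⟩
    rw [h₁, h₂]
    exact (Category.assoc _ _ _).symm.trans
      ((split_tensorHom_assoc hπ _ _ _).trans (Category.assoc _ _ _))

end Interpretation

end LinLam

/-! ### Simultaneous substitution -/

namespace LinLam

variable {G : Type u} {S : Signature.{u, v} G}
variable {C : Type u₁} [Category.{v₁} C] [MonoidalCategory C]

theorem tensorHom_comp_whiskerRight_of_eq {X Y Z W D A : C} {g : X ⟶ Y} {k : Y ⟶ Z} {w : X ⟶ W}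
    {m : W ⟶ Z} (h : g ≫ k = w ≫ m) (d : D ⟶ A) :
    (g ⊗ₘ d) ≫ k ▷ A = w ▷ D ≫ (m ⊗ₘ d) := by
  rw [← tensorHom_id, ← tensorHom_id, tensorHom_comp_tensorHom, tensorHom_comp_tensorHom, h,
    Category.comp_id, Category.id_comp]

theorem comp_leftUnitor_comp {X Y Z W : C} (p : X ⟶ Y) (s : Y ⟶ 𝟙_ C ⊗ Z) (d : Z ⟶ W) :
    (p ≫ s ≫ (λ_ Z).hom) ≫ d = (p ≫ s ≫ (𝟙 (𝟙_ C) ⊗ₘ d) ≫ (λ_ W).hom) ≫ 𝟙 W := by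
  simp

variable [MonoidalClosed C] [SymmetricCategory C]

namespace Interpretation

variable (I : Interpretation C S)

/-- `f` interprets the simultaneous substitution `σ` of terms in context `E` for the variables
of `Γ`. -/
def IsSubst (σ : ℕ → Tm S) : (Γ E : Ctx G) → (I.ctx E ⟶ I.ctx Γ) → Prop
  | [], E, f => ∃ π : Permutation E [], f = I.permHom π
  | p :: Γ, E, f => ∃ (E₁ E₂ : Ctx G) (π : Permutation E (E₁.cat E₂)) (g : I.ctx E₁ ⟶ I.ctx Γ)
      (d : Typed E₂ (σ p.1) p.2), IsSubst σ Γ E₁ g ∧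
        f = I.permHom π ≫ (I.splitIso E₁ E₂).hom ≫ (g ⊗ₘ I.den d) ≫ (I.snocIso Γ p).inv

variable {I} {σ : ℕ → Tm S}

theorem IsSubst.cons {Γ E₁ E₂ : Ctx G} {p : ℕ × Ty G} {g : I.ctx E₁ ⟶ I.ctx Γ}
    (h : I.IsSubst σ Γ E₁ g) (d : Typed E₂ (σ p.1) p.2) :
    I.IsSubst σ (p :: Γ) (E₁.cat E₂)
      ((I.splitIso E₁ E₂).hom ≫ (g ⊗ₘ I.den d) ≫ (I.snocIso Γ p).inv) :=
  ⟨_, _, .refl _, g, d, h, by simp⟩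

/-- `IsSubst` lists the substituted terms last variable first. To reach one in the middle, its block
of `E` is swapped past the blocks of the later variables, and this wire is again a permutation. -/
theorem IsSubst.comp_extractHom {p : ℕ × Ty G} {Γ' Γ : Ctx G} (i : Insertion p Γ' Γ) :
    ∀ {E : Ctx G} {f : I.ctx E ⟶ I.ctx Γ}, I.IsSubst σ Γ E f →
    ∃ (E₁ E₂ : Ctx G) (π : Permutation E (E₁.cat E₂)) (g : I.ctx E₁ ⟶ I.ctx Γ')
      (d : Typed E₂ (σ p.1) p.2), I.IsSubst σ Γ' E₁ g ∧
        f ≫ I.extractHom i = I.permHom π ≫ (I.splitIso E₁ E₂).hom ≫ (g ⊗ₘ I.den d) := by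
  induction i with
  | here Γ =>
    rintro E f ⟨E₁, E₂, π, g, d, h, rfl⟩
    exact ⟨E₁, E₂, π, g, d, h, by simp [extractHom_here]⟩
  | there q i ih =>
    rename_i Γ' Γ
    rintro E f ⟨E₁, E₂, π, g, d, h, rfl⟩
    obtain ⟨E₃, E₄, π', g', d', h', e⟩ := ih h
    let W : I.ctx E ⟶ (I.ctx E₃ ⊗ I.ctx E₂) ⊗ I.ctx E₄ := I.permHom π ≫ (I.splitIso E₁ E₂).hom ≫
      (I.permHom π' ≫ (I.splitIso E₃ E₄).hom) ▷ I.ctx E₂ ≫ swapR _ _ _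
    have hw : I.IsWire (.ctx E) (.node (.node (.ctx E₃) (.ctx E₂)) (.ctx E₄)) W :=
      .comp (.permHom π) <| .comp (.split E₁ E₂) <|
        .comp (.whiskerRight (.comp (.permHom π') (.split E₃ E₄)) (.ctx E₂))
        (.swapR (.ctx E₃) (.ctx E₄) (.ctx E₂))
    obtain ⟨π'', e'⟩ := hw.exists_permHom_split_right
    refine ⟨E₃.cat E₂, E₄, π'', _, d', h'.cons d, ?_⟩
    have e₁ : (g ⊗ₘ I.den d) ≫ I.extractHom i ▷ I.ty q.2 = (I.permHom π' ≫ (I.splitIso E₃ E₄).hom) ▷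
        I.ctx E₂ ≫ ((g' ⊗ₘ I.den d') ⊗ₘ I.den d) := by
      exact tensorHom_comp_whiskerRight_of_eq (by rw [e, Category.assoc]) _
    simp only [extractHom_there, Category.assoc, Iso.inv_hom_id_assoc]
    rw [reassoc_of% e₁, reassoc_of% swapR_naturality]
    have e₂ := e' =≫ ((g' ⊗ₘ I.den d) ≫ (I.snocIso Γ' q).inv ⊗ₘ I.den d')
    simp only [W, Category.assoc, ← tensorHom_id, tensorHom_comp_tensorHom, Category.id_comp,
      Category.comp_id] at e₂ ⊢
    exact e₂.symm

theorem IsSubst.comp_permHom {Γ Γ' : Ctx G} (π : Permutation Γ Γ') :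
    ∀ {E : Ctx G} {f : I.ctx E ⟶ I.ctx Γ}, I.IsSubst σ Γ E f →
      I.IsSubst σ Γ' E (f ≫ I.permHom π) := by
  induction π with
  | nil =>
    intro E f h
    rwa [show I.permHom .nil = 𝟙 (I.ctx []) from rfl, Category.comp_id]
  | cons i π ih =>
    intro E f h
    obtain ⟨E₁, E₂, π', g, d, h', e⟩ := h.comp_extractHom i
    refine ⟨E₁, E₂, π', _, d, ih h', ?_⟩
    rw [permHom_cons, reassoc_of% e, ← tensorHom_id, tensorHom_comp_tensorHom_assoc,
      Category.comp_id]

/-- The blocks that belong to `Δ` are peeled off from the end and collected in `E₂`, one associator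
each; what is left substitutes for `Γ`. -/
theorem IsSubst.comp_split {Γ : Ctx G} : ∀ {Δ E : Ctx G} {f : I.ctx E ⟶ I.ctx (Γ.cat Δ)},
    I.IsSubst σ (Γ.cat Δ) E f →
    ∃ (E₁ E₂ : Ctx G) (π : Permutation E (E₁.cat E₂)) (f₁ : I.ctx E₁ ⟶ I.ctx Γ)
      (f₂ : I.ctx E₂ ⟶ I.ctx Δ), I.IsSubst σ Γ E₁ f₁ ∧ I.IsSubst σ Δ E₂ f₂ ∧
        (I.permHom π ≫ (I.splitIso E₁ E₂).hom) ≫ (f₁ ⊗ₘ f₂) = f ≫ (I.splitIso Γ Δ).hom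
  | [], E, f, h => by
    refine ⟨E, [], .refl _, f, 𝟙 _, h, ⟨.nil, rfl⟩, ?_⟩
    change (I.permHom (.refl E) ≫ (ρ_ (I.ctx E)).inv) ≫ (f ⊗ₘ 𝟙 (𝟙_ C)) = f ≫ (ρ_ (I.ctx Γ)).inv
    simp
  | p :: Δ, E, f, h => by
    obtain ⟨E₀, E₃, π, (g : I.ctx E₀ ⟶ I.ctx (Γ.cat Δ)), d, h, hf⟩ := h
    obtain ⟨E₁, E₂, π', f₁, f₂, h₁, h₂, e⟩ := comp_split h
    have hf : f = I.permHom π ≫ (I.splitIso E₀ E₃).hom ≫ (g ⊗ₘ I.den d) ≫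
      (I.snocIso (Γ.cat Δ) p).inv := hf
    let W : I.ctx E ⟶ I.ctx E₁ ⊗ (I.ctx E₂ ⊗ I.ctx E₃) := I.permHom π ≫ (I.splitIso E₀ E₃).hom ≫
      (I.permHom π' ≫ (I.splitIso E₁ E₂).hom) ▷ I.ctx E₃ ≫ (α_ _ _ _).hom
    have hw : I.IsWire (.ctx E) (.node (.ctx E₁) (.node (.ctx E₂) (.ctx E₃))) W :=
      .comp (.permHom π) <| .comp (.split E₀ E₃) <|
        .comp (.whiskerRight (.comp (.permHom π') (.split E₁ E₂)) (.ctx E₃))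
        (.associator (.ctx E₁) (.ctx E₂) (.ctx E₃))
    obtain ⟨π'', e'⟩ := hw.exists_permHom_split_left
    refine ⟨E₁, E₂.cat E₃, π'', f₁, _, h₁, h₂.cons d, ?_⟩
    have e₁ : (g ⊗ₘ I.den d) ≫ (I.splitIso Γ Δ).hom ▷ I.ty p.2 =
        (I.permHom π' ≫ (I.splitIso E₁ E₂).hom) ▷ I.ctx E₃ ≫ ((f₁ ⊗ₘ f₂) ⊗ₘ I.den d) := by
      exact tensorHom_comp_whiskerRight_of_eq e.symm _
    have e₂ := e' =≫ (f₁ ⊗ₘ (f₂ ⊗ₘ I.den d) ≫ (I.snocIso Δ p).inv)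
    rw [splitIso_cons_hom, hf]
    simp only [Category.assoc, Iso.inv_hom_id_assoc]
    rw [reassoc_of% e₁]
    simp only [W, Category.assoc, ← id_tensorHom, tensorHom_comp_tensorHom, Category.id_comp,
      associator_naturality_assoc, Category.comp_id] at e₂ ⊢
    exact e₂

theorem IsSubst.comp_splitN : ∀ (n : ℕ) {Γs : Fin n → Ctx G} {E : Ctx G}
    {f : I.ctx E ⟶ I.ctx (Ctx.catN n Γs)}, I.IsSubst σ (Ctx.catN n Γs) E f →
    ∃ (Es : Fin n → Ctx G) (π : Permutation E (Ctx.catN n Es)) (fs : ∀ i, I.ctx (Es i) ⟶ I.ctx (Γs i)),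
      (∀ i, I.IsSubst σ (Γs i) (Es i) (fs i)) ∧
        I.permHom π ≫ I.splitN n Es ≫ nTensorHom n fs = f ≫ I.splitN n Γs
  | 0, _, E, f, h => by
    obtain ⟨π, rfl⟩ := h
    exact ⟨fun _ => [], π, fun i => i.elim0, fun i => i.elim0,
      congrArg (I.permHom π ≫ ·) (Category.id_comp _)⟩
  | 1, Γs, E, f, h => by
    refine ⟨fun _ => E, .refl _, fun i => Subsingleton.elim 0 i ▸ f, fun i => ?_, ?_⟩
    · obtain rfl := Subsingleton.elim 0 i
      exact h
    · change I.permHom (.refl E) ≫ _ = _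
      rw [permHom_refl]
      exact (Category.id_comp _).trans ((Category.id_comp _).trans (Category.comp_id _).symm)
  | n + 2, Γs, E, f, h => by
    obtain ⟨E₁, E₂, π, f₁, f₂, h₁, h₂, e⟩ := comp_split h
    obtain ⟨Es, π', fs, hs, e'⟩ := comp_splitN (n + 1) h₁
    -- All blocks are packed into one dependent family, and the separate blocks are then replaced by
    -- its values, so that no transport along `Fin.lastCases` enters the goal.
    obtain ⟨y, hy, hy'⟩ : ∃ y : ∀ i : Fin (n + 2),
        {x : Σ E' : Ctx G, (I.ctx E' ⟶ I.ctx (Γs i)) // I.IsSubst σ (Γs i) x.1 x.2},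
        (∀ i, y i.castSucc = ⟨⟨Es i, fs i⟩, hs i⟩) ∧ y (Fin.last (n + 1)) = ⟨⟨E₂, f₂⟩, h₂⟩ :=
      ⟨Fin.lastCases ⟨⟨E₂, f₂⟩, h₂⟩ fun i => ⟨⟨Es i, fs i⟩, hs i⟩, by simp, by simp⟩
    have hE : E₂ = (y (Fin.last (n + 1))).1.1 := by rw [hy']
    obtain rfl : Es = fun i : Fin (n + 1) => (y i.castSucc).1.1 := by ext1 i; rw [hy]
    obtain rfl : fs = fun i : Fin (n + 1) => (y i.castSucc).1.2 := by
      ext1 i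
      have := congrArg Subtype.val (hy i)
      exact (eq_of_heq (Sigma.mk.inj this).2).symm
    subst hE
    obtain rfl : f₂ = (y (Fin.last (n + 1))).1.2 := by
      have := congrArg Subtype.val hy'
      exact (eq_of_heq (Sigma.mk.inj this).2).symm
    obtain ⟨π₁, e₁⟩ := I.permHom_cat π' (.refl (y (Fin.last (n + 1))).1.1)
    obtain ⟨π₂, e₂⟩ := I.permHom_trans π π₁
    refine ⟨fun i => (y i).1.1, π₂, fun i => (y i).1.2, fun i => (y i).2, ?_⟩
    have key : ∀ {X₀ X X' Y Z Y' Z' W W' D : C} {p₂ : X₀ ⟶ X'} {p : X₀ ⟶ X} {p₁ : X ⟶ X'} {s : X' ⟶ Y ⊗ Z}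
        {s' : X ⟶ Y' ⊗ Z} {q : Y' ⟶ Y} {r : Y ⟶ W} {a : W ⟶ W'} {b : Z ⟶ Z'} {g : Y' ⟶ D} {k : D ⟶ W'}
        (_ : p₂ = p ≫ p₁) (_ : p₁ ≫ s = s' ≫ (q ⊗ₘ 𝟙 Z)) (_ : q ≫ r ≫ a = g ≫ k) {l : X₀ ⟶ D ⊗ Z'}
        (_ : (p ≫ s') ≫ (g ⊗ₘ b) = l), p₂ ≫ (s ≫ r ▷ Z) ≫ (a ⊗ₘ b) = l ≫ k ▷ Z' := by
      intro _ _ _ _ _ _ _ _ _ _ p₂ p p₁ s s' q r a b g k h₁ h₂ h₃ l h₄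
      rw [← h₄, h₁]
      simp only [Category.assoc]
      rw [reassoc_of% h₂, ← tensorHom_id, ← tensorHom_id, tensorHom_comp_tensorHom,
        tensorHom_comp_tensorHom, tensorHom_comp_tensorHom, h₃]
      simp
    rw [permHom_refl] at e₁
    exact (key e₂ e₁ e' e).trans (Category.assoc _ _ _)

/-! ## Substitutions of variables and substitutions under binders -/

theorem IsSubst.cons_var {Γ E : Ctx G} {f : I.ctx E ⟶ I.ctx Γ} (h : I.IsSubst σ Γ E f) {x y : ℕ}
    (hx : σ x = .var y) (A : Ty G) :
    I.IsSubst σ ((x, A) :: Γ) ((y, A) :: E)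
      ((I.snocIso E (y, A)).hom ≫ f ▷ I.ty A ≫ (I.snocIso Γ (x, A)).inv) := by
  obtain ⟨d, hd⟩ : ∃ d : Typed [(y, A)] (σ x) A, I.den d = 𝟙 (I.ty A) := by
    rw [hx]
    exact ⟨.hyp y A, rfl⟩
  have := h.cons (p := (x, A)) d
  rw [splitIso_singleton, hd] at this
  erw [tensorHom_id] at this
  exact this

theorem IsSubst.of_ren (ρ : ℕ → ℕ) : ∀ {Γ E : Ctx G} (h : E = Γ.ren ρ)
    (_ : ∀ p ∈ Γ, σ p.1 = .var (ρ p.1)),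
    I.IsSubst σ Γ E (I.retype ((congrArg _ h).trans (Γ.map_snd_ren ρ)))
  | [], _, rfl, _ => ⟨.nil, rfl⟩
  | (x, A) :: Γ, _, rfl, hσ => by
    have ih := IsSubst.of_ren ρ (Γ := Γ) rfl fun p hp => hσ p (List.mem_cons_of_mem _ hp)
    have := ih.cons_var (hσ (x, A) (List.mem_cons_self ..)) A
    have e := I.retype_cons (ρ x) x A (Ctx.map_snd_ren ρ Γ) (Ctx.map_snd_ren ρ ((x, A) :: Γ))
    exact e ▸ this

/-- `τ` is `σ` carried under `k` binders, as `hτ` expresses term by term. For `k = 1, 2` this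
hypothesis comes from the renaming lemma. -/
theorem IsSubst.lift {τ : ℕ → Tm S} (k : ℕ)
    (hτ : ∀ {x : ℕ} {E : Ctx G} {A : Ty G} (d : Typed E (σ x) A),
      ∃ d' : Typed (E.lift k) (τ (x + k)) A, I.den d' = I.retype (E.map_snd_lift k) ≫ I.den d) :
    ∀ {Γ E : Ctx G} {f : I.ctx E ⟶ I.ctx Γ}, I.IsSubst σ Γ E f →
      ∃ f', I.IsSubst τ (Γ.lift k) (E.lift k) f' ∧
        f' ≫ I.retype (Γ.map_snd_lift k) = I.retype (E.map_snd_lift k) ≫ f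
  | [], E, f, h => by
    obtain ⟨π, rfl⟩ := h
    obtain ⟨π', h⟩ := I.permHom_lift k π
    exact ⟨_, ⟨π', rfl⟩, h⟩
  | (x, A) :: Γ, E, f, h => by
    obtain ⟨E₁, E₂, π, g, d, h, rfl⟩ := h
    obtain ⟨g', hg, e⟩ := IsSubst.lift k hτ h
    obtain ⟨d', hd⟩ := hτ d
    obtain ⟨π', e'⟩ := I.exists_lift_cat k π
    refine ⟨_, ⟨E₁.lift k, E₂.lift k, π', g', d', hg, rfl⟩, ?_⟩
    have e₁ := I.retype_cons (x + k) x A (Ctx.map_snd_lift k Γ) (Ctx.map_snd_lift k ((x, A) :: Γ))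
    have key : ∀ {X₀ X Y Z Y' Z' D D' A W W' T : C} {q : X₀ ⟶ X} {s : X ⟶ Y ⊗ Z} {a : Y ⟶ D}
        {b : Z ⟶ A} {i : W ≅ D ⊗ A} {r : D ⟶ D'} {j : D' ⊗ A ⟶ W'} {y : Y ⟶ Y'} {z : Z ⟶ Z'}
        {g : Y' ⟶ D'} {d : Z' ⟶ A} {t : X₀ ⟶ T} {p : T ⟶ Y' ⊗ Z'} (_ : a ≫ r = y ≫ g)
        (_ : b = z ≫ d) (_ : (q ≫ s) ≫ (y ⊗ₘ z) = t ≫ p),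
        (q ≫ s ≫ (a ⊗ₘ b) ≫ i.inv) ≫ i.hom ≫ r ▷ A ≫ j = t ≫ p ≫ (g ⊗ₘ d) ≫ j := by
      rintro _ _ _ _ _ _ _ _ _ _ _ _ q s a _ i r j y z g d t p h₁ rfl h₃
      have : (q ≫ s ≫ (a ⊗ₘ z ≫ d) ≫ i.inv) ≫ i.hom ≫ r ▷ _ ≫ j =
          (q ≫ s) ≫ (a ≫ r ⊗ₘ z ≫ d) ≫ j := by simp [tensorHom_def']
      rw [this, h₁, ← tensorHom_comp_tensorHom, Category.assoc (_ ⊗ₘ _),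
        ← Category.assoc (q ≫ s), h₃, Category.assoc]
    exact (congrArg _ e₁).trans
      ((key e hd (e'.trans (Category.assoc _ _ _).symm)).trans (by simp only [Category.assoc]))

/-- Substituting variables for all but one variable. -/
theorem IsSubst.cons_of_ren (ρ : ℕ → ℕ) {Γ E Δ : Ctx G} (h : E = Γ.ren ρ)
    (hσ : ∀ p ∈ Γ, σ p.1 = .var (ρ p.1)) {x : ℕ} {A : Ty G} (d : Typed Δ (σ x) A) :
    I.IsSubst σ ((x, A) :: Γ) (E.cat Δ) ((I.splitIso E Δ).hom ≫
      (I.retype ((congrArg _ h).trans (Γ.map_snd_ren ρ)) ⊗ₘ I.den d) ≫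
        (I.snocIso Γ (x, A)).inv) :=
  (IsSubst.of_ren ρ h hσ).cons (p := (x, A)) d

theorem exists_den_upSub (I : Interpretation C S) {σ : ℕ → Tm S} {x : ℕ} {E : Ctx G} {A : Ty G}
    (d : Typed E (σ x) A) :
    ∃ d' : Typed (E.lift 1) (Tm.upSub σ (x + 1)) A,
      I.den d' = I.retype (E.map_snd_lift 1) ≫ I.den d :=
  I.exists_den_rename d Nat.succ rfl ((Ctx.valid_lift_iff 1 E).2 d.valid)

theorem exists_den_upSub_upSub (I : Interpretation C S) {σ : ℕ → Tm S} {x : ℕ} {E : Ctx G}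
    {A : Ty G} (d : Typed E (σ x) A) :
    ∃ d' : Typed (E.lift 2) (Tm.upSub (Tm.upSub σ) (x + 2)) A,
      I.den d' = I.retype (E.map_snd_lift 2) ≫ I.den d := by
  obtain ⟨d₁, h₁⟩ := I.exists_den_upSub d
  obtain ⟨d₂, h₂⟩ := I.exists_den_rename d₁ Nat.succ (E := E.lift 2)
    (by simp [Ctx.lift, Ctx.ren]) ((Ctx.valid_lift_iff 2 E).2 d.valid)
  exact ⟨d₂, h₂.trans (by rw [h₁, retype_retype_assoc])⟩

/-- The substitution lemma. -/
theorem exists_den_subst (I : Interpretation C S) {Γ : Ctx G} {v : Tm S} {A : Ty G}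
    (d : Typed Γ v A) : ∀ {σ : ℕ → Tm S} {E : Ctx G} {f : I.ctx E ⟶ I.ctx Γ}, E.Valid →
      I.IsSubst σ Γ E f → ∃ d' : Typed E (v.subst σ) A, I.den d' = f ≫ I.den d := by
  induction d with
  | ax f d s ih =>
    intro σ E g hE hg
    obtain ⟨Es, π, fs, hs, e⟩ := IsSubst.comp_splitN _ (hg.comp_permHom s.perm)
    have hEs : ∀ i, (Es i).Valid := fun i =>
      (hE.of_perm π.toPerm).of_sublist (Ctx.sublist_catN _ Es i)
    choose d' hd using fun i => ih i (hEs i) (hs i)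
    obtain ⟨d'', h⟩ := Exchange.ax f (fun i => I.exchange (d' i)) hE π
    refine ⟨d'', h.trans ?_⟩
    simp only [hd, nTensorHom_comp, den, shuffleSplitN, Category.assoc]
    rw [reassoc_of% e]
  | hyp x A =>
    -- The one substituted term is the result. The block for the empty remainder is itself empty,
    -- and exchange removes it from `Ctx.cat [] E₂`.
    rintro σ E g hE ⟨E₁, E₂, π, g, d, ⟨π₁, rfl⟩, rfl⟩
    obtain rfl := List.perm_nil.1 π₁.toPerm
    rw [π₁.unique List.nodup_nil .nil]
    obtain ⟨π₀, h₀⟩ := I.permHom_nil_cat E₂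
    obtain ⟨π', e⟩ := I.permHom_trans π π₀
    obtain ⟨d', h⟩ := I.exchange d hE π'
    refine ⟨d', h.trans ?_⟩
    rw [e, h₀]
    exact comp_leftUnitor_comp _ _ _
  | unitI =>
    rintro σ E g hE ⟨π, rfl⟩
    obtain rfl := List.perm_nil.1 π.toPerm
    rw [π.unique List.nodup_nil .nil]
    exact ⟨.unitI, (Category.id_comp _).symm⟩
  | unitE d₁ d₂ s ih₁ ih₂ =>
    intro σ E g hE hg
    obtain ⟨E₁, E₂, π, f₁, f₂, hf₁, hf₂, e⟩ := (hg.comp_permHom s.perm).comp_split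
    have hE' := hE.of_perm π.toPerm
    obtain ⟨d₁', h₁⟩ := ih₁ (hE'.of_sublist (List.sublist_append_right _ _)) hf₁
    obtain ⟨d₂', h₂⟩ := ih₂ (hE'.of_sublist (List.sublist_append_left _ _)) hf₂
    obtain ⟨d', h⟩ := (I.exchange d₁').unitE (I.exchange d₂') hE π
    refine ⟨d', h.trans ?_⟩
    rw [h₁, h₂]
    rw [Category.assoc g] at e
    exact (Category.assoc _ _ _).symm.trans
      ((split_leftUnitor e _ _).trans (Category.assoc _ _ _))
  | tensorI d₁ d₂ s ih₁ ih₂ =>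
    intro σ E g hE hg
    obtain ⟨E₁, E₂, π, f₁, f₂, hf₁, hf₂, e⟩ := (hg.comp_permHom s.perm).comp_split
    have hE' := hE.of_perm π.toPerm
    obtain ⟨d₁', h₁⟩ := ih₁ (hE'.of_sublist (List.sublist_append_right _ _)) hf₁
    obtain ⟨d₂', h₂⟩ := ih₂ (hE'.of_sublist (List.sublist_append_left _ _)) hf₂
    obtain ⟨d', h⟩ := (I.exchange d₁').tensorI (I.exchange d₂') hE π
    refine ⟨d', h.trans ?_⟩
    rw [h₁, h₂]
    rw [Category.assoc g] at e
    exact (Category.assoc _ _ _).symm.trans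
      ((split_tensorHom e _ _).trans (Category.assoc _ _ _))
  | tensorE d₁ d₂ s ih₁ ih₂ =>
    rename_i A B D
    intro σ E g hE hg
    obtain ⟨E₁, E₂, π, f₁, f₂, hf₁, hf₂, e⟩ := (hg.comp_permHom s.perm).comp_split
    have hE' := hE.of_perm π.toPerm
    have hE₂ := hE'.of_sublist (List.sublist_append_left E₂ E₁)
    -- The lifted substitution is extended by the bound variables `1` and `0`, which it fixes.
    obtain ⟨f₃, hf₃, e₃⟩ := hf₂.lift 2 I.exists_den_upSub_upSub
    obtain ⟨d₁', h₁⟩ := ih₁ (hE'.of_sublist (List.sublist_append_right _ _)) hf₁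
    obtain ⟨d₂', h₂⟩ := ih₂ (Ctx.valid_cons_cons_lift A B hE₂)
      ((hf₃.cons_var (x := 1) (y := 1) rfl A).cons_var (x := 0) (y := 0) rfl B)
    obtain ⟨d', h⟩ := (I.exchange d₁').tensorE (I.exchange d₂') hE π
    refine ⟨d', h.trans ?_⟩
    rw [h₁, h₂]
    rw [Category.assoc g] at e
    exact (Category.assoc _ _ _).symm.trans
      ((split_braiding e (I.joinBound2_naturality A B _ _ e₃) _ _).trans (Category.assoc _ _ _))
  | lolliI d ih =>
    rename_i A B
    intro σ E g hE hg
    obtain ⟨f₃, hf₃, e₃⟩ := hg.lift 1 I.exists_den_upSub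
    obtain ⟨d₁, h₁⟩ := ih (Ctx.valid_cons_lift A hE)
      (hf₃.cons_var (x := 0) (y := 0) rfl A)
    obtain ⟨d', h⟩ := (I.exchange d₁).lolliI hE (.refl _)
    refine ⟨d', h.trans ?_⟩
    have := I.joinBound_naturality A _ _ e₃
    rw [h₁, permHom_refl, Category.id_comp]
    refine Eq.trans ?_ (transpose_comp_left _ _)
    rw [← reassoc_of% this]
    simp only [Category.assoc]
    rfl
  | lolliE d₁ d₂ s ih₁ ih₂ =>
    intro σ E g hE hg
    obtain ⟨E₁, E₂, π, f₁, f₂, hf₁, hf₂, e⟩ := (hg.comp_permHom s.perm).comp_split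
    have hE' := hE.of_perm π.toPerm
    obtain ⟨d₁', h₁⟩ := ih₁ (hE'.of_sublist (List.sublist_append_right _ _)) hf₁
    obtain ⟨d₂', h₂⟩ := ih₂ (hE'.of_sublist (List.sublist_append_left _ _)) hf₂
    obtain ⟨d', h⟩ := (I.exchange d₁').lolliE (I.exchange d₂') hE π
    refine ⟨d', h.trans ?_⟩
    rw [h₁, h₂]
    rw [Category.assoc g] at e
    exact (Category.assoc _ _ _).symm.trans
      ((split_tensorHom_assoc e _ _ _).trans (Category.assoc _ _ _))

end Interpretation

end LinLam

/-! ### Uniqueness of derivations -/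

namespace LinLam

variable {G : Type u} {S : Signature.{u, v} G}

/-- The variable `x` is free in a term. -/
def Tm.IsFree : ℕ → Tm S → Prop
  | x, .var n => x = n
  | x, .op _ vs => ∃ i, IsFree x (vs i)
  | _, .star => False
  | x, .letUnit v w => IsFree x v ∨ IsFree x w
  | x, .tensor v w => IsFree x v ∨ IsFree x w
  | x, .letPair v w => IsFree x v ∨ IsFree (x + 2) w
  | x, .lam _ v => IsFree (x + 1) v
  | x, .app v w => IsFree x v ∨ IsFree x w

/-- A sublist of a duplicate-free context is recovered from its set of names by filtering. -/
theorem Ctx.eq_of_sublist {E : Ctx G} : ∀ {Γ Γ' : Ctx G}, E.Valid → Γ.Sublist E → Γ'.Sublist E →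
    (∀ x, x ∈ Γ.map Prod.fst ↔ x ∈ Γ'.map Prod.fst) → Γ = Γ' := by
  have key : ∀ {Γ : Ctx G} (P : ℕ → Prop) [DecidablePred P], E.Valid → Γ.Sublist E →
      (∀ x, x ∈ Γ.map Prod.fst ↔ P x) → E.filter (fun p => P p.1) = Γ := by
    intro Γ P _ hE hΓ hP
    have h : (E.filter (fun p => P p.1)).Perm Γ := by
      refine (List.perm_ext_iff_of_nodup (hE.nodup.filter _) (hE.of_sublist hΓ).nodup).2 ?_
      rintro ⟨x, A⟩
      simp only [List.mem_filter, decide_eq_true_eq, ← hP]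
      refine ⟨fun ⟨h, h'⟩ => ?_, fun h => ⟨hΓ.subset h, List.mem_map_of_mem h⟩⟩
      obtain ⟨⟨y, B⟩, hB, rfl⟩ := List.mem_map.1 h'
      have := List.inj_on_of_nodup_map hE h (hΓ.subset hB) rfl
      rwa [this]
    have h' : Γ.filter (fun p => P p.1) = Γ :=
      List.filter_eq_self.2 fun p hp => decide_eq_true ((hP p.1).1 (List.mem_map_of_mem hp))
    refine (List.Sublist.eq_of_length ?_ h.length_eq.symm).symm
    have := hΓ.filter (fun p => P p.1)
    rwa [h'] at this
  intro Γ Γ' hE h h' hx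
  classical
  rw [← key (· ∈ Γ.map Prod.fst) hE h (fun _ => Iff.rfl),
    key (· ∈ Γ.map Prod.fst) hE h' fun x => (hx x).symm]

theorem Ctx.mem_lift (k : ℕ) (Γ : Ctx G) (x : ℕ) :
    x + k ∈ (Γ.lift k).map Prod.fst ↔ x ∈ Γ.map Prod.fst := by
  simp [Ctx.lift]

theorem Shuffle.mem_iff {Γ Δ E : Ctx G} (s : Shuffle Γ Δ E) (x : ℕ) :
    x ∈ E.map Prod.fst ↔ x ∈ Γ.map Prod.fst ∨ x ∈ Δ.map Prod.fst := by
  rw [(s.perm.toPerm.map Prod.fst).mem_iff, Ctx.cat, List.map_append, List.mem_append, or_comm]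

theorem Ctx.mem_catN (x : ℕ) : ∀ (n : ℕ) (Γs : Fin n → Ctx G),
    x ∈ (Ctx.catN n Γs).map Prod.fst ↔ ∃ i, x ∈ (Γs i).map Prod.fst
  | 0, _ => by simp [catN]
  | 1, _ => by simp [catN]
  | n + 2, Γs => by
    rw [catN, Fin.exists_fin_succ', ← mem_catN x (n + 1), Ctx.cat, List.map_append, List.mem_append,
      or_comm]

/-- Linearity: nothing in a context goes unused, so the term alone decides which variables each
premise receives. -/
theorem Typed.mem_iff {Γ : Ctx G} {v : Tm S} {A : Ty G} (d : Typed Γ v A) :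
    ∀ x, x ∈ Γ.map Prod.fst ↔ v.IsFree x := by
  induction d with
  | ax f d s ih =>
    intro x
    rw [(s.perm.toPerm.map Prod.fst).mem_iff, Ctx.mem_catN]
    simp only [ih, Tm.IsFree]
  | hyp x A => simp [Tm.IsFree]
  | unitI => simp [Tm.IsFree]
  | unitE d₁ d₂ s ih₁ ih₂ => exact fun x => by rw [s.mem_iff, ih₁, ih₂, Tm.IsFree]
  | tensorI d₁ d₂ s ih₁ ih₂ => exact fun x => by rw [s.mem_iff, ih₁, ih₂, Tm.IsFree]
  | tensorE d₁ d₂ s ih₁ ih₂ =>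
    intro x
    rw [s.mem_iff, ih₁, Tm.IsFree, ← ih₂, ← Ctx.mem_lift 2]
    simp
  | lolliI d ih =>
    intro x
    rw [Tm.IsFree, ← ih, ← Ctx.mem_lift 1]
    simp
  | lolliE d₁ d₂ s ih₁ ih₂ => exact fun x => by rw [s.mem_iff, ih₁, ih₂, Tm.IsFree]

theorem Typed.ctx_unique {Γ Γ' E : Ctx G} {v : Tm S} {A A' : Ty G} (d : Typed Γ v A)
    (d' : Typed Γ' v A') (hE : E.Valid) (h : Γ.Sublist E) (h' : Γ'.Sublist E) : Γ = Γ' :=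
  Ctx.eq_of_sublist hE h h' fun x => by rw [d.mem_iff, d'.mem_iff]

instance {Γ Δ E : Ctx G} : Subsingleton (Shuffle Γ Δ E) :=
  ⟨fun s s' => by
    cases s
    cases s'
    congr 1
    exact Permutation.unique (Ctx.Valid.nodup ‹_›) _ _⟩

instance {n : ℕ} {Γs : Fin n → Ctx G} {E : Ctx G} : Subsingleton (ShuffleN Γs E) :=
  ⟨fun s s' => by
    cases s
    cases s'
    congr 1
    exact Permutation.unique (Ctx.Valid.nodup ‹_›) _ _⟩

/-- A term has at most one type in a context, and at most one derivation. -/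
theorem Typed.unique {Γ : Ctx G} {v : Tm S} {A : Ty G} (d : Typed Γ v A) :
    ∀ {A' : Ty G} (d' : Typed Γ v A'), A = A' ∧ HEq d d' := by
  induction d with
  | ax f d s ih =>
    intro A' d'
    cases d' with
    | ax _ d' s' =>
      obtain rfl := funext fun i => (d i).ctx_unique (d' i) s.valid (s.sub i) (s'.sub i)
      obtain rfl := funext fun i => eq_of_heq (ih i (d' i)).2
      obtain rfl := Subsingleton.elim s s'
      exact ⟨rfl, .rfl⟩
  | hyp x A =>
    intro A' d'
    cases d'
    exact ⟨rfl, .rfl⟩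
  | unitI =>
    intro A' d'
    cases d'
    exact ⟨rfl, .rfl⟩
  | unitE d₁ d₂ s ih₁ ih₂ =>
    intro A' d'
    cases d' with
    | unitE d₁' d₂' s' =>
      obtain rfl := d₁.ctx_unique d₁' s.valid s.left s'.left
      obtain rfl := d₂.ctx_unique d₂' s.valid s.right s'.right
      obtain rfl := eq_of_heq (ih₁ d₁').2
      obtain ⟨rfl, h⟩ := ih₂ d₂'
      obtain rfl := eq_of_heq h
      obtain rfl := Subsingleton.elim s s'
      exact ⟨rfl, .rfl⟩
  | tensorI d₁ d₂ s ih₁ ih₂ =>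
    intro A' d'
    cases d' with
    | tensorI d₁' d₂' s' =>
      obtain rfl := d₁.ctx_unique d₁' s.valid s.left s'.left
      obtain rfl := d₂.ctx_unique d₂' s.valid s.right s'.right
      obtain ⟨rfl, h⟩ := ih₁ d₁'
      obtain rfl := eq_of_heq h
      obtain ⟨rfl, h⟩ := ih₂ d₂'
      obtain rfl := eq_of_heq h
      obtain rfl := Subsingleton.elim s s'
      exact ⟨rfl, .rfl⟩
  | tensorE d₁ d₂ s ih₁ ih₂ =>
    intro A' d'
    cases d' with
    | tensorE d₁' d₂' s' =>
      obtain rfl := d₁.ctx_unique d₁' s.valid s.left s'.left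
      -- The bodies are typed in lifted contexts rather than in sublists of `E`, so names are
      -- compared directly, with offset 2 for the binders.
      obtain rfl := Ctx.eq_of_sublist s.valid s.right s'.right fun x => by
        have := (d₂.mem_iff (x + 2)).trans (d₂'.mem_iff (x + 2)).symm
        rw [← Ctx.mem_lift 2, ← Ctx.mem_lift 2 _ x]
        simpa using this
      obtain ⟨h, h'⟩ := ih₁ d₁'
      cases h
      obtain rfl := eq_of_heq h'
      obtain ⟨rfl, h⟩ := ih₂ d₂'
      obtain rfl := eq_of_heq h
      obtain rfl := Subsingleton.elim s s'
      exact ⟨rfl, .rfl⟩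
  | lolliI d ih =>
    intro A' d'
    cases d' with
    | lolliI d' =>
      obtain ⟨rfl, h⟩ := ih d'
      obtain rfl := eq_of_heq h
      exact ⟨rfl, .rfl⟩
  | lolliE d₁ d₂ s ih₁ ih₂ =>
    intro A' d'
    cases d' with
    | lolliE d₁' d₂' s' =>
      obtain rfl := d₁.ctx_unique d₁' s.valid s.left s'.left
      obtain rfl := d₂.ctx_unique d₂' s.valid s.right s'.right
      obtain ⟨h, h'⟩ := ih₁ d₁'
      cases h
      obtain rfl := eq_of_heq h'
      obtain rfl := eq_of_heq (ih₂ d₂').2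
      obtain rfl := Subsingleton.elim s s'
      exact ⟨rfl, .rfl⟩

instance {Γ : Ctx G} {v : Tm S} {A : Ty G} : Subsingleton (Typed Γ v A) :=
  ⟨fun d d' => eq_of_heq (d.unique d').2⟩

end LinLam

/-! ### The substitutions that occur in the equations -/

namespace LinLam

variable {G : Type u} {S : Signature.{u, v} G}

theorem Ctx.lift_ren_sub (k : ℕ) (Γ : Ctx G) : Γ = (Γ.lift k).ren (· - k) := by
  simp [lift, ren, Function.comp_def]

theorem Ctx.ren_id (Γ : Ctx G) : Γ = Γ.ren id := by
  simp [ren]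

theorem Ctx.lift_cat (k : ℕ) (Γ Δ : Ctx G) : (Γ.cat Δ).lift k = (Γ.lift k).cat (Δ.lift k) :=
  List.map_append

theorem Ctx.Valid.fst_ne {Γ : Ctx G} {x : ℕ} {A : Ty G} (h : Ctx.Valid ((x, A) :: Γ)) :
    ∀ p ∈ Γ, p.1 ≠ x := by
  rintro p hp rfl
  exact (List.nodup_cons.1 h).1 (List.mem_map.2 ⟨p, hp, rfl⟩)

variable {C : Type u₁} [Category.{v₁} C] [MonoidalCategory C] [MonoidalClosed C]
  [SymmetricCategory C]

namespace Interpretation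

variable (I : Interpretation C S)

theorem exists_den_cast {Γ Γ' : Ctx G} {v : Tm S} {A : Ty G} (h : Γ' = Γ) (d : Typed Γ v A) :
    ∃ d' : Typed Γ' v A, I.den d' = I.retype (congrArg _ h) ≫ I.den d := by
  subst h
  exact ⟨d, by simp⟩

theorem exists_den_subst1 {Γ Δ : Ctx G} {v w : Tm S} {x : ℕ} {A D : Ty G}
    (d : Typed ((x, A) :: Γ) v D) (d₂ : Typed Δ w A) (h : (Γ.cat Δ).Valid) :
    ∃ d' : Typed (Γ.cat Δ) (v.subst1 w x) D, I.den d' = (I.splitIso Γ Δ).hom ≫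
      I.ctx Γ ◁ I.den d₂ ≫ (I.snocIso Γ (x, A)).inv ≫ I.den d := by
  -- The updated substitution has value `w` at `x` only up to a proved equality; `hx` moves the
  -- derivation across it without changing the interpretation.
  have hx : ∀ {t : Tm S}, Typed Δ t A → t = w → ∃ d' : Typed Δ t A, I.den d' = I.den d₂ := by
    rintro t d' rfl
    exact ⟨d₂, rfl⟩
  have hw : Function.update Tm.var x w x = w := Function.update_self ..
  obtain ⟨d₃, h₃⟩ := hx (hw.symm ▸ d₂) hw
  obtain ⟨d', h'⟩ := I.exists_den_subst d h (IsSubst.cons_of_ren id (Ctx.ren_id Γ)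
    (σ := Function.update Tm.var x w) (fun p hp => Function.update_of_ne (d.valid.fst_ne p hp) ..) d₃)
  refine ⟨d', h'.trans ?_⟩
  rw [h₃, retype_self, id_tensorHom, Category.assoc, Category.assoc]

theorem exists_den_subst1Under2 {Γ Δ : Ctx G} {v w : Tm S} {x : ℕ} {A D : Ty G}
    (d : Typed ((x, A) :: Γ) v D) (d₂ : Typed Δ w A) (h : ((Γ.lift 2).cat Δ).Valid) :
    ∃ d' : Typed ((Γ.lift 2).cat Δ) (v.subst1Under2 w x) D, I.den d' =
      (I.splitIso (Γ.lift 2) Δ).hom ≫ (I.retype (Γ.map_snd_lift 2) ⊗ₘ I.den d₂) ≫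
        (I.snocIso Γ (x, A)).inv ≫ I.den d := by
  have hx : ∀ {t : Tm S}, Typed Δ t A → t = w → ∃ d' : Typed Δ t A, I.den d' = I.den d₂ := by
    rintro t d' rfl
    exact ⟨d₂, rfl⟩
  have hw : Function.update (fun n => Tm.var (n + 2)) x w x = w := Function.update_self ..
  obtain ⟨d₃, h₃⟩ := hx (hw.symm ▸ d₂) hw
  obtain ⟨d', h'⟩ := I.exists_den_subst d h (IsSubst.cons_of_ren (· + 2) (E := Γ.lift 2) rfl
    (σ := Function.update (fun n => Tm.var (n + 2)) x w)
    (fun p hp => Function.update_of_ne (d.valid.fst_ne p hp) ..) d₃)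
  refine ⟨d', h'.trans ?_⟩
  rw [h₃, Category.assoc, Category.assoc]

theorem exists_den_inst {Γ Δ : Ctx G} {v w : Tm S} {A D : Ty G}
    (d : Typed ((0, A) :: Γ.lift 1) v D) (d₂ : Typed Δ w A) (h : (Γ.cat Δ).Valid) :
    ∃ d' : Typed (Γ.cat Δ) (v.inst w) D, I.den d' =
      (I.splitIso Γ Δ).hom ≫ I.ctx Γ ◁ I.den d₂ ≫ I.joinBound Γ A ≫ I.den d := by
  -- Subtracting `1` undoes the lift. Truncation is harmless, since no variable of `Γ.lift 1` is
  -- named `0`.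
  obtain ⟨d', h'⟩ := I.exists_den_subst d h (IsSubst.cons_of_ren (· - 1) (Ctx.lift_ren_sub 1 Γ)
    (σ := fun n => match n with
      | 0 => w
      | n + 1 => Tm.var n)
    (by
      intro p hp
      obtain ⟨q, hq, rfl⟩ := List.mem_map.1 hp
      rfl) d₂)
  refine ⟨d', h'.trans ?_⟩
  rw [joinBound_eq, MonoidalCategory.tensorHom_def']
  simp only [Category.assoc]

theorem exists_den_inst2 {Γ Δ E : Ctx G} {u v w : Tm S} {A B D : Ty G}
    (d : Typed ((0, B) :: (1, A) :: E.lift 2) u D) (d₁ : Typed Γ v A) (d₂ : Typed Δ w B)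
    (h : ((E.cat Γ).cat Δ).Valid) :
    ∃ d' : Typed ((E.cat Γ).cat Δ) (u.inst2 v w) D, I.den d' =
      (I.splitIso (E.cat Γ) Δ).hom ≫ ((I.splitIso E Γ).hom ≫ I.ctx E ◁ I.den d₁ ⊗ₘ I.den d₂) ≫
        I.joinBound2 E A B ≫ I.den d := by
  obtain ⟨d', h'⟩ := I.exists_den_subst d h
    ((IsSubst.cons_of_ren (· - 2) (Ctx.lift_ren_sub 2 E)
    (σ := fun n => match n with
      | 0 => w
      | 1 => v
      | n + 2 => Tm.var n)
    (by
      intro p hp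
      obtain ⟨q, hq, rfl⟩ := List.mem_map.1 hp
      rfl) (x := 1) d₁).cons (p := (0, B)) d₂)
  refine ⟨d', h'.trans ?_⟩
  rw [joinBound2_eq]
  have key : ∀ {X Y Z W A B K L M N : C} {s : X ⟶ Y ⊗ Z} {t : Y ⟶ W ⊗ K} {m : K ⟶ A} {r : W ⟶ L}
      {i : L ⊗ A ⟶ M} {n : Z ⟶ B} {j : M ⊗ B ⟶ N} {D : C} {g : N ⟶ D},
      (s ≫ (t ≫ (r ⊗ₘ m) ≫ i ⊗ₘ n) ≫ j) ≫ g =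
        s ≫ (t ≫ W ◁ m ⊗ₘ n) ≫ (r ▷ A ▷ B ≫ i ▷ B ≫ j) ≫ g := by
    intro _ _ _ _ _ B _ _ _ _ s t m r i n j _ g
    have h : (r ▷ _ ▷ B ≫ i ▷ B ≫ j) ≫ g = ((r ▷ _ ≫ i) ⊗ₘ 𝟙 B) ≫ j ≫ g := by simp
    rw [h, tensorHom_comp_tensorHom_assoc, MonoidalCategory.tensorHom_def' r m]
    simp only [Category.assoc, Category.comp_id]
  exact key

end Interpretation

end LinLam

/-! ### The equations of autonomous categories hold in the model -/

namespace LinLam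

variable {G : Type u} {S : Signature.{u, v} G}

/-- `appHom` is the counit, so whiskering and then applying inverts `transpose`. This is the β-law
for functions, and `transpose_appHom` is the η-law. -/
theorem transpose_whiskerRight_appHom {C : Type u₁} [Category.{v₁} C] [MonoidalCategory C]
    [MonoidalClosed C] [SymmetricCategory C] {X Y Z : C} (f : X ⊗ Y ⟶ Z) :
    transpose f ▷ Y ≫ appHom Y Z = f :=
  ((tensorHomAdj Y).homEquiv_counit X Z (transpose f)).symm.trans
    (((tensorHomAdj Y).homEquiv X Z).symm_apply_apply f)

theorem transpose_appHom {C : Type u₁} [Category.{v₁} C] [MonoidalCategory C]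
    [MonoidalClosed C] [SymmetricCategory C] {X Y Z : C} (f : X ⟶ (ihom Y).obj Z) :
    transpose (f ▷ Y ≫ appHom Y Z) = f :=
  (congrArg _ ((tensorHomAdj Y).homEquiv_counit X Z f).symm).trans
    (((tensorHomAdj Y).homEquiv X Z).apply_symm_apply f)

variable {C : Type u₁} [Category.{v₁} C] [MonoidalCategory C] [MonoidalClosed C]
  [SymmetricCategory C]

namespace Interpretation

variable (I : Interpretation C S)

/-- Both terms are typed and have the same interpretation. -/
def EqDen (Γ : Ctx G) (v w : Tm S) (A : Ty G) : Prop :=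
  ∃ (d : Typed Γ v A) (d' : Typed Γ w A), I.den d = I.den d'

variable {I}

theorem EqDen.perm {Γ F : Ctx G} {v w : Tm S} {A : Ty G} (h : I.EqDen Γ v w A) (hF : F.Valid)
    (p : F.Perm Γ) : I.EqDen F v w A := by
  obtain ⟨d, d', h⟩ := h
  obtain ⟨π⟩ := Permutation.exists_of_perm p
  obtain ⟨d₁, h₁⟩ := I.exchange d hF π
  obtain ⟨d₂, h₂⟩ := I.exchange d' hF π
  exact ⟨d₁, d₂, by rw [h₁, h₂, h]⟩

variable (I)

theorem eqDen_unit_beta {Γ : Ctx G} {v : Tm S} {A : Ty G} (d : Typed Γ v A) :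
    I.EqDen Γ (.letUnit .star v) v A := by
  have p : Γ.Perm (Ctx.cat [] Γ) := by simp
  have hX := d.valid.of_perm p
  obtain ⟨π, h⟩ := I.permHom_nil_cat Γ
  obtain ⟨d₁, h₁⟩ := (I.exchange (Typed.unitI (S := S))).unitE (I.exchange d) hX (.refl _)
  obtain ⟨d₂, h₂⟩ := I.exchange d hX π
  refine EqDen.perm ⟨d₁, d₂, ?_⟩ d.valid p
  rw [h₁, h₂, h, permHom_refl]
  have key : ∀ {X Y Z : C} {s : X ⟶ 𝟙_ C ⊗ Y} {g : Y ⟶ Z},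
      𝟙 X ≫ s ≫ 𝟙 (𝟙_ C) ▷ Y ≫ (λ_ Y).hom ≫ g = (s ≫ (λ_ Y).hom) ≫ g := by
    intros
    simp
  exact key

theorem eqDen_lolli_beta {Γ Δ : Ctx G} {v w : Tm S} {A B : Ty G}
    (d₁ : Typed ((0, A) :: Γ.lift 1) v B) (d₂ : Typed Δ w A) (h : (Γ.cat Δ).Valid) :
    I.EqDen (Γ.cat Δ) (.app (.lam A v) w) (v.inst w) B := by
  obtain ⟨d₃, h₃⟩ := (I.exchange d₁).lolliI (h.of_sublist (List.sublist_append_right _ _)) (.refl _)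
  obtain ⟨d, hd⟩ := (I.exchange d₃).lolliE (I.exchange d₂) h (.refl _)
  obtain ⟨d', hd'⟩ := I.exists_den_inst d₁ d₂ h
  refine ⟨d, d', ?_⟩
  rw [hd, hd', h₃, permHom_refl, permHom_refl]
  have key : ∀ {X Y Z A B : C} {s : X ⟶ Y ⊗ Z} {f : Y ⊗ A ⟶ B} {g : Z ⟶ A},
      𝟙 X ≫ s ≫ (𝟙 Y ≫ transpose f ⊗ₘ g) ≫ appHom A B = s ≫ Y ◁ g ≫ f := by
    intros
    simp [MonoidalCategory.tensorHom_def', transpose_whiskerRight_appHom]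
  exact key

theorem eqDen_lolli_eta {Γ : Ctx G} {v : Tm S} {A B : Ty G} (d : Typed Γ v (.lolli A B)) :
    I.EqDen Γ (.lam A (.app (v.rename Nat.succ) (.var 0))) v (.lolli A B) := by
  have hX := Ctx.valid_cons_lift A d.valid
  obtain ⟨d₁, h₁⟩ := I.exists_den_rename d Nat.succ (E := Γ.lift 1) rfl
    ((Ctx.valid_lift_iff 1 Γ).2 d.valid)
  obtain ⟨d₂, h₂⟩ := (I.exchange d₁).lolliE (I.exchange (.hyp 0 A)) (E := (0, A) :: Γ.lift 1) hX
    (.refl _)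
  obtain ⟨d₃, h₃⟩ := (I.exchange d₂).lolliI d.valid (.refl _)
  refine ⟨d₃, d, ?_⟩
  rw [h₃, h₂, permHom_refl, permHom_refl, h₁, splitIso_singleton, joinBound_eq]
  have key : ∀ {X Y A B W : C} {i : W ≅ Y ⊗ A} {r : X ⟶ Y} {r' : Y ⟶ X} (_ : r ≫ r' = 𝟙 X)
      {f : X ⟶ (ihom A).obj B},
      𝟙 X ≫ transpose ((r ▷ A ≫ i.inv) ≫ 𝟙 W ≫ i.hom ≫ (r' ≫ f ⊗ₘ 𝟙 A) ≫ appHom A B) = f := by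
    intro _ _ A _ _ _ _ _ h _
    simp only [Category.assoc, Category.id_comp, Iso.inv_hom_id_assoc, tensorHom_id]
    rw [← comp_whiskerRight_assoc, reassoc_of% h, transpose_appHom]
  exact key (by simp)

/-- Substitution puts the variables of the substituted term last, whereas the elimination rules put
them first; the braiding mediates. -/
theorem exists_den_swap {Γ Δ : Ctx G} {v : Tm S} {A : Ty G} (d : Typed (Δ.cat Γ) v A)
    {Y : C} {g : I.ctx Δ ⊗ I.ctx Γ ⟶ Y} {k : Y ⟶ I.ty A}
    (hd : I.den d = (I.splitIso Δ Γ).hom ≫ g ≫ k) (h : (Γ.cat Δ).Valid) :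
    ∃ d' : Typed (Γ.cat Δ) v A,
      I.den d' = (I.splitIso Γ Δ).hom ≫ (β_ _ _).hom ≫ g ≫ k := by
  obtain ⟨π, hπ⟩ := IsWire.exists_permHom (I := I) (E := Γ.cat Δ) (Γ := Δ.cat Γ)
    (.comp (.split Γ Δ) <| .comp (.braiding (.ctx Γ) (.ctx Δ)) (.split_inv Δ Γ))
  obtain ⟨d', h'⟩ := I.exchange d h π
  refine ⟨d', ?_⟩
  rw [h', hπ, hd]
  simp [shapeObj]

/-- By naturality the two sides differ by the braiding of the unit object with `I.ctx Δ`, which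
consists of unitors. -/
theorem eqDen_unit_eta {Γ Δ : Ctx G} {v w : Tm S} {z : ℕ} {A : Ty G}
    (d₁ : Typed Γ v .unit) (d₂ : Typed ((z, .unit) :: Δ) w A) (h : (Γ.cat Δ).Valid) :
    I.EqDen (Γ.cat Δ) (.letUnit v (w.subst1 .star z)) (w.subst1 v z) A := by
  have hΔ := h.of_sublist (List.sublist_append_left Δ Γ)
  obtain ⟨(d₃ : Typed Δ (w.subst1 .star z) A), h₃⟩ := I.exists_den_subst1 d₂ .unitI hΔ
  obtain ⟨d, hd⟩ := (I.exchange d₁).unitE (I.exchange d₃) h (.refl _)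
  obtain ⟨d₄, h₄⟩ := I.exists_den_subst1 d₂ d₁ (h.of_perm List.perm_append_comm)
  obtain ⟨d', hd'⟩ := I.exists_den_swap d₄ h₄ h
  refine ⟨d, d', ?_⟩
  have h₃ : I.den d₃ = (ρ_ (I.ctx Δ)).inv ≫ I.ctx Δ ◁ 𝟙 _ ≫ (I.snocIso Δ (z, .unit)).inv ≫ I.den d₂ :=
    h₃
  rw [hd, hd', permHom_refl, h₃]
  have key : ∀ {X Y Z A D : C} {s : X ⟶ Y ⊗ Z} {m : Y ⟶ 𝟙_ C} {i : Z ⊗ 𝟙_ C ⟶ A} {g : A ⟶ D},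
      𝟙 X ≫ s ≫ m ▷ Z ≫ (λ_ Z).hom ≫ (ρ_ Z).inv ≫ Z ◁ 𝟙 (𝟙_ C) ≫ i ≫ g =
        s ≫ (β_ Y Z).hom ≫ Z ◁ m ≫ i ≫ g := by
    intros
    rw [← BraidedCategory.braiding_naturality_left_assoc, braiding_tensorUnit_left]
    simp
  exact key

omit [SymmetricCategory C] in
theorem joinBound2_splitIso (Δ : Ctx G) (A B : Ty G) :
    I.joinBound2 Δ A B ≫ (I.splitIso (Δ.lift 2) [(0, B), (1, A)]).hom =
      I.retype (Δ.map_snd_lift 2).symm ▷ I.ty A ▷ I.ty B ≫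
        (α_ (I.ctx (Δ.lift 2)) (I.ty A) (I.ty B)).hom := by
  rw [joinBound2_eq, splitIso_cons_hom, splitIso_singleton]
  have key : ∀ {X Y A B W W' : C} {r : X ⟶ Y} {i : W ≅ Y ⊗ A} {j : W' ≅ W ⊗ B},
      (r ▷ A ▷ B ≫ i.inv ▷ B ≫ j.inv) ≫ j.hom ≫ i.hom ▷ B ≫ (α_ Y A B).hom ≫ Y ◁ 𝟙 (A ⊗ B) =
        r ▷ A ▷ B ≫ (α_ Y A B).hom := by
    intros
    simp
  exact key

/-- The term `x ⊗ y` is interpreted by an identity, so the bound variables are merely rebracketed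
into one; the braiding of the elimination is the one that `exists_den_swap` produces. -/
theorem eqDen_tensor_eta {Γ Δ : Ctx G} {u v : Tm S} {z : ℕ} {A B D : Ty G}
    (d₁ : Typed Γ v (.tensor A B)) (d₂ : Typed ((z, .tensor A B) :: Δ) u D) (h : (Γ.cat Δ).Valid) :
    I.EqDen (Γ.cat Δ) (.letPair v (u.subst1Under2 (.tensor (.var 1) (.var 0)) z))
      (u.subst1 v z) D := by
  have hΔ := Ctx.valid_cons_cons_lift A B (h.of_sublist (List.sublist_append_left Δ Γ))
  obtain ⟨d₀, h₀⟩ := (I.exchange (.hyp (S := S) 1 A)).tensorI (I.exchange (.hyp 0 B))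
    (E := [(0, B), (1, A)]) (by simp [Ctx.Valid]) (.refl _)
  have h₀ : I.den d₀ = 𝟙 (I.ty A ⊗ I.ty B) := by
    rw [h₀, permHom_refl, splitIso_singleton]
    have key : ∀ X Y : C, 𝟙 (X ⊗ Y) ≫ 𝟙 (X ⊗ Y) ≫ (𝟙 X ⊗ₘ 𝟙 Y) = 𝟙 (X ⊗ Y) := by simp
    exact key _ _
  obtain ⟨d₃, h₃⟩ := I.exists_den_subst1Under2 d₂ d₀ hΔ
  obtain ⟨d, hd⟩ := (I.exchange d₁).tensorE (I.exchange d₃) h (.refl _)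
  obtain ⟨d₄, h₄⟩ := I.exists_den_subst1 d₂ d₁ (h.of_perm List.perm_append_comm)
  obtain ⟨d', hd'⟩ := I.exists_den_swap d₄ h₄ h
  refine ⟨d, d', ?_⟩
  rw [hd, hd', permHom_refl, h₃, h₀]
  have key : ∀ {X Y Z A B Z' W M D : C} {s : X ⟶ Y ⊗ Z} {m : Y ⟶ A ⊗ B} {j : (Z ⊗ A) ⊗ B ⟶ W}
      {t : W ⟶ Z' ⊗ (A ⊗ B)} {r : Z ⟶ Z'} {r' : Z' ⟶ Z} (_ : r ≫ r' = 𝟙 Z)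
      (_ : j ≫ t = r ▷ A ▷ B ≫ (α_ Z' A B).hom) {i : Z ⊗ (A ⊗ B) ⟶ M} {g : M ⟶ D},
      𝟙 X ≫ s ≫ m ▷ Z ≫ (β_ (A ⊗ B) Z).hom ≫ (α_ Z A B).inv ≫ j ≫ t ≫
        (r' ⊗ₘ 𝟙 (A ⊗ B)) ≫ i ≫ g = s ≫ (β_ Y Z).hom ≫ Z ◁ m ≫ i ≫ g := by
    intro _ _ _ _ _ _ _ _ _ s m j t r r' h₁ h₂ i g
    rw [reassoc_of% h₂, tensorHom_id, ← BraidedCategory.braiding_naturality_left_assoc,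
      ← associator_inv_naturality_left_assoc, Iso.inv_hom_id_assoc, ← comp_whiskerRight_assoc, h₁,
      id_whiskerRight, Category.id_comp, Category.id_comp]
  exact key (by simp) (I.joinBound2_splitIso Δ A B)

theorem eqDen_tensor_beta {Γ Δ E : Ctx G} {u v w : Tm S} {A B D : Ty G} (d₁ : Typed Γ v A)
    (d₂ : Typed Δ w B) (d₃ : Typed ((0, B) :: (1, A) :: E.lift 2) u D)
    (h : ((E.cat Γ).cat Δ).Valid) :
    I.EqDen ((E.cat Γ).cat Δ) (.letPair (.tensor v w) u) (u.inst2 v w) D := by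
  obtain ⟨d', hd'⟩ := I.exists_den_inst2 d₃ d₁ d₂ h
  -- The elimination needs the order `Γ, Δ, E`. The braiding introduced here cancels that of
  -- `letPair` by symmetry.
  obtain ⟨π, hπ⟩ := IsWire.exists_permHom_split (I := I) (E := (E.cat Γ).cat Δ) (Γ := Γ.cat Δ)
    (Δ := E) <| .comp (.split (E.cat Γ) Δ) <| .comp (.whiskerRight (.split E Γ) (.ctx Δ)) <|
      .comp (.associator (.ctx E) (.ctx Γ) (.ctx Δ)) <|
      .comp (.braiding (.ctx E) (.node (.ctx Γ) (.ctx Δ))) <|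
      .whiskerRight (.split_inv Γ Δ) (.ctx E)
  have hE := h.of_perm π.toPerm
  obtain ⟨d₄, h₄⟩ := (I.exchange d₁).tensorI (I.exchange d₂)
    (hE.of_sublist (List.sublist_append_right _ _)) (.refl _)
  obtain ⟨d, hd⟩ := (I.exchange d₄).tensorE (I.exchange d₃) h π
  refine ⟨d, d', ?_⟩
  rw [hd, hd', h₄, permHom_refl]
  have key : ∀ {P X X' Y Z W L A B J D : C} {p : P ⟶ L} {s : P ⟶ X ⊗ W} {l : L ⟶ X' ⊗ Z}
      {t : X ⟶ Z ⊗ Y} {m : Y ⟶ A} {n : W ⟶ B} {i : X' ≅ Y ⊗ W}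
      (_ : p ≫ l = s ≫ t ▷ W ≫ (α_ Z Y W).hom ≫ (β_ Z (Y ⊗ W)).hom ≫ i.inv ▷ Z)
      {j : (Z ⊗ A) ⊗ B ⟶ J} {g : J ⟶ D},
      p ≫ l ≫ (𝟙 X' ≫ i.hom ≫ (m ⊗ₘ n)) ▷ Z ≫ (β_ (A ⊗ B) Z).hom ≫ (α_ Z A B).inv ≫ j ≫ g =
        s ≫ (t ≫ Z ◁ m ⊗ₘ n) ≫ j ≫ g := by
    intro _ _ _ _ Z _ _ _ _ _ _ p s l t m n i h j g
    rw [reassoc_of% h]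
    have e : (t ≫ Z ◁ m ⊗ₘ n) = t ▷ _ ≫ ((𝟙 Z ⊗ₘ m) ⊗ₘ n) := by
      rw [← tensorHom_id, tensorHom_comp_tensorHom, Category.id_comp, id_tensorHom]
    rw [e, comp_whiskerRight_assoc, id_whiskerRight, Category.id_comp, comp_whiskerRight_assoc,
      inv_hom_whiskerRight_assoc,
      ← BraidedCategory.braiding_naturality_right_assoc, SymmetricCategory.symmetry_assoc,
      ← id_tensorHom, ← associator_naturality_assoc, Iso.hom_inv_id_assoc, Category.assoc]
  exact key hπ

/-- Pulling `v` out moves its variables past `Γ`. By naturality the braiding then meets only the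
unit object, where it reduces to unitors. -/
theorem eqDen_unit_comm {Γ Δ E : Ctx G} {u v w : Tm S} {z : ℕ} {A B : Ty G}
    (d₁ : Typed ((z, A) :: Γ) u B) (d₂ : Typed Δ v .unit) (d₃ : Typed E w A)
    (h : (Γ.cat (Δ.cat E)).Valid) :
    I.EqDen (Γ.cat (Δ.cat E)) (u.subst1 (.letUnit v w) z) (.letUnit v (u.subst1 w z)) B := by
  obtain ⟨π, hπ⟩ := IsWire.exists_permHom_split (I := I) (E := Γ.cat (Δ.cat E)) (Γ := Δ)
    (Δ := Γ.cat E) <| .comp (.split Γ (Δ.cat E)) <| .comp (.whiskerLeft (.ctx Γ) (.split Δ E)) <|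
      .comp (.associator_inv (.ctx Γ) (.ctx Δ) (.ctx E)) <|
      .comp (.whiskerRight (.braiding (.ctx Γ) (.ctx Δ)) (.ctx E)) <|
      .comp (.associator (.ctx Δ) (.ctx Γ) (.ctx E)) <|
      .whiskerLeft (.ctx Δ) (.split_inv Γ E)
  have hE := h.of_perm π.toPerm
  obtain ⟨d₄, h₄⟩ := (I.exchange d₂).unitE (I.exchange d₃)
    (h.of_sublist (List.sublist_append_left _ _)) (.refl _)
  obtain ⟨d, hd⟩ := I.exists_den_subst1 d₁ d₄ h
  obtain ⟨d₅, h₅⟩ := I.exists_den_subst1 d₁ d₃ (hE.of_sublist (List.sublist_append_left _ _))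
  obtain ⟨d', hd'⟩ := (I.exchange d₂).unitE (I.exchange d₅) h π
  refine ⟨d, d', ?_⟩
  rw [hd, hd', h₄, h₅, permHom_refl]
  have key : ∀ {P L X X' Y Z W A M D : C} {p : P ⟶ L} {s : P ⟶ X ⊗ X'} {l : L ⟶ Y ⊗ W}
      {t : X' ⟶ Y ⊗ Z} {m : Y ⟶ 𝟙_ C} {n : Z ⟶ A} {i : W ≅ X ⊗ Z}
      (_ : p ≫ l = s ≫ X ◁ t ≫ (α_ X Y Z).inv ≫ (β_ X Y).hom ▷ Z ≫ (α_ Y X Z).hom ≫ Y ◁ i.inv)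
      {j : X ⊗ A ⟶ M} {g : M ⟶ D},
      s ≫ X ◁ (𝟙 X' ≫ t ≫ m ▷ Z ≫ (λ_ Z).hom ≫ n) ≫ j ≫ g =
        p ≫ l ≫ m ▷ W ≫ (λ_ W).hom ≫ i.hom ≫ X ◁ n ≫ j ≫ g := by
    intro _ _ X _ Y Z _ _ _ _ p s l t m n i h j g
    rw [reassoc_of% h]
    have e : (α_ X Y Z).inv ≫ (β_ X Y).hom ▷ Z ≫ (α_ Y X Z).hom ≫ m ▷ (X ⊗ Z) ≫ (λ_ _).hom =
        X ◁ m ▷ Z ≫ X ◁ (λ_ Z).hom := by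
      rw [← associator_naturality_left_assoc, ← comp_whiskerRight_assoc,
        ← BraidedCategory.braiding_naturality_right, braiding_tensorUnit_right]
      simp
    rw [whisker_exchange_assoc, leftUnitor_naturality_assoc, Iso.inv_hom_id_assoc, reassoc_of% e]
    simp
  exact key hπ

omit [SymmetricCategory C] in
-- The bound variables attach to the end of `E`, so splitting off `Γ` does not see them; only
-- reassociation and retyping have to be matched.
theorem joinBound2_splitIso_cat (Γ E : Ctx G) (A B : Ty G)
    (h : List.map Prod.snd ((0, B) :: (1, A) :: (Γ.cat E).lift 2) =
      List.map Prod.snd ((Γ.lift 2).cat ((0, B) :: (1, A) :: E.lift 2))) :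
    I.joinBound2 (Γ.cat E) A B ≫ I.retype h ≫
        (I.splitIso (Γ.lift 2) ((0, B) :: (1, A) :: E.lift 2)).hom ≫
          I.retype (Γ.map_snd_lift 2) ▷ _ =
      (I.splitIso Γ E).hom ▷ I.ty A ▷ I.ty B ≫ (α_ _ _ _).hom ▷ I.ty B ≫ (α_ _ _ _).hom ≫
        I.ctx Γ ◁ I.joinBound2 E A B := by
  have h₁ : List.map Prod.snd ((Γ.cat E).lift 2) =
      List.map Prod.snd ((Γ.lift 2).cat (E.lift 2)) := by
    rw [Ctx.lift_cat]
  have h₂ : List.map Prod.snd ((1, A) :: (Γ.cat E).lift 2) =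
      List.map Prod.snd ((1, A) :: (Γ.lift 2).cat (E.lift 2)) :=
    congrArg (A :: ·) h₁
  have e₁ : I.retype h = (I.snocIso _ (0, B)).hom ≫ ((I.snocIso _ (1, A)).hom ≫
      I.retype h₁ ▷ I.ty A ≫ (I.snocIso _ (1, A)).inv) ▷ I.ty B ≫ (I.snocIso _ (0, B)).inv := by
    rw [← I.retype_cons 1 1 A h₁ h₂]
    exact I.retype_cons 0 0 B h₂ h
  have e₂ : I.retype (Ctx.map_snd_lift 2 (Γ.cat E)).symm ≫ I.retype h₁ ≫
      (I.splitIso (Γ.lift 2) (E.lift 2)).hom ≫ I.retype (Γ.map_snd_lift 2) ▷ _ =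
        (I.splitIso Γ E).hom ≫ I.ctx Γ ◁ I.retype (E.map_snd_lift 2).symm := by
    rw [retype_retype_assoc, reassoc_of% I.retype_split (Γ.map_snd_lift 2).symm
      (E.map_snd_lift 2).symm, MonoidalCategory.tensorHom_def', Category.assoc,
      ← comp_whiskerRight, retype_retype, retype_self, id_whiskerRight, Category.comp_id]
  rw [e₁, splitIso_cons_hom, splitIso_cons_hom, joinBound2_eq, joinBound2_eq]
  have key : ∀ {X X₁ X₂ Y Y' Z Z' A B W₁ W₂ M₁ M₂ N₁ N₂ : C} {r : X ⟶ X₁} {r' : X₁ ⟶ X₂}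
      {t : X₂ ⟶ Y' ⊗ Z'} {q : Y' ⟶ Y} {s : X ⟶ Y ⊗ Z} {p : Z ⟶ Z'}
      (_ : r ≫ r' ≫ t ≫ q ▷ Z' = s ≫ Y ◁ p) {i₁ : W₁ ≅ X₁ ⊗ A} {j₁ : M₁ ≅ W₁ ⊗ B}
      {i₂ : W₂ ≅ X₂ ⊗ A} {j₂ : M₂ ≅ W₂ ⊗ B} {i : N₁ ≅ Z' ⊗ A} {j : N₂ ≅ N₁ ⊗ B},
      (r ▷ A ▷ B ≫ i₁.inv ▷ B ≫ j₁.inv) ≫ (j₁.hom ≫ (i₁.hom ≫ r' ▷ A ≫ i₂.inv) ▷ B ≫ j₂.inv) ≫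
        (j₂.hom ≫ (i₂.hom ≫ t ▷ A ≫ (α_ Y' Z' A).hom ≫ Y' ◁ i.inv) ▷ B ≫ (α_ Y' N₁ B).hom ≫
          Y' ◁ j.inv) ≫ q ▷ N₂ = s ▷ A ▷ B ≫ (α_ Y Z A).hom ▷ B ≫ (α_ Y (Z ⊗ A) B).hom ≫
            Y ◁ (p ▷ A ▷ B ≫ i.inv ▷ B ≫ j.inv) := by
    intro X X₁ X₂ Y Y' Z Z' A B _ _ _ _ _ _ r r' t q s p h i₁ j₁ i₂ j₂ i j
    have h' := congrArg (fun f => f ▷ A ▷ B) h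
    simp only [comp_whiskerRight] at h'
    have e₃ : (Y' ◁ i.inv) ▷ B ≫ q ▷ _ ▷ B = q ▷ _ ▷ B ≫ (Y ◁ i.inv) ▷ B := by
      rw [← comp_whiskerRight, whisker_exchange, comp_whiskerRight]
    have e₄ : (α_ Y' Z' A).hom ▷ B ≫ q ▷ _ ▷ B = q ▷ Z' ▷ A ▷ B ≫ (α_ Y Z' A).hom ▷ B := by
      rw [← comp_whiskerRight, ← associator_naturality_left, comp_whiskerRight]
    simp only [comp_whiskerRight, Category.assoc, Iso.inv_hom_id_assoc, inv_hom_whiskerRight_assoc,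
      whisker_exchange, ← associator_naturality_left_assoc]
    rw [reassoc_of% e₃, reassoc_of% e₄, reassoc_of% h']
    simp
  exact key e₂

/-- As for the unit, but the braidings survive: moving the pair from behind `Γ` to the front and
then past `Γ, E` amounts, by the hexagon and symmetry, to moving it past `E` alone (`e₂`). -/
theorem eqDen_tensor_comm {Γ Δ E : Ctx G} {u v w : Tm S} {z : ℕ} {A B D D' : Ty G}
    (d₁ : Typed ((z, D) :: Γ) u D') (d₂ : Typed Δ v (.tensor A B))
    (d₃ : Typed ((0, B) :: (1, A) :: E.lift 2) w D) (h : (Γ.cat (Δ.cat E)).Valid) :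
    I.EqDen (Γ.cat (Δ.cat E)) (u.subst1 (.letPair v w) z) (.letPair v (u.subst1Under2 w z)) D' := by
  obtain ⟨π, hπ⟩ := IsWire.exists_permHom_split (I := I) (E := Γ.cat (Δ.cat E)) (Γ := Δ)
    (Δ := Γ.cat E) <| .comp (.split Γ (Δ.cat E)) <| .comp (.whiskerLeft (.ctx Γ) (.split Δ E)) <|
      .comp (.associator_inv (.ctx Γ) (.ctx Δ) (.ctx E)) <|
      .comp (.whiskerRight (.braiding (.ctx Γ) (.ctx Δ)) (.ctx E)) <|
      .comp (.associator (.ctx Δ) (.ctx Γ) (.ctx E)) <|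
      .whiskerLeft (.ctx Δ) (.split_inv Γ E)
  have hE := h.of_perm π.toPerm
  obtain ⟨d₄, h₄⟩ := (I.exchange d₂).tensorE (I.exchange d₃)
    (h.of_sublist (List.sublist_append_left _ _)) (.refl _)
  obtain ⟨d, hd⟩ := I.exists_den_subst1 d₁ d₄ h
  have e : (0, B) :: (1, A) :: (Γ.cat E).lift 2 =
      (Γ.lift 2).cat ((0, B) :: (1, A) :: E.lift 2) := by
    rw [Ctx.lift_cat]
    rfl
  have hΓE := Ctx.valid_cons_cons_lift A B (hE.of_sublist (List.sublist_append_left (Γ.cat E) Δ))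
  rw [e] at hΓE
  obtain ⟨d₅, h₅⟩ := I.exists_den_subst1Under2 d₁ d₃ hΓE
  obtain ⟨d₆, h₆⟩ := I.exists_den_cast e d₅
  obtain ⟨d', hd'⟩ := (I.exchange d₂).tensorE (I.exchange d₆) h π
  refine ⟨d, d', ?_⟩
  rw [hd, hd', h₄, h₆, h₅, permHom_refl]
  have key : ∀ {P L X X' X'' Y Z W A B J J' K M D T : C} {p : P ⟶ L} {s : P ⟶ X ⊗ X'}
      {l : L ⟶ Y ⊗ W} {t : X' ⟶ Y ⊗ Z} {m : Y ⟶ A ⊗ B} {n : K ⟶ D} {i : W ≅ X ⊗ Z}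
      (_ : p ≫ l = s ≫ X ◁ t ≫ (α_ X Y Z).inv ≫ (β_ X Y).hom ▷ Z ≫ (α_ Y X Z).hom ≫ Y ◁ i.inv)
      {j : (Z ⊗ A) ⊗ B ⟶ K} {j' : (W ⊗ A) ⊗ B ⟶ J} {q : J ⟶ J'} {t' : J' ⟶ X'' ⊗ K} {r : X'' ⟶ X}
      (_ : j' ≫ q ≫ t' ≫ r ▷ K =
        i.hom ▷ A ▷ B ≫ (α_ X Z A).hom ▷ B ≫ (α_ X (Z ⊗ A) B).hom ≫ X ◁ j)
      {k : X ⊗ D ⟶ M} {g : M ⟶ T},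
      s ≫ X ◁ (𝟙 X' ≫ t ≫ m ▷ Z ≫ (β_ (A ⊗ B) Z).hom ≫ (α_ Z A B).inv ≫ j ≫ n) ≫ k ≫ g =
        p ≫ l ≫ m ▷ W ≫ (β_ (A ⊗ B) W).hom ≫ (α_ W A B).inv ≫ j' ≫ q ≫ t' ≫ (r ⊗ₘ n) ≫ k ≫ g := by
    intro _ _ X _ _ Y Z W A B _ _ _ _ _ _ p s l t m n i h j j' q t' r h' k g
    have e₁ : (α_ X Y Z).inv ≫ (β_ X Y).hom ▷ Z ≫ (α_ Y X Z).hom ≫ m ▷ (X ⊗ Z) =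
        X ◁ m ▷ Z ≫ (α_ X (A ⊗ B) Z).inv ≫ (β_ X (A ⊗ B)).hom ▷ Z ≫ (α_ (A ⊗ B) X Z).hom := by
      rw [← associator_naturality_left, ← comp_whiskerRight_assoc,
        ← BraidedCategory.braiding_naturality_right]
      simp
    have e₂ : (α_ X (A ⊗ B) Z).inv ≫ (β_ X (A ⊗ B)).hom ▷ Z ≫ (α_ (A ⊗ B) X Z).hom ≫
        (β_ (A ⊗ B) (X ⊗ Z)).hom = X ◁ (β_ (A ⊗ B) Z).hom ≫ (α_ X Z (A ⊗ B)).inv := by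
      rw [BraidedCategory.braiding_tensor_right_hom (A ⊗ B) X Z, Iso.hom_inv_id_assoc,
        ← comp_whiskerRight_assoc, SymmetricCategory.symmetry, id_whiskerRight, Category.id_comp,
        Iso.inv_hom_id_assoc]
    have e₃ : (α_ X Z (A ⊗ B)).inv ≫ (α_ (X ⊗ Z) A B).inv ≫ (α_ X Z A).hom ▷ B ≫
        (α_ X (Z ⊗ A) B).hom = X ◁ (α_ Z A B).inv := by
      simp
    have e₄ : Y ◁ i.inv ≫ m ▷ W ≫ (β_ (A ⊗ B) W).hom ≫ (α_ W A B).inv ≫ i.hom ▷ A ▷ B =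
        m ▷ (X ⊗ Z) ≫ (β_ (A ⊗ B) (X ⊗ Z)).hom ≫ (α_ (X ⊗ Z) A B).inv := by
      rw [whisker_exchange_assoc, BraidedCategory.braiding_naturality_right_assoc,
        associator_inv_naturality_left_assoc, ← comp_whiskerRight, ← comp_whiskerRight,
        Iso.inv_hom_id, id_whiskerRight, id_whiskerRight, Category.comp_id]
    rw [MonoidalCategory.tensorHom_def, Category.assoc, reassoc_of% h', reassoc_of% h,
      reassoc_of% e₄, reassoc_of% e₁, reassoc_of% e₂, reassoc_of% e₃]
    simp
  exact key hπ (I.joinBound2_splitIso_cat Γ E A B _)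

theorem eqDen_of_baseEq {F : Ctx G} {v w : Tm S} {A : Ty G} (h : BaseEq F v w A) :
    I.EqDen F v w A := by
  cases h with
  | tensor_beta d₁ d₂ d₃ hF p => exact (I.eqDen_tensor_beta d₁ d₂ d₃ (hF.of_perm p)).perm hF p
  | tensor_eta d₁ d₂ hF p => exact (I.eqDen_tensor_eta d₁ d₂ (hF.of_perm p)).perm hF p
  | unit_beta d => exact I.eqDen_unit_beta d
  | unit_eta d₁ d₂ hF p => exact (I.eqDen_unit_eta d₁ d₂ (hF.of_perm p)).perm hF p
  | lolli_beta d₁ d₂ hF p => exact (I.eqDen_lolli_beta d₁ d₂ (hF.of_perm p)).perm hF p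
  | lolli_eta d => exact I.eqDen_lolli_eta d
  | unit_comm d₁ d₂ d₃ hF p =>
    rw [Ctx.cat, Ctx.cat, ← List.append_assoc] at p
    exact (I.eqDen_unit_comm d₁ d₂ d₃ (hF.of_perm p)).perm hF p
  | tensor_comm d₁ d₂ d₃ hF p =>
    rw [Ctx.cat, Ctx.cat, ← List.append_assoc] at p
    exact (I.eqDen_tensor_comm d₁ d₂ d₃ (hF.of_perm p)).perm hF p

end Interpretation

end LinLam

/-! ### Enrichment and soundness of the congruence rules -/

namespace LinLam

section Enriched

variable {V : Type w} [CommMonoid V] [CompleteLattice V] [IsQuantale V]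
variable {C : Type u₁} [Category.{v₁} C] [VCatEnriched V C]

theorem VCatEnriched.comp_le {X Y Z : C} (f f' : X ⟶ Y) (g g' : Y ⟶ Z) :
    VCategory.a f f' * VCategory.a g g' ≤ VCategory.a (V := V) (f ≫ g) (f' ≫ g') :=
  VCatEnriched.comp_isVFunctor X Y Z (f, g) (f', g')

/-- Since `1 ≤ a f f`, composing with a fixed morphism loses nothing. -/
theorem VCatEnriched.comp_left_le {X Y Z : C} (f : X ⟶ Y) (g g' : Y ⟶ Z) :
    VCategory.a g g' ≤ VCategory.a (V := V) (f ≫ g) (f ≫ g') :=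
  (le_mul_of_one_le_left' (VCategory.unit_le f)).trans (comp_le f f g g')

theorem VCatEnriched.comp_right_le {X Y Z : C} (f f' : X ⟶ Y) (g : Y ⟶ Z) :
    VCategory.a f f' ≤ VCategory.a (V := V) (f ≫ g) (f' ≫ g) :=
  (le_mul_of_one_le_right' (VCategory.unit_le g)).trans (comp_le f f' g g)

variable [MonoidalCategory C] [SymmetricCategory C] [MonoidalClosed C] [VCatAutonomous C V]

theorem VCatAutonomous.tensorHom_le {X Y X' Y' : C} (f f' : X ⟶ Y) (g g' : X' ⟶ Y') :
    VCategory.a f f' * VCategory.a g g' ≤ VCategory.a (V := V) (f ⊗ₘ g) (f' ⊗ₘ g') :=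
  VCatAutonomous.tensor_isVCatFunctor (C := C) (V := V) (X, X') (Y, Y') (f, g) (f', g')

theorem VCatAutonomous.whiskerRight_le {X Y : C} (f f' : X ⟶ Y) (Z : C) :
    VCategory.a f f' ≤ VCategory.a (V := V) (f ▷ Z) (f' ▷ Z) := by
  rw [← tensorHom_id, ← tensorHom_id]
  exact (le_mul_of_one_le_right' (VCategory.unit_le (𝟙 Z))).trans (tensorHom_le ..)

theorem VCatAutonomous.whiskerLeft_le {X Y : C} (Z : C) (f f' : X ⟶ Y) :
    VCategory.a f f' ≤ VCategory.a (V := V) (Z ◁ f) (Z ◁ f') := by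
  rw [← id_tensorHom, ← id_tensorHom]
  exact (le_mul_of_one_le_left' (VCategory.unit_le (𝟙 Z))).trans (tensorHom_le ..)

/-- The forward half of the `V`-isomorphism on homs is all that is used of the enriched adjunction.
-/
theorem VCatAutonomous.transpose_le {X Y Z : C} (f f' : X ⊗ Y ⟶ Z) :
    VCategory.a f f' ≤ VCategory.a (V := V) (transpose f) (transpose f') :=
  ((VCatAutonomous.adj_isVCatAdjunction (V := V) Y).homEquiv X Z).1 f f'

theorem VCatAutonomous.nTensorHom_le : ∀ (n : ℕ) {X Y : Fin n → C} (f f' : ∀ i, X i ⟶ Y i),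
    ∏ i, VCategory.a (f i) (f' i) ≤ VCategory.a (V := V) (nTensorHom n f) (nTensorHom n f')
  | 0, _, _, _, _ => by
    rw [Fin.prod_univ_zero]
    exact VCategory.unit_le _
  | 1, _, _, _, _ => by
    rw [Fin.prod_univ_one]
    exact le_rfl
  | n + 2, _, _, f, f' => by
    rw [Fin.prod_univ_castSucc]
    exact (mul_le_mul' (nTensorHom_le (n + 1) _ _) le_rfl).trans (tensorHom_le ..)

end Enriched

variable {V : Type w} [CommMonoid V] [CompleteLattice V] [IsQuantale V]
variable {G : Type u} {S : Signature.{u, v} G}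
variable {C : Type u₁} [Category.{v₁} C] [MonoidalCategory C] [SymmetricCategory C]
  [MonoidalClosed C] [VCatEnriched V C]

namespace Interpretation

variable (I : Interpretation C S)

/-- Both terms are typed and the distance of their interpretations is at least `q`. -/
def Bounds (Γ : Ctx G) (v w : Tm S) (A : Ty G) (q : V) : Prop :=
  ∃ (d : Typed Γ v A) (d' : Typed Γ w A), q ≤ VCategory.a (I.den d) (I.den d')

variable {I}

theorem EqDen.bounds {Γ : Ctx G} {v w : Tm S} {A : Ty G} (h : I.EqDen Γ v w A) :
    I.Bounds Γ v w A (1 : V) := by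
  obtain ⟨d, d', h⟩ := h
  exact ⟨d, d', h ▸ VCategory.unit_le _⟩

theorem EqDen.symm {Γ : Ctx G} {v w : Tm S} {A : Ty G} (h : I.EqDen Γ v w A) :
    I.EqDen Γ w v A := by
  obtain ⟨d, d', h⟩ := h
  exact ⟨d', d, h.symm⟩

/-- Derivations are unique, so a bound for one pair of derivations holds for every pair. -/
theorem Bounds.satisfies {Γ : Ctx G} {v w : Tm S} {A : Ty G} {q : V} (h : I.Bounds Γ v w A q) :
    I.Satisfies (⟨Γ, v, w, A, q⟩ : VEquation S V) := by
  obtain ⟨d, d', h⟩ := h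
  intro d₁ d₁'
  rwa [Subsingleton.elim d₁ d, Subsingleton.elim d₁' d']

theorem Bounds.trans {Γ : Ctx G} {v w u : Tm S} {A : Ty G} {q r : V} (h : I.Bounds Γ v w A q)
    (h' : I.Bounds Γ w u A r) : I.Bounds Γ v u A (q * r) := by
  obtain ⟨d₁, d₂, h⟩ := h
  obtain ⟨d₃, d₄, h'⟩ := h'
  obtain rfl := Subsingleton.elim d₂ d₃
  exact ⟨d₁, d₄, (mul_le_mul' h h').trans (VCategory.mul_le _ _ _)⟩

theorem Bounds.mono {Γ : Ctx G} {v w : Tm S} {A : Ty G} {q r : V} (h : I.Bounds Γ v w A q)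
    (hr : r ≤ q) : I.Bounds Γ v w A r := by
  obtain ⟨d, d', h⟩ := h
  exact ⟨d, d', hr.trans h⟩

theorem Bounds.le {Γ : Ctx G} {v w : Tm S} {A : Ty G} {q : V} (h : I.Bounds Γ v w A q)
    (d : Typed Γ v A) (d' : Typed Γ w A) : q ≤ VCategory.a (I.den d) (I.den d') :=
  h.satisfies d d'

theorem Bounds.exchange {Γ Δ : Ctx G} {v w : Tm S} {A : Ty G} {q : V} (h : I.Bounds Γ v w A q)
    (p : Δ.Perm Γ) : I.Bounds Δ v w A q := by
  obtain ⟨d, d', h⟩ := h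
  obtain ⟨π⟩ := Permutation.exists_of_perm p
  have hΔ := d.valid.of_perm p.symm
  obtain ⟨d₁, h₁⟩ := I.exchange d hΔ π
  obtain ⟨d₂, h₂⟩ := I.exchange d' hΔ π
  refine ⟨d₁, d₂, ?_⟩
  rw [h₁, h₂]
  exact h.trans (VCatEnriched.comp_left_le ..)

variable [VCatAutonomous C V]

open VCatEnriched VCatAutonomous

theorem Bounds.op {E : Ctx G} (f : S.Op) {Γs : Fin (S.arity f) → Ctx G}
    {vs ws : Fin (S.arity f) → Tm S} {q : Fin (S.arity f) → V}
    (h : ∀ i, I.Bounds (Γs i) (vs i) (ws i) (S.dom f i) (q i)) (s : ShuffleN Γs E) :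
    I.Bounds E (.op f vs) (.op f ws) (S.cod f) (∏ i, q i) := by
  choose d d' h using h
  refine ⟨.ax f d s, .ax f d' s, ?_⟩
  exact (Finset.prod_le_prod' fun i _ => h i).trans <| (nTensorHom_le ..).trans <|
    (comp_right_le ..).trans (comp_left_le ..)

theorem Bounds.tensor {Γ Δ E : Ctx G} {v w v' w' : Tm S} {A A' : Ty G} {q r : V}
    (h : I.Bounds Γ v w A q) (h' : I.Bounds Δ v' w' A' r) (s : Shuffle Γ Δ E) :
    I.Bounds E (.tensor v v') (.tensor w w') (.tensor A A') (q * r) := by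
  obtain ⟨d₁, d₂, h⟩ := h
  obtain ⟨d₃, d₄, h'⟩ := h'
  refine ⟨.tensorI d₁ d₃ s, .tensorI d₂ d₄ s, ?_⟩
  exact (mul_le_mul' h h').trans <| (tensorHom_le ..).trans (comp_left_le ..)

theorem Bounds.letPair {Γ Δ E : Ctx G} {v w v' w' : Tm S} {A A' D : Ty G} {q r : V}
    (h : I.Bounds Γ v w (.tensor A A') q)
    (h' : I.Bounds ((0, A') :: (1, A) :: Δ.lift 2) v' w' D r) (s : Shuffle Γ Δ E) :
    I.Bounds E (.letPair v v') (.letPair w w') D (q * r) := by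
  obtain ⟨d₁, d₂, h⟩ := h
  obtain ⟨d₃, d₄, h'⟩ := h'
  refine ⟨.tensorE d₁ d₃ s, .tensorE d₂ d₄ s, ?_⟩
  refine (mul_le_mul' (h.trans (whiskerRight_le _ _ (I.ctx Δ))) h').trans ?_
  refine le_trans ?_ (comp_left_le ..)
  refine le_trans (mul_le_mul' le_rfl ?_) (comp_le ..)
  exact (comp_left_le ..).trans <| (comp_left_le ..).trans (comp_left_le ..)

theorem Bounds.letUnit {Γ Δ E : Ctx G} {v w v' w' : Tm S} {A : Ty G} {q r : V}
    (h : I.Bounds Γ v w .unit q) (h' : I.Bounds Δ v' w' A r) (s : Shuffle Γ Δ E) :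
    I.Bounds E (.letUnit v v') (.letUnit w w') A (q * r) := by
  obtain ⟨d₁, d₂, h⟩ := h
  obtain ⟨d₃, d₄, h'⟩ := h'
  refine ⟨.unitE d₁ d₃ s, .unitE d₂ d₄ s, ?_⟩
  refine (mul_le_mul' (h.trans (whiskerRight_le _ _ (I.ctx Δ))) h').trans ?_
  refine le_trans ?_ (comp_left_le ..)
  exact le_trans (mul_le_mul' le_rfl (comp_left_le ..)) (comp_le ..)

theorem Bounds.lam {Γ : Ctx G} {v w : Tm S} {A A' : Ty G} {q : V}
    (h : I.Bounds ((0, A) :: Γ.lift 1) v w A' q) :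
    I.Bounds Γ (.lam A v) (.lam A w) (.lolli A A') q := by
  obtain ⟨d, d', h⟩ := h
  exact ⟨.lolliI d, .lolliI d', h.trans <| (comp_left_le ..).trans (transpose_le ..)⟩

theorem Bounds.app {Γ Δ E : Ctx G} {v w v' w' : Tm S} {A A' : Ty G} {q r : V}
    (h : I.Bounds Γ v w (.lolli A A') q) (h' : I.Bounds Δ v' w' A r) (s : Shuffle Γ Δ E) :
    I.Bounds E (.app v v') (.app w w') A' (q * r) := by
  obtain ⟨d₁, d₂, h⟩ := h
  obtain ⟨d₃, d₄, h'⟩ := h'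
  refine ⟨.lolliE d₁ d₃ s, .lolliE d₂ d₄ s, ?_⟩
  exact (mul_le_mul' h h').trans <| (tensorHom_le ..).trans <|
    (comp_right_le ..).trans (comp_left_le ..)

theorem Bounds.subst {Γ Δ : Ctx G} {v w v' w' : Tm S} {x : ℕ} {A A' : Ty G} {q r : V}
    (h : I.Bounds ((x, A) :: Γ) v w A' q) (h' : I.Bounds Δ v' w' A r) (hΓ : (Γ.cat Δ).Valid) :
    I.Bounds (Γ.cat Δ) (v.subst1 v' x) (w.subst1 w' x) A' (q * r) := by
  obtain ⟨d₁, d₂, h⟩ := h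
  obtain ⟨d₃, d₄, h'⟩ := h'
  obtain ⟨d, hd⟩ := I.exists_den_subst1 d₁ d₃ hΓ
  obtain ⟨d', hd'⟩ := I.exists_den_subst1 d₂ d₄ hΓ
  refine ⟨d, d', ?_⟩
  -- The substituted term is composed first, so its label comes out as the first factor.
  rw [hd, hd', mul_comm]
  refine le_trans ?_ (comp_left_le ..)
  exact le_trans (mul_le_mul' (h'.trans (whiskerLeft_le (I.ctx Γ) _ _))
    (h.trans (comp_left_le ..))) (comp_le ..)

/-- Induction on derivability. Membership of the label in `B` and typability of both sides are
carried along, since the inequality speaks of interpretations of actual derivations. -/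
theorem bounds_of_th (integral : (1 : V) = ⊤) {B : Set V} (basis : IsLatticeBasis B)
    (join_mem : ∀ A : Set V, A.Finite → A ⊆ B → sSup A ∈ B)
    (mul_mem : ∀ q ∈ B, ∀ r ∈ B, q * r ∈ B) (one_mem : (1 : V) ∈ B)
    {Ax : Set (VEquation S V)} (hAx : ∀ e ∈ Ax, e.InContext B ∧ I.Satisfies e)
    {Γ : Ctx G} {v w : Tm S} {A : Ty G} {q : V} (h : Th B Ax Γ v w A q) :
    q ∈ B ∧ I.Bounds Γ v w A q := by
  induction h with
  | ax h =>
    obtain ⟨⟨hq, ⟨d⟩, ⟨d'⟩⟩, hs⟩ := hAx _ h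
    exact ⟨hq, d, d', hs d d'⟩
  -- Equal interpretations give the bound `1`, which integrality turns into the label `⊤`.
  | eq h => exact integral ▸ ⟨one_mem, (I.eqDen_of_baseEq h).bounds⟩
  | eq_symm h => exact integral ▸ ⟨one_mem, (I.eqDen_of_baseEq h).symm.bounds⟩
  | refl d => exact integral ▸ ⟨one_mem, d, d, VCategory.unit_le _⟩
  | trans _ _ ih ih' => exact ⟨mul_mem _ ih.1 _ ih'.1, ih.2.trans ih'.2⟩
  | weak _ hr hle ih => exact ⟨hr, ih.2.mono hle⟩
  | arch hq _ ih =>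
    -- Non-emptiness of the set of basis elements way below `q` supplies the two derivations. Each
    -- such element is a lower bound of the distance, hence so is their least upper bound `q`.
    obtain ⟨⟨r, hr, hr'⟩, -, hlub⟩ := basis _
    obtain ⟨-, d, d', -⟩ := ih r hr hr'
    exact ⟨hq, d, d', hlub.2 fun s hs => (ih s hs.1 hs.2).2.le d d'⟩
  -- For `n = 0` there is no premise to take derivations from, so the typings in the rule itself are
  -- used.
  | join d d' _ ih =>
    exact ⟨join_mem _ (Set.finite_range _) (Set.range_subset_iff.2 fun i => (ih i).1), d, d',
      iSup_le fun i => (ih i).2.le d d'⟩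
  | op f _ s ih =>
    refine ⟨?_, .op f (fun i => (ih i).2) s⟩
    exact Finset.prod_induction _ (· ∈ B) (fun q r hq hr => mul_mem q hq r hr) one_mem
      fun i _ => (ih i).1
  | tensor _ _ s ih ih' => exact ⟨mul_mem _ ih.1 _ ih'.1, ih.2.tensor ih'.2 s⟩
  | letPair _ _ s ih ih' => exact ⟨mul_mem _ ih.1 _ ih'.1, ih.2.letPair ih'.2 s⟩
  | letUnit _ _ s ih ih' => exact ⟨mul_mem _ ih.1 _ ih'.1, ih.2.letUnit ih'.2 s⟩
  | lam _ ih => exact ⟨ih.1, ih.2.lam⟩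
  | app _ _ s ih ih' => exact ⟨mul_mem _ ih.1 _ ih'.1, ih.2.app ih'.2 s⟩
  | exchange _ p ih => exact ⟨ih.1, ih.2.exchange p⟩
  | subst _ _ hΓ ih ih' => exact ⟨mul_mem _ ih.1 _ ih'.1, ih.2.subst ih'.2 hΓ⟩

end Interpretation

end LinLam

theorem mainTheorem3
    {V : Type w} [CommMonoid V] [CompleteLattice V] [IsQuantale V]
    (integral : (1 : V) = ⊤) (continuous : IsContinuousLattice V)
    (B : Set V) (basis : IsLatticeBasis B)
    (join_mem : ∀ A : Set V, A.Finite → A ⊆ B → sSup A ∈ B)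
    (mul_mem : ∀ q ∈ B, ∀ r ∈ B, q * r ∈ B) (one_mem : (1 : V) ∈ B)
    {G : Type u} {S : Signature.{u, v} G}
    {C : Type u₁} [Category.{v₁} C] [MonoidalCategory C] [SymmetricCategory C]
    [MonoidalClosed C] [VCatEnriched V C] [VCatAutonomous C V]
    (I : Interpretation C S)
    (Ax : Set (VEquation S V)) (hAx : ∀ e ∈ Ax, e.InContext B ∧ I.Satisfies e)
    {Γ : Ctx G} {v w : Tm S} {A : Ty G} {q : V} (h : Th B Ax Γ v w A q) :
    VEquation.InContext B (⟨Γ, v, w, A, q⟩ : VEquation S V) ∧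
      I.Satisfies (⟨Γ, v, w, A, q⟩ : VEquation S V) := by
  obtain ⟨hq, d, d', h⟩ := I.bounds_of_th integral basis join_mem mul_mem one_mem hAx h
  exact ⟨⟨hq, ⟨d⟩, ⟨d'⟩⟩, Interpretation.Bounds.satisfies ⟨d, d', h⟩⟩
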